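/- **Setting.** Let $n\ge 1$ agents be joined by a connected graph $\mathcal G$, and consider $\min_{x\in\mathbb R^d} f(x)=\frac1n\sum_{i=1}^n f_i(x)$ with $f_i(x)=\mathbb E_{\xi\sim\mathcal D_i}[F_i(x,\xi)]$. Let $\|\cdot\|$ be the Euclidean norm (Frobenius norm for matrices), $\|\cdot\|_2$ the spectral norm, $J=\frac1n\mathbf 1\mathbf 1^\top$, and for $X=[x_1,\dots,x_n]\in\mathbb R^{d\times n}$ put $\bar x=\frac1n X\mathbf 1$ and $X_\perp=X(I-J)$. **Algorithm (DAMSCo, compressed decentralized AMSGrad).** Let $\alpha>0$, $\beta_1,\beta_2\in(0,1)$, $\delta>0$, $0<\gamma\le 1$, let $W\in\mathbb R^{n\times n}$, and let $\mathcal Q$ be a random compression operator. Start from $x_i^0=\underline x_i^0=m_i^{-1}=\widehat u_i^{-1}=u_i^{-1}=0$. For $t=0,1,\dots$ and all $i\in[n]$, draw a sample $\xi_i^t\sim\mathcal D_i$, put $g_i^t=\nabla F_i(x_i^t,\xi_i^t)$ (gradient in $x$), and, with componentwise operations, $$m_i^t=\beta_1m_i^{t-1}+(1-\beta_1)g_i^t,\quad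 \widehat u_i^t=\beta_2\widehat u_i^{t-1}+(1-\beta_2)\,g_i^t\circ g_i^t,\quad u_i^t=\max\{u_i^{t-1},\widehat u_i^t\},$$ $$x_i^{t+\frac12}=x_i^t-\alpha\frac{m_i^t}{\sqrt{u_i^t+\delta}},\quad \underline x_i^{t+1}=\underline x_i^t+\mathcal Q\big[x_i^{t+\frac12}-\underline x_i^t\big],\quad x_i^{t+1}=x_i^{t+\frac12}+\gamma\Big(\sum_{j=1}^nW_{ji}\,\underline x_j^{t+1}-\underline x_i^{t+1}\Big).$$ **Assumptions.** 1. The $f_i$ are differentiable with $\|\nabla f_i(x)-\nabla f_i(y)\|\le L\|x-y\|$ for all $x,y$, where $L\ge 0$, and $f^*=\inf f>-\infty$. 2. $W$ is doubly stochastic, $W_{ij}=0$ if $i\ne j$ are not neighbours in $\mathcal G$, $\operatorname{Null}(W-I)=\operatorname{span}\{\mathbf 1\}$, and $\rho=\|W-J\|_2<1$. 3. There is $\eta\in[0,1)$ with $\mathbb E_{\mathcal Q}\|x-\mathcal Q[x]\|^2\le\eta^2\|x\|^2$ for all $x\in\mathbb R^d$. 4. The samples $\xi_i^t$ are independent. The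 randomness of the compressions is independent of the samples and fresh in every iteration. For all $i,t$, almost surely, $\mathbb E_t[g_i^t]=\nabla f_i(x_i^t)$ ($\mathbb E_t$ is the expectation over $\xi_i^t$ with the iterate kept fixed), $\|g_i^t\|\le B$ and $\|g_i^t\|_\infty\le B_\infty$. Moreover $\|\nabla f_i(x)\|\le B$ and $\|\nabla f_i(x)\|_\infty\le B_\infty$ for all $x$ and $i$. Put $\widehat\rho=\|\gamma W+(1-\gamma)I-J\|_2$. **Theorem.** Under these assumptions $\widehat\rho<1$. Let $T\ge1$ and suppose (with $c/0=+\infty$) $$\alpha\le\min\Big\{\frac{\delta}{24L\sqrt{B_\infty^2+\delta}},\ \frac{(1-\eta^2)^2}{32}\Big\},\qquad \gamma\le\min\Big\{\frac{1-\widehat\rho^2}{60\eta},\ \frac{1-\eta^2}{25},\ \frac{\alpha}{\eta}\Big\}.$$ Let $$C=\frac{12}{1-\widehat\rho^2}\Big(\frac{4nB^2\widehat\rho^2}{\delta(1-\widehat\rho^2)}+\frac{nB^2}{45\delta}\Big)+\frac{320\,\alpha nB^2}{\delta(1-\eta^2)^2}$$ and $z^t=\bar x^t+\frac{\beta_1}{1-\beta_1}(\bar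 x^t-\bar x^{t-1})$ with $\bar x^{-1}=\bar x^0$. Then all expectations below are finite, $$\frac1T\sum_{t=0}^{T-1}\mathbb E\|X_\perp^t\|^2\le\alpha^2C,$$ and $$\begin{aligned} \frac{\alpha}{4\sqrt{B_\infty^2+\delta}}\sum_{t=0}^{T-1}\mathbb E\|\nabla f(\bar x^t)\|^2\le{}&\mathbb E[f(z^0)-f(z^T)]+\frac{\alpha\beta_1}{1-\beta_1}\frac{dB_\infty^2}{\sqrt\delta}+\frac{L\beta_1^2\alpha^2dB_\infty^2}{\delta(1-\beta_1)^2}+\frac{24L\alpha^2}{n\delta}TB^2\\ &+\Big(\frac{6L^3\alpha^2}{n\delta}+\frac{L^2\alpha}{n}\Big(\frac{\sqrt{B_\infty^2+\delta}}{\delta}+\frac1{2\sqrt\delta}\Big)\Big)\alpha^2CT+L\alpha^2B_\infty^4\frac{2d}{\delta^2}\sum_{t=0}^{T-1}(1-\beta_2^{t+1})\\ &+\alpha\sum_{t=0}^{T-1}\Big(\frac{dB_\infty^4}{\delta^{3/2}}(1-\beta_2^{t+1})+\frac{\alpha^2\beta_1^2L^2B^2}{\delta(1-\beta_1)^2}\Big(\frac{\sqrt{B_\infty^2+\delta}}{\delta}+\frac1{2\sqrt\delta}\Big)\Big).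 \end{aligned}$$ The last inequality also holds with $\mathbb E[f(z^0)-f(z^T)]$ replaced by $f(\bar x^0)-f^*$. -/

import Mathlib

open MeasureTheory ProbabilityTheory

noncomputable section

namespace DAMSCo

/-- `ℝ^d` with its Euclidean norm. -/
abbrev Vec (d : ℕ) : Type := EuclideanSpace ℝ (Fin d)

/-- The algorithmic parameters `α, β₁, β₂, δ, γ`. -/
structure Params where
  α : ℝ
  β₁ : ℝ
  β₂ : ℝ
  δ : ℝ
  γ : ℝ

/-- The ranges of the parameters required as input of the algorithm. -/
structure Params.Admissible (p : Params) : Prop where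
  α_pos : 0 < p.α
  β₁_pos : 0 < p.β₁
  β₁_lt_one : p.β₁ < 1
  β₂_pos : 0 < p.β₂
  β₂_lt_one : p.β₂ < 1
  δ_pos : 0 < p.δ
  γ_pos : 0 < p.γ
  γ_le_one : p.γ ≤ 1

/-- What the `n` agents store at the beginning of iteration `t`: the local models `x = x^t`, their
estimates `xu` (written `\underline{x}^t`), and the momentum terms `m = m^{t-1}`,
`uh = \widehat{u}^{t-1}` and `u = u^{t-1}`. -/
structure State (n d : ℕ) where
  x : Fin n → Vec d
  xu : Fin n → Vec d
  m : Fin n → Vec d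
  uh : Fin n → Vec d
  u : Fin n → Vec d

/-- All variables are initialised to `0`. -/
def State.init (n d : ℕ) : State n d where
  x := 0
  xu := 0
  m := 0
  uh := 0
  u := 0

/-- One iteration, performed by all agents in parallel. `grad i x s` is the stochastic gradient of
agent `i` at `x` with sample `s`; `Q r` is the compression operator with random seed `r`; `s i` and
`r i` are the sample and the seed drawn by agent `i`. All operations on `g ∘ g`, `max`, the square
root and the quotient are componentwise. -/
def step {n d : ℕ} {Ξ Z : Type*} (p : Params) (W : Matrix (Fin n) (Fin n) ℝ)
    (grad : Fin n → Vec d → Ξ → Vec d) (Q : Z → Vec d → Vec d)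
    (st : State n d) (s : Fin n → Ξ) (r : Fin n → Z) : State n d :=
  let g : Fin n → Vec d := fun i => grad i (st.x i) (s i)
  let m : Fin n → Vec d := fun i => p.β₁ • st.m i + (1 - p.β₁) • g i
  let uh : Fin n → Vec d := fun i =>
    WithLp.toLp 2 fun k => p.β₂ * st.uh i k + (1 - p.β₂) * (g i k * g i k)
  let u : Fin n → Vec d := fun i => WithLp.toLp 2 fun k => max (st.u i k) (uh i k)
  let xHalf : Fin n → Vec d := fun i =>
    WithLp.toLp 2 fun k => st.x i k - p.α * (m i k / √(u i k + p.δ))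
  let xu : Fin n → Vec d := fun i => st.xu i + Q (r i) (xHalf i - st.xu i)
  { x := fun i => xHalf i + p.γ • ((∑ j, W j i • xu j) - xu i)
    xu := xu
    m := m
    uh := uh
    u := u }

/-- The state after `t` iterations, for given sequences of samples and of compression seeds. -/
def run {n d : ℕ} {Ξ Z : Type*} (p : Params) (W : Matrix (Fin n) (Fin n) ℝ)
    (grad : Fin n → Vec d → Ξ → Vec d) (Q : Z → Vec d → Vec d)
    (s : ℕ → Fin n → Ξ) (r : ℕ → Fin n → Z) : ℕ → State n d
  | 0 => State.init n d
  | t + 1 => step p W grad Q (run p W grad Q s r t) (s t) (r t)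

/-- The stochastic gradient `∇F_i(x, s)`, the gradient being taken in `x`. -/
def stochGrad {n d : ℕ} {Ξ : Type*} (F : Fin n → Vec d → Ξ → ℝ) (i : Fin n) (x : Vec d) (s : Ξ) :
    Vec d :=
  gradient (fun y => F i y s) x

/-- The global objective `f = (1/n) ∑ f_i`. -/
def globalObj {n d : ℕ} (f : Fin n → Vec d → ℝ) (x : Vec d) : ℝ :=
  (1 / (n : ℝ)) * ∑ i, f i x

/-- The average `(1/n) ∑ x_i` of the local models. -/
def avg {n d : ℕ} (X : Fin n → Vec d) : Vec d :=
  (1 / (n : ℝ)) • ∑ i, X i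

/-- The squared Frobenius norm `‖X (I - J)‖² = ∑ ‖x_i - avg X‖²`. -/
def consensusError {n d : ℕ} (X : Fin n → Vec d) : ℝ :=
  ∑ i, ‖X i - avg X‖ ^ 2

/-- The auxiliary sequence `z^t = a^t + β₁ / (1 - β₁) (a^t - a^{t-1})` attached to a sequence `a`,
with the convention `a^{-1} = a^0` (here `0 - 1 = 0`). -/
def auxSeq {d : ℕ} (β₁ : ℝ) (a : ℕ → Vec d) (t : ℕ) : Vec d :=
  a t + (β₁ / (1 - β₁)) • (a t - a (t - 1))

/-- The averaging matrix `J = 1 1ᵀ / n`. -/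
def avgMatrix (n : ℕ) : Matrix (Fin n) (Fin n) ℝ :=
  Matrix.of fun _ _ => 1 / (n : ℝ)

/-- The spectral norm of a real square matrix. -/
def specNorm {n : ℕ} (A : Matrix (Fin n) (Fin n) ℝ) : ℝ :=
  ‖Matrix.toEuclideanCLM (n := Fin n) (𝕜 := ℝ) A‖

/-- `\widehat{ρ} = ‖γ W + (1 - γ) I - J‖₂`. -/
def rhoHat {n : ℕ} (γ : ℝ) (W : Matrix (Fin n) (Fin n) ℝ) : ℝ :=
  specNorm (γ • W + (1 - γ) • (1 : Matrix (Fin n) (Fin n) ℝ) - avgMatrix n)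

/-- `W` is a mixing matrix for the communication graph `G`. -/
structure IsMixingMatrix {n : ℕ} (G : SimpleGraph (Fin n)) (W : Matrix (Fin n) (Fin n) ℝ) :
    Prop where
  doublyStochastic : W ∈ doublyStochastic ℝ (Fin n)
  eq_zero_of_not_adj : ∀ i j, i ≠ j → ¬ G.Adj i j → W i j = 0
  ker_eq : LinearMap.ker (Matrix.toLin' (W - 1)) = Submodule.span ℝ {fun _ : Fin n => (1 : ℝ)}
  rho_lt_one : specNorm (W - avgMatrix n) < 1

/-- The random operator `Q`, with seed distributed according to `ν`, satisfies
`E_Q ‖x - Q[x]‖² ≤ η² ‖x‖²` for all `x`. -/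
structure IsCompressor {d : ℕ} {Z : Type*} [MeasurableSpace Z] (ν : Measure Z)
    (Q : Z → Vec d → Vec d) (η : ℝ) : Prop where
  measurable : Measurable fun v : Z × Vec d => Q v.1 v.2
  integrable : ∀ x, Integrable (fun r => ‖x - Q r x‖ ^ 2) ν
  le : ∀ x, ∫ r, ‖x - Q r x‖ ^ 2 ∂ν ≤ η ^ 2 * ‖x‖ ^ 2

/-- The local objectives are well defined as the expectations of the sample losses `F_i(x, ·)`,
which are differentiable in `x` for almost every sample; the `f_i` are `L`-smooth; and
`f = (1/n) ∑ f_i` is bounded below. -/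
structure IsSmoothProblem {n d : ℕ} {Ξ : Type*} [MeasurableSpace Ξ] (D : Fin n → Measure Ξ)
    (F : Fin n → Vec d → Ξ → ℝ) (f : Fin n → Vec d → ℝ) (L : ℝ) : Prop where
  integrable : ∀ i x, Integrable (F i x) (D i)
  eq_integral : ∀ i x, f i x = ∫ s, F i x s ∂(D i)
  differentiableAt_sample : ∀ i x, ∀ᵐ s ∂(D i), DifferentiableAt ℝ (fun y => F i y s) x
  measurable_stochGrad : ∀ i, Measurable fun v : Vec d × Ξ => stochGrad F i v.1 v.2
  L_nonneg : 0 ≤ L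
  differentiable : ∀ i, Differentiable ℝ (f i)
  smooth : ∀ i x y, ‖gradient (f i) x - gradient (f i) y‖ ≤ L * ‖x - y‖
  bddBelow : BddBelow (Set.range (globalObj f))

/-- The samples `ξ i t` (agent `i`, iteration `t`) are independent with `ξ i t ∼ D i`. The seeds
`ζ i t` of the compressions have law `ν` and are drawn independently of the samples and afresh in
every iteration; within one iteration the seeds of different agents may depend on each other. -/
structure IsSampling {n : ℕ} {Ξ Z Ω : Type*} [MeasurableSpace Ξ] [MeasurableSpace Z]
    [MeasurableSpace Ω] (P : Measure Ω) (D : Fin n → Measure Ξ) (ν : Measure Z)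
    (ξ : Fin n → ℕ → Ω → Ξ) (ζ : Fin n → ℕ → Ω → Z) : Prop where
  measurable_sample : ∀ i t, Measurable (ξ i t)
  measurable_seed : ∀ i t, Measurable (ζ i t)
  map_sample : ∀ i t, P.map (ξ i t) = D i
  map_seed : ∀ i t, P.map (ζ i t) = ν
  indep_sample : iIndepFun (fun (v : Fin n × ℕ) => ξ v.1 v.2) P
  indep_seed : iIndepFun (fun (t : ℕ) (ω : Ω) (i : Fin n) => ζ i t ω) P
  indep : IndepFun (fun (ω : Ω) (v : Fin n × ℕ) => ξ v.1 v.2 ω)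
    (fun (ω : Ω) (v : Fin n × ℕ) => ζ v.1 v.2 ω) P

/-- Along the iterates `X t ω i = x_i^t`, the stochastic gradients `g_i^t = ∇F_i(x_i^t, ξ_i^t)` are
unbiased (the expectation being over a fresh sample with the iterate kept fixed) and bounded by `B`
and `Binf` in the Euclidean and the maximum norm; the gradients of the `f_i` satisfy the same bounds
everywhere. -/
structure HasBoundedGradients {n d : ℕ} {Ξ Ω : Type*} [MeasurableSpace Ξ]
    [MeasurableSpace Ω] (P : Measure Ω) (D : Fin n → Measure Ξ)
    (F : Fin n → Vec d → Ξ → ℝ) (f : Fin n → Vec d → ℝ) (ξ : Fin n → ℕ → Ω → Ξ)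
    (X : ℕ → Ω → Fin n → Vec d) (B Binf : ℝ) : Prop where
  unbiased : ∀ i t, ∀ᵐ ω ∂P,
    ∫ s, stochGrad F i (X t ω i) s ∂(D i) = gradient (f i) (X t ω i)
  stoch_le : ∀ i t, ∀ᵐ ω ∂P, ‖stochGrad F i (X t ω i) (ξ i t ω)‖ ≤ B
  stoch_inf_le : ∀ i t, ∀ᵐ ω ∂P, ∀ k, |stochGrad F i (X t ω i) (ξ i t ω) k| ≤ Binf
  grad_le : ∀ i x, ‖gradient (f i) x‖ ≤ B
  grad_inf_le : ∀ i x k, |gradient (f i) x k| ≤ Binf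

/-- The constant `C` of the consensus bound. -/
def consensusConst (n : ℕ) (α δ η B ρ : ℝ) : ℝ :=
  12 / (1 - ρ ^ 2) * (4 * n * B ^ 2 * ρ ^ 2 / (δ * (1 - ρ ^ 2)) + n * B ^ 2 / (45 * δ))
    + 320 * α * n * B ^ 2 / (δ * (1 - η ^ 2) ^ 2)

/-- The bound on the gradients, with initial-gap term `gap` and consensus constant `C`. -/
def gradientBound (n d T : ℕ) (p : Params) (L B Binf C gap : ℝ) : ℝ :=
  gap
    + p.α * p.β₁ / (1 - p.β₁) * (d * Binf ^ 2 / √p.δ)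
    + L * p.β₁ ^ 2 * p.α ^ 2 * d * Binf ^ 2 / (p.δ * (1 - p.β₁) ^ 2)
    + 24 * L * p.α ^ 2 / (n * p.δ) * T * B ^ 2
    + (6 * L ^ 3 * p.α ^ 2 / (n * p.δ)
        + L ^ 2 * p.α / n * (√(Binf ^ 2 + p.δ) / p.δ + 1 / (2 * √p.δ))) * p.α ^ 2 * C * T
    + L * p.α ^ 2 * Binf ^ 4 * (2 * d / p.δ ^ 2)
        * ∑ t ∈ Finset.range T, (1 - p.β₂ ^ (t + 1))
    + p.α * ∑ t ∈ Finset.range T,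
        (d * Binf ^ 4 / p.δ ^ (3 / 2 : ℝ) * (1 - p.β₂ ^ (t + 1))
          + p.α ^ 2 * p.β₁ ^ 2 * L ^ 2 * B ^ 2 / (p.δ * (1 - p.β₁) ^ 2)
            * (√(Binf ^ 2 + p.δ) / p.δ + 1 / (2 * √p.δ)))

end DAMSCo

end

/-! Two estimates are proved separately and then joined. Write s = 1 - ρ̂², κ = 1 - η², Ŵ = γW + (1
- γ)I, Y^t for the steps α m^t/√(u^t + δ), R^t for the compressed vectors x^{t+1/2} -
\underline{x}^t, and E for their compression errors.

Consensus. Doubly stochastic gossip preserves averages, so X_⊥^{t+1} = (X_⊥^t - Y^t)(Ŵ - J) + γE(W -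
I), while R^{t+1} = E(γ(W - I) - I) + γX^{t+1/2}(W - I) - Y^{t+1}. Young's inequality turns both
identities into pathwise bounds (`consensusError_step_le`, `residual_step_le`), with ‖Y^t‖² ≤
nα²B²/δ because u ≥ 0. Each seed is independent of the vector it compresses, so the mean square of E
is at most η² times that of R^t (`integral_sum_comprErr_le`). The mean squares of X_⊥ and R thus
obey a coupled linear recursion with contraction rates s/2 and κ/2. Summing over time and
eliminating R (`sum_le_of_coupled_recursion`) works because the conditions on γ and α make the
coupling small.

Descent. The sequence z^t is built so that the momentum cancels: its increment is -α/√δ times the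
average stochastic gradient plus two errors (`auxSeq_run_succ`). Freezing the preconditioner at its
initial value 1/√δ gives the leading term a deterministic coefficient, so unbiasedness can be used
against ∇f(z^t) although u^t depends on the current sample. The price of freezing is linear in u^t ≤
(1 - β₂^{t+1})B_∞². The other error is momentum times the change of the preconditioner; the maximum
in the definition of u makes the preconditioner nonincreasing, so these errors telescope. The
descent lemma then gives a pathwise inequality (`sum_descent_le`). In expectation the averaged noise
is orthogonal to what the past determines, and its variance is at most 4B²/n by independence across
agents (`integral_norm_avg_noise_sq_le`). The consensus bound controls the local gradients'
deviation from ∇f at the average, and `sum_le_gradientBound` compares the constants. -/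

namespace DAMSCo

/-! ### Averages, deviations and elementary norm inequalities -/

section Algebra

variable {n d : ℕ}

/-- Young's inequality in convex form. -/
theorem norm_add_sq_le_div {E : Type*} [SeminormedAddCommGroup E] (a b : E) {θ : ℝ} (h0 : 0 < θ)
    (h1 : θ < 1) : ‖a + b‖ ^ 2 ≤ ‖a‖ ^ 2 / θ + ‖b‖ ^ 2 / (1 - θ) := by
  have h2 : 0 < 1 - θ := by linarith
  have h3 : ‖a + b‖ ^ 2 ≤ (‖a‖ + ‖b‖) ^ 2 := by
    gcongr
    exact norm_add_le a b
  refine h3.trans ?_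
  rw [div_add_div _ _ h0.ne' h2.ne', le_div_iff₀ (mul_pos h0 h2)]
  nlinarith [sq_nonneg ((1 - θ) * ‖a‖ - θ * ‖b‖)]

theorem norm_add_sq_le_two {E : Type*} [SeminormedAddCommGroup E] (a b : E) :
    ‖a + b‖ ^ 2 ≤ 2 * ‖a‖ ^ 2 + 2 * ‖b‖ ^ 2 := by
  have := norm_add_sq_le_div a b (θ := 1 / 2) (by norm_num) (by norm_num)
  norm_num at this
  linarith

theorem norm_sub_sq_le_two {E : Type*} [SeminormedAddCommGroup E] (a b : E) :
    ‖a - b‖ ^ 2 ≤ 2 * ‖a‖ ^ 2 + 2 * ‖b‖ ^ 2 := by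
  simpa [sub_eq_add_neg] using norm_add_sq_le_two a (-b)

/-- The squared norm of a convex combination is at most the combination of the squared norms. -/
theorem norm_sum_smul_sq_le {ι E : Type*} [Fintype ι] [SeminormedAddCommGroup E] [NormedSpace ℝ E]
    (w : ι → ℝ) (hw0 : ∀ i, 0 ≤ w i) (hw1 : ∑ i, w i = 1) (v : ι → E) :
    ‖∑ i, w i • v i‖ ^ 2 ≤ ∑ i, w i * ‖v i‖ ^ 2 := by
  have h := (convexOn_pow 2).map_sum_le (t := Finset.univ) (w := w) (p := fun i => ‖v i‖)
    (fun i _ => hw0 i) hw1 (fun i _ => norm_nonneg _)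
  have h2 : ‖∑ i, w i • v i‖ ≤ ∑ i, w i • ‖v i‖ := by
    refine (norm_sum_le _ _).trans (le_of_eq (Finset.sum_congr rfl fun i _ => ?_))
    rw [norm_smul, Real.norm_of_nonneg (hw0 i), smul_eq_mul]
  calc ‖∑ i, w i • v i‖ ^ 2 ≤ (∑ i, w i • ‖v i‖) ^ 2 := by gcongr
    _ ≤ _ := by simpa using h

theorem norm_avg_sq_le (hn : 0 < n) (X : Fin n → Vec d) :
    ‖avg X‖ ^ 2 ≤ 1 / (n : ℝ) * ∑ i, ‖X i‖ ^ 2 := by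
  have hn' : (n : ℝ) ≠ 0 := by positivity
  have h := norm_sum_smul_sq_le (fun _ : Fin n => 1 / (n : ℝ)) (fun _ => by positivity)
    (by simp [hn']) X
  rwa [← Finset.smul_sum, ← Finset.mul_sum] at h

theorem norm_avg_le (hn : 0 < n) (X : Fin n → Vec d) {c : ℝ} (hX : ∀ i, ‖X i‖ ≤ c) :
    ‖avg X‖ ≤ c := by
  have hn' : (0 : ℝ) < n := by positivity
  rw [avg, norm_smul, Real.norm_of_nonneg (by positivity)]
  have : ‖∑ i, X i‖ ≤ n * c := by
    refine (norm_sum_le_of_le _ fun i _ => hX i).trans ?_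
    simp
  rw [one_div, inv_mul_le_iff₀ hn']
  exact this

theorem avg_add (X Y : Fin n → Vec d) : avg (fun i => X i + Y i) = avg X + avg Y := by
  simp [avg, Finset.sum_add_distrib]

theorem avg_sub (X Y : Fin n → Vec d) : avg (fun i => X i - Y i) = avg X - avg Y := by
  simp [avg, Finset.sum_sub_distrib, smul_sub]

theorem avg_smul (c : ℝ) (X : Fin n → Vec d) : avg (fun i => c • X i) = c • avg X := by
  simp only [avg, ← Finset.smul_sum, smul_comm c]

theorem inner_avg_left (X : Fin n → Vec d) (v : Vec d) :
    inner ℝ (avg X) v = 1 / (n : ℝ) * ∑ i, inner ℝ (X i) v := by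
  rw [avg, real_inner_smul_left, sum_inner]

theorem inner_avg_right (X : Fin n → Vec d) (v : Vec d) :
    inner ℝ v (avg X) = 1 / (n : ℝ) * ∑ i, inner ℝ v (X i) := by
  rw [avg, real_inner_smul_right, inner_sum]

theorem consensusError_nonneg (X : Fin n → Vec d) : 0 ≤ consensusError X :=
  Finset.sum_nonneg fun _ _ => sq_nonneg _

theorem consensusError_eq (hn : 0 < n) (X : Fin n → Vec d) :
    consensusError X = ∑ i, ‖X i‖ ^ 2 - n * ‖avg X‖ ^ 2 := by
  have hn' : (n : ℝ) ≠ 0 := by positivity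
  have h : ∑ i, inner ℝ (X i) (avg X) = n * ‖avg X‖ ^ 2 := by
    rw [← real_inner_self_eq_norm_sq, inner_avg_left]
    field_simp
  simp only [consensusError, norm_sub_sq_real, Finset.sum_add_distrib, Finset.sum_sub_distrib,
    ← Finset.mul_sum, h]
  simp
  ring

theorem consensusError_le (hn : 0 < n) (X : Fin n → Vec d) :
    consensusError X ≤ ∑ i, ‖X i‖ ^ 2 := by
  rw [consensusError_eq hn]
  have : 0 ≤ (n : ℝ) * ‖avg X‖ ^ 2 := by positivity
  linarith

theorem consensusError_sub_le (X Y : Fin n → Vec d) :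
    consensusError (fun i => X i - Y i) ≤ 2 * consensusError X + 2 * consensusError Y := by
  simp only [consensusError, avg_sub, Finset.mul_sum, ← Finset.sum_add_distrib]
  refine Finset.sum_le_sum fun i _ => ?_
  rw [sub_sub_sub_comm]
  exact norm_sub_sq_le_two _ _

end Algebra

/-! ### The mixing matrix and spectral norms -/

section Mixing

variable {n d : ℕ}

theorem norm_sq_eq_sum_coord (v : Vec d) : ‖v‖ ^ 2 = ∑ k, v k ^ 2 := by
  simp [EuclideanSpace.norm_sq_eq]

/-- Mixing columns with a matrix expands the Frobenius norm at most by the spectral norm. -/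
theorem sum_norm_sum_smul_sq_le_specNorm (M : Matrix (Fin n) (Fin n) ℝ) (X : Fin n → Vec d) :
    ∑ i, ‖∑ j, M j i • X j‖ ^ 2 ≤ specNorm M ^ 2 * ∑ i, ‖X i‖ ^ 2 := by
  have hT : specNorm M.transpose = specNorm M := by
    have h : M.transpose = star M := by
      ext i j
      simp [Matrix.star_apply]
    rw [specNorm, specNorm, h, map_star, ContinuousLinearMap.star_eq_adjoint,
      LinearIsometryEquiv.norm_map]
  have key : ∀ k : Fin d, ∑ i, (∑ j, M j i * X j k) ^ 2 ≤ specNorm M ^ 2 * ∑ i, X i k ^ 2 := by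
    intro k
    have h := (Matrix.toEuclideanCLM (n := Fin n) (𝕜 := ℝ) M.transpose).le_opNorm
      (WithLp.toLp 2 fun j => X j k)
    have h2 := pow_le_pow_left₀ (norm_nonneg _) h 2
    rw [mul_pow, norm_sq_eq_sum_coord, norm_sq_eq_sum_coord] at h2
    rw [← hT]
    simpa [specNorm, Matrix.mulVec, dotProduct] using h2
  simp only [norm_sq_eq_sum_coord]
  rw [Finset.sum_comm]
  refine (Finset.sum_le_sum (g := fun k => specNorm M ^ 2 * ∑ i, X i k ^ 2) fun k _ => ?_).trans ?_
  · simpa using key k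
  · rw [← Finset.mul_sum, Finset.sum_comm]

/-- The matrix I - J is an orthogonal projection; applying `consensusError_le` with d = 1 to the
entries of v says exactly that it does not expand norms. -/
theorem specNorm_one_sub_avgMatrix_le (hn : 0 < n) : specNorm (1 - avgMatrix n) ≤ 1 := by
  refine ContinuousLinearMap.opNorm_le_bound _ zero_le_one fun v => ?_
  have hn' : (0 : ℝ) < n := by positivity
  rw [one_mul]
  refine le_of_sq_le_sq ?_ (norm_nonneg _)
  have h := consensusError_le hn (fun i => (WithLp.toLp 2 (fun _ : Fin 1 => v i) : Vec 1))
  simp only [consensusError, norm_sq_eq_sum_coord] at h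
  rw [norm_sq_eq_sum_coord, norm_sq_eq_sum_coord]
  simpa [avg, avgMatrix, Matrix.sub_mulVec, Matrix.mulVec, dotProduct, Finset.mul_sum] using h

theorem rhoHat_nonneg (γ : ℝ) (W : Matrix (Fin n) (Fin n) ℝ) : 0 ≤ rhoHat γ W := norm_nonneg _

/-- Ŵ - J is the convex combination γ(W - J) + (1 - γ)(I - J) of a strict contraction and a
projection, and the contraction has positive weight. -/
theorem rhoHat_lt_one (hn : 0 < n) {γ : ℝ} (h0 : 0 < γ) (h1 : γ ≤ 1)
    {W : Matrix (Fin n) (Fin n) ℝ} (hW : specNorm (W - avgMatrix n) < 1) : rhoHat γ W < 1 := by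
  have h : γ • W + (1 - γ) • (1 : Matrix (Fin n) (Fin n) ℝ) - avgMatrix n
      = γ • (W - avgMatrix n) + (1 - γ) • (1 - avgMatrix n) := by
    module
  have h2 := specNorm_one_sub_avgMatrix_le hn
  calc rhoHat γ W ≤ γ * specNorm (W - avgMatrix n) + (1 - γ) * specNorm (1 - avgMatrix n) := by
        rw [rhoHat, h, specNorm, map_add, map_smul, map_smul]
        refine (norm_add_le _ _).trans (le_of_eq ?_)
        rw [norm_smul, norm_smul, Real.norm_of_nonneg h0.le,
          Real.norm_of_nonneg (by linarith : 0 ≤ 1 - γ)]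
        rfl
    _ < 1 := by nlinarith

variable {W : Matrix (Fin n) (Fin n) ℝ}

theorem avg_sum_smul (hW : W ∈ doublyStochastic ℝ (Fin n)) (X : Fin n → Vec d) :
    avg (fun i => ∑ j, W j i • X j) = avg X := by
  rw [avg, avg, Finset.sum_comm]
  congr 1
  refine Finset.sum_congr rfl fun j _ => ?_
  rw [← Finset.sum_smul, sum_row_of_mem_doublyStochastic hW, one_smul]

theorem sum_norm_sum_smul_sq_le (hW : W ∈ doublyStochastic ℝ (Fin n)) (X : Fin n → Vec d) :
    ∑ i, ‖∑ j, W j i • X j‖ ^ 2 ≤ ∑ i, ‖X i‖ ^ 2 := by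
  calc ∑ i, ‖∑ j, W j i • X j‖ ^ 2 ≤ ∑ i, ∑ j, W j i * ‖X j‖ ^ 2 :=
        Finset.sum_le_sum fun i _ => norm_sum_smul_sq_le _
          (fun j => nonneg_of_mem_doublyStochastic hW) (sum_col_of_mem_doublyStochastic hW i) X
    _ = ∑ i, ‖X i‖ ^ 2 := by
        rw [Finset.sum_comm]
        refine Finset.sum_congr rfl fun j _ => ?_
        rw [← Finset.sum_mul, sum_row_of_mem_doublyStochastic hW, one_mul]

theorem sum_norm_sum_smul_sub_sq_le (hW : W ∈ doublyStochastic ℝ (Fin n)) (X : Fin n → Vec d) :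
    ∑ i, ‖(∑ j, W j i • X j) - X i‖ ^ 2 ≤ 4 * ∑ i, ‖X i‖ ^ 2 := by
  have h := sum_norm_sum_smul_sq_le hW X
  calc ∑ i, ‖(∑ j, W j i • X j) - X i‖ ^ 2
      ≤ ∑ i, (2 * ‖∑ j, W j i • X j‖ ^ 2 + 2 * ‖X i‖ ^ 2) :=
        Finset.sum_le_sum fun i _ => norm_sub_sq_le_two _ _
    _ ≤ _ := by
        rw [Finset.sum_add_distrib, ← Finset.mul_sum, ← Finset.mul_sum]
        linarith

/-- Mixing deviations: `X (W - I) = X_⊥ (W - I)`. -/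
theorem sum_norm_sum_smul_sub_sq_le_consensusError (hW : W ∈ doublyStochastic ℝ (Fin n))
    (X : Fin n → Vec d) :
    ∑ i, ‖(∑ j, W j i • X j) - X i‖ ^ 2 ≤ 4 * consensusError X := by
  have h := sum_norm_sum_smul_sub_sq_le hW fun i => X i - avg X
  refine le_trans (le_of_eq (Finset.sum_congr rfl fun i _ => ?_)) h
  congr 2
  simp only [smul_sub, Finset.sum_sub_distrib, ← Finset.sum_smul,
    sum_col_of_mem_doublyStochastic hW, one_smul]
  abel

/-- The compression error enters the next residual through `γ (W - I) - I`. -/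
theorem sum_norm_smul_sub_sub_sq_le (hW : W ∈ doublyStochastic ℝ (Fin n)) {γ : ℝ} (hγ : 0 ≤ γ)
    (X : Fin n → Vec d) :
    ∑ i, ‖γ • ((∑ j, W j i • X j) - X i) - X i‖ ^ 2 ≤ (1 + 2 * γ) ^ 2 * ∑ i, ‖X i‖ ^ 2 := by
  have h := sum_norm_sum_smul_sq_le hW X
  have key : ∀ i, ‖γ • ((∑ j, W j i • X j) - X i) - X i‖ ^ 2
      ≤ (1 + 2 * γ) * (γ * ‖∑ j, W j i • X j‖ ^ 2 + (1 + γ) * ‖X i‖ ^ 2) := by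
    intro i
    set a := ∑ j, W j i • X j
    have e : γ • (a - X i) - X i = γ • a - (1 + γ) • X i := by module
    have h1 : ‖γ • (a - X i) - X i‖ ≤ γ * ‖a‖ + (1 + γ) * ‖X i‖ := by
      rw [e]
      refine (norm_sub_le _ _).trans (le_of_eq ?_)
      rw [norm_smul, norm_smul, Real.norm_of_nonneg hγ,
        Real.norm_of_nonneg (by linarith : 0 ≤ 1 + γ)]
    have h2 := pow_le_pow_left₀ (norm_nonneg _) h1 2
    nlinarith [mul_nonneg (mul_nonneg hγ (by linarith : 0 ≤ 1 + γ)) (sq_nonneg (‖a‖ - ‖X i‖))]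
  calc _ ≤ ∑ i, (1 + 2 * γ) * (γ * ‖∑ j, W j i • X j‖ ^ 2 + (1 + γ) * ‖X i‖ ^ 2) :=
        Finset.sum_le_sum fun i _ => key i
    _ = (1 + 2 * γ) * (γ * ∑ i, ‖∑ j, W j i • X j‖ ^ 2 + (1 + γ) * ∑ i, ‖X i‖ ^ 2) := by
        rw [← Finset.mul_sum, Finset.sum_add_distrib, ← Finset.mul_sum, ← Finset.mul_sum]
    _ ≤ (1 + 2 * γ) * (γ * ∑ i, ‖X i‖ ^ 2 + (1 + γ) * ∑ i, ‖X i‖ ^ 2) := by gcongr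
    _ = _ := by ring

/-- A relaxed mixing step, `(X Ŵ)_⊥ = X_⊥ (Ŵ - J)`, contracts the consensus error. -/
theorem sub_avg_eq_sum_smul (hn : 0 < n) (hW : W ∈ doublyStochastic ℝ (Fin n)) (γ : ℝ)
    (X : Fin n → Vec d) (i : Fin n) :
    X i + γ • ((∑ j, W j i • X j) - X i) - avg X
      = ∑ j, (γ • W + (1 - γ) • (1 : Matrix (Fin n) (Fin n) ℝ) - avgMatrix n) j i
          • (X j - avg X) := by
  have hn' : (n : ℝ) ≠ 0 := by positivity
  -- The columns of Ŵ - J sum to zero, so subtracting the average from every X j changes nothing.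
  have h1 : ∑ j, (γ • W + (1 - γ) • (1 : Matrix (Fin n) (Fin n) ℝ) - avgMatrix n) j i = 0 := by
    simp [avgMatrix, Finset.sum_sub_distrib, Finset.sum_add_distrib, ← Finset.mul_sum,
      sum_col_of_mem_doublyStochastic hW, Matrix.one_apply, hn']
  simp only [smul_sub, Finset.sum_sub_distrib, ← Finset.sum_smul, h1, zero_smul, sub_zero]
  have h2 : ∀ j, (γ • W + (1 - γ) • (1 : Matrix (Fin n) (Fin n) ℝ) - avgMatrix n) j i • X j
      = γ • W j i • X j + (1 - γ) • (if j = i then X j else 0) - (1 / (n : ℝ)) • X j := by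
    intro j
    simp only [Matrix.sub_apply, Matrix.add_apply, Matrix.smul_apply, Matrix.one_apply, avgMatrix,
      Matrix.of_apply, smul_eq_mul]
    split_ifs <;> module
  simp only [h2, Finset.sum_sub_distrib, Finset.sum_add_distrib, ← Finset.smul_sum,
    Finset.sum_ite_eq', Finset.mem_univ, if_true, avg]
  module

end Mixing

/-! ### Pathwise recursions for one iteration -/

section Step

variable {n d : ℕ} {Ξ Z : Type*}

/-- The preconditioned momentum `m / √(u + δ)`. -/
noncomputable def State.dir (δ : ℝ) (st : State n d) (i : Fin n) : Vec d :=
  WithLp.toLp 2 fun k => st.m i k / √(st.u i k + δ)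

/-- The models `x^{t+1/2}` between the states `st` and `st'` of consecutive iterations. -/
noncomputable def halfModel (p : Params) (st st' : State n d) (i : Fin n) : Vec d :=
  st.x i - p.α • st'.dir p.δ i

/-- The vectors `x^{t+1/2} - \underline{x}^t` that are compressed. -/
noncomputable def residual (p : Params) (st st' : State n d) (i : Fin n) : Vec d :=
  halfModel p st st' i - st.xu i

/-- The errors `\underline{x}^{t+1} - x^{t+1/2}` made by the compression. -/
noncomputable def comprErr (p : Params) (Q : Z → Vec d → Vec d) (st st' : State n d) (r : Fin n → Z)
    (i : Fin n) : Vec d :=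
  Q (r i) (residual p st st' i) - residual p st st' i

variable (p : Params) (W : Matrix (Fin n) (Fin n) ℝ) (grad : Fin n → Vec d → Ξ → Vec d)
  (Q : Z → Vec d → Vec d) (st : State n d) (s : Fin n → Ξ) (r : Fin n → Z)

theorem step_xu (i : Fin n) :
    (step p W grad Q st s r).xu i
      = halfModel p st (step p W grad Q st s r) i
        + comprErr p Q st (step p W grad Q st s r) r i := by
  have h : (step p W grad Q st s r).xu i
      = st.xu i + Q (r i) (residual p st (step p W grad Q st s r) i) := rfl
  rw [h, comprErr, residual]
  abel

theorem step_x (i : Fin n) :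
    (step p W grad Q st s r).x i
      = halfModel p st (step p W grad Q st s r) i
        + p.γ • ((∑ j, W j i • (step p W grad Q st s r).xu j)
          - (step p W grad Q st s r).xu i) := rfl

variable {p W} in
-- Rows of W sum to one, so gossip moves the models without moving their average. Compression errors
-- therefore never reach the average.
theorem avg_step_x (hW : W ∈ doublyStochastic ℝ (Fin n)) :
    avg (step p W grad Q st s r).x
      = avg st.x - p.α • avg ((step p W grad Q st s r).dir p.δ) := by
  have h : (step p W grad Q st s r).x = _ := funext (step_x p W grad Q st s r)
  rw [h, avg_add, avg_smul, avg_sub, avg_sum_smul hW, sub_self, smul_zero, add_zero]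
  exact (avg_sub _ _).trans (congrArg _ (avg_smul _ _))

variable {p W} in
theorem consensusError_halfModel_le (hn : 0 < n) (st st' : State n d) :
    consensusError (halfModel p st st')
      ≤ 2 * consensusError st.x + 2 * ∑ i, ‖p.α • st'.dir p.δ i‖ ^ 2 := by
  have h := consensusError_sub_le st.x (fun i => p.α • st'.dir p.δ i)
  have h2 := consensusError_le hn (fun i => p.α • st'.dir p.δ i)
  have h3 : halfModel p st st' = fun i => st.x i - p.α • st'.dir p.δ i := rfl
  rw [h3]
  linarith

variable {p W} in
/-- One-step recursion of the consensus error. -/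
theorem consensusError_step_le (hn : 0 < n) (hW : W ∈ doublyStochastic ℝ (Fin n))
    (hρ : rhoHat p.γ W < 1) :
    consensusError (step p W grad Q st s r).x
      ≤ (1 - (1 - rhoHat p.γ W ^ 2) / 2) * consensusError st.x
        + 2 / (1 - rhoHat p.γ W ^ 2)
          * (2 * rhoHat p.γ W ^ 2
              * ∑ i, ‖p.α • (step p W grad Q st s r).dir p.δ i‖ ^ 2
            + 8 * p.γ ^ 2 * ∑ i, ‖comprErr p Q st (step p W grad Q st s r) r i‖ ^ 2) := by
  set st' := step p W grad Q st s r with hst'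
  set ρ := rhoHat p.γ W with hρdef
  set M := p.γ • W + (1 - p.γ) • (1 : Matrix (Fin n) (Fin n) ℝ) - avgMatrix n with hM
  set e := comprErr p Q st st' r with he
  set y : Fin n → Vec d := fun i => p.α • st'.dir p.δ i with hy
  have hρ0 : 0 ≤ ρ := rhoHat_nonneg _ _
  have hr : ρ ^ 2 < 1 := by nlinarith
  -- The half models mix through Ŵ - J, which acts on x and on the step y separately; the
  -- compression error enters only through γ(W - I).
  have hx : ∀ i, st'.x i - avg st'.x
      = (∑ j, M j i • (st.x j - avg st.x))
        + (p.γ • ((∑ j, W j i • e j) - e i) - ∑ j, M j i • (y j - avg y)) := by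
    intro i
    have h1 := sub_avg_eq_sum_smul hn hW p.γ (halfModel p st st') i
    have h2 : avg st'.x = avg (halfModel p st st') := by
      have h : st'.x = _ := funext (step_x p W grad Q st s r)
      rw [h, avg_add, avg_smul, avg_sub, avg_sum_smul hW, sub_self, smul_zero, add_zero]
    have h3 : ∑ j, M j i • (halfModel p st st' j - avg (halfModel p st st'))
        = (∑ j, M j i • (st.x j - avg st.x)) - ∑ j, M j i • (y j - avg y) := by
      rw [← Finset.sum_sub_distrib]
      refine Finset.sum_congr rfl fun j _ => ?_
      have h4 : avg (halfModel p st st') = avg st.x - avg y := avg_sub _ _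
      have h5 : halfModel p st st' j = st.x j - y j := rfl
      rw [h4, h5]
      module
    rw [h3] at h1
    have hxu : ∀ j, st'.xu j = halfModel p st st' j + e j := step_xu p W grad Q st s r
    have hxx : st'.x i = halfModel p st st' i
        + p.γ • ((∑ j, W j i • st'.xu j) - st'.xu i) := step_x p W grad Q st s r i
    rw [hxx, h2]
    simp only [hxu, smul_add, Finset.sum_add_distrib]
    calc _ = (halfModel p st st' i
            + p.γ • ((∑ j, W j i • halfModel p st st' j) - halfModel p st st' i)
            - avg (halfModel p st st')) + p.γ • ((∑ j, W j i • e j) - e i) := by module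
      _ = _ := by
        rw [h1]
        abel
  have hA : ∑ i, ‖∑ j, M j i • (st.x j - avg st.x)‖ ^ 2 ≤ ρ ^ 2 * consensusError st.x :=
    sum_norm_sum_smul_sq_le_specNorm M _
  have hB1 : ∑ i, ‖∑ j, M j i • (y j - avg y)‖ ^ 2 ≤ ρ ^ 2 * ∑ i, ‖y i‖ ^ 2 :=
    (sum_norm_sum_smul_sq_le_specNorm M _).trans
      (mul_le_mul_of_nonneg_left (consensusError_le hn y) (sq_nonneg _))
  have hB2 : ∑ i, ‖p.γ • ((∑ j, W j i • e j) - e i)‖ ^ 2 ≤ p.γ ^ 2 * (4 * ∑ i, ‖e i‖ ^ 2) := by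
    simp only [norm_smul, mul_pow, Real.norm_eq_abs, sq_abs, ← Finset.mul_sum]
    exact mul_le_mul_of_nonneg_left (sum_norm_sum_smul_sub_sq_le hW e) (sq_nonneg _)
  have hB : ∑ i, ‖p.γ • ((∑ j, W j i • e j) - e i) - ∑ j, M j i • (y j - avg y)‖ ^ 2
      ≤ 2 * ρ ^ 2 * ∑ i, ‖y i‖ ^ 2 + 8 * p.γ ^ 2 * ∑ i, ‖e i‖ ^ 2 := by
    refine (Finset.sum_le_sum fun i _ => norm_sub_sq_le_two _ _).trans ?_
    rw [Finset.sum_add_distrib, ← Finset.mul_sum, ← Finset.mul_sum]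
    linarith
  -- The Young weight θ = (1 + ρ²)/2 satisfies ρ² ≤ θ², so ρ²/θ ≤ θ = 1 - (1 - ρ²)/2, and 1/(1 - θ)
  -- = 2/(1 - ρ²).
  have hθ0 : 0 < (1 + ρ ^ 2) / 2 := by positivity
  have hθ1 : (1 + ρ ^ 2) / 2 < 1 := by linarith
  have hs : 0 < 1 - ρ ^ 2 := by linarith
  calc consensusError st'.x
      ≤ ∑ i, (‖∑ j, M j i • (st.x j - avg st.x)‖ ^ 2 / ((1 + ρ ^ 2) / 2)
        + ‖p.γ • ((∑ j, W j i • e j) - e i) - ∑ j, M j i • (y j - avg y)‖ ^ 2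
          / (1 - (1 + ρ ^ 2) / 2)) := by
        refine Finset.sum_le_sum fun i _ => ?_
        rw [hx i]
        exact norm_add_sq_le_div _ _ hθ0 hθ1
    _ = (∑ i, ‖∑ j, M j i • (st.x j - avg st.x)‖ ^ 2) / ((1 + ρ ^ 2) / 2)
        + (∑ i, ‖p.γ • ((∑ j, W j i • e j) - e i) - ∑ j, M j i • (y j - avg y)‖ ^ 2)
          / (1 - (1 + ρ ^ 2) / 2) := by
        rw [Finset.sum_add_distrib, Finset.sum_div, Finset.sum_div]
    _ ≤ ρ ^ 2 * consensusError st.x / ((1 + ρ ^ 2) / 2)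
        + (2 * ρ ^ 2 * ∑ i, ‖y i‖ ^ 2 + 8 * p.γ ^ 2 * ∑ i, ‖e i‖ ^ 2)
          / (1 - (1 + ρ ^ 2) / 2) := by
        have : 0 < 1 - (1 + ρ ^ 2) / 2 := by linarith
        gcongr
    _ ≤ _ := by
        have h1 : ρ ^ 2 * consensusError st.x / ((1 + ρ ^ 2) / 2)
            ≤ (1 - (1 - ρ ^ 2) / 2) * consensusError st.x := by
          rw [div_le_iff₀ hθ0]
          nlinarith [mul_nonneg (sq_nonneg (1 - ρ ^ 2)) (consensusError_nonneg st.x)]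
        have h2 : ∀ c : ℝ, c / (1 - (1 + ρ ^ 2) / 2) = 2 / (1 - ρ ^ 2) * c := by
          intro c
          have : 1 - (1 + ρ ^ 2) / 2 = (1 - ρ ^ 2) / 2 := by ring
          rw [this]
          field_simp
        rw [h2]
        linarith

variable {p W} in
/-- One-step recursion of the compressed vectors. -/
theorem residual_step_le (hn : 0 < n) (hW : W ∈ doublyStochastic ℝ (Fin n)) (hγ : 0 ≤ p.γ)
    (st'' : State n d) {θ : ℝ} (h0 : 0 < θ) (h1 : θ < 1) :
    ∑ i, ‖residual p (step p W grad Q st s r) st'' i‖ ^ 2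
      ≤ (1 + 2 * p.γ) ^ 2 * (∑ i, ‖comprErr p Q st (step p W grad Q st s r) r i‖ ^ 2) / θ
        + (16 * p.γ ^ 2 * (consensusError st.x
              + ∑ i, ‖p.α • (step p W grad Q st s r).dir p.δ i‖ ^ 2)
            + 2 * ∑ i, ‖p.α • st''.dir p.δ i‖ ^ 2) / (1 - θ) := by
  set st' := step p W grad Q st s r with hst'
  set e := comprErr p Q st st' r with he
  set h := halfModel p st st' with hh
  -- The half model h cancels between the new model and its new estimate. Only its mixing difference
  -- survives, and that is controlled by consensus error.
  have hx : ∀ i, residual p st' st'' i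
      = (p.γ • ((∑ j, W j i • e j) - e i) - e i)
        + (p.γ • ((∑ j, W j i • h j) - h i) - p.α • st''.dir p.δ i) := by
    intro i
    have hxu : ∀ j, st'.xu j = h j + e j := step_xu p W grad Q st s r
    have hxx : st'.x i = h i + p.γ • ((∑ j, W j i • st'.xu j) - st'.xu i) :=
      step_x p W grad Q st s r i
    rw [residual, halfModel, hxx]
    simp only [hxu, smul_add, Finset.sum_add_distrib]
    module
  have hA := sum_norm_smul_sub_sub_sq_le hW hγ e
  have hB1 : ∑ i, ‖p.γ • ((∑ j, W j i • h j) - h i)‖ ^ 2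
      ≤ p.γ ^ 2 * (4 * (2 * consensusError st.x + 2 * ∑ i, ‖p.α • st'.dir p.δ i‖ ^ 2)) := by
    simp only [norm_smul, mul_pow, Real.norm_eq_abs, sq_abs, ← Finset.mul_sum]
    refine mul_le_mul_of_nonneg_left ?_ (sq_nonneg _)
    have h1 := sum_norm_sum_smul_sub_sq_le_consensusError hW h
    have h2 := consensusError_halfModel_le (p := p) hn st st'
    simp only [norm_smul, mul_pow, Real.norm_eq_abs, sq_abs, ← Finset.mul_sum] at h1 h2
    linarith
  have hB : ∑ i, ‖p.γ • ((∑ j, W j i • h j) - h i) - p.α • st''.dir p.δ i‖ ^ 2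
      ≤ 16 * p.γ ^ 2 * (consensusError st.x + ∑ i, ‖p.α • st'.dir p.δ i‖ ^ 2)
        + 2 * ∑ i, ‖p.α • st''.dir p.δ i‖ ^ 2 := by
    refine (Finset.sum_le_sum fun i _ => norm_sub_sq_le_two _ _).trans ?_
    rw [Finset.sum_add_distrib, ← Finset.mul_sum, ← Finset.mul_sum]
    linarith
  calc ∑ i, ‖residual p st' st'' i‖ ^ 2
      ≤ ∑ i, (‖p.γ • ((∑ j, W j i • e j) - e i) - e i‖ ^ 2 / θ
        + ‖p.γ • ((∑ j, W j i • h j) - h i) - p.α • st''.dir p.δ i‖ ^ 2 / (1 - θ)) := by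
        refine Finset.sum_le_sum fun i _ => ?_
        rw [hx i]
        exact norm_add_sq_le_div _ _ h0 h1
    _ = (∑ i, ‖p.γ • ((∑ j, W j i • e j) - e i) - e i‖ ^ 2) / θ
        + (∑ i, ‖p.γ • ((∑ j, W j i • h j) - h i) - p.α • st''.dir p.δ i‖ ^ 2) / (1 - θ) := by
        rw [Finset.sum_add_distrib, Finset.sum_div, Finset.sum_div]
    _ ≤ _ := by
        have : 0 < 1 - θ := by linarith
        gcongr

end Step

/-! ### Almost sure bounds on the moments and on the step -/

section Bounds

variable {n d : ℕ} {Ξ Z : Type*} {p : Params} {W : Matrix (Fin n) (Fin n) ℝ}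
  {grad : Fin n → Vec d → Ξ → Vec d} {Q : Z → Vec d → Vec d}
  {s : ℕ → Fin n → Ξ} {r : ℕ → Fin n → Z}

theorem norm_run_m_le (hp : p.Admissible) {B : ℝ} {i : Fin n}
    (hg : ∀ t, ‖grad i ((run p W grad Q s r t).x i) (s t i)‖ ≤ B) (t : ℕ) :
    ‖(run p W grad Q s r t).m i‖ ≤ B := by
  induction t with
  | zero => simpa [run, State.init] using (norm_nonneg _).trans (hg 0)
  | succ t ih =>
    have h1 := hp.β₁_pos
    have h2 := hp.β₁_lt_one
    calc ‖p.β₁ • (run p W grad Q s r t).m i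
          + (1 - p.β₁) • grad i ((run p W grad Q s r t).x i) (s t i)‖
        ≤ p.β₁ * ‖(run p W grad Q s r t).m i‖
          + (1 - p.β₁) * ‖grad i ((run p W grad Q s r t).x i) (s t i)‖ := by
          refine (norm_add_le _ _).trans (le_of_eq ?_)
          rw [norm_smul, norm_smul, Real.norm_of_nonneg h1.le, Real.norm_of_nonneg (by linarith)]
      _ ≤ p.β₁ * B + (1 - p.β₁) * B := by
          have := hg t
          have : 0 ≤ 1 - p.β₁ := by linarith
          gcongr
      _ = B := by ring

theorem abs_run_m_le (hp : p.Admissible) {b : ℝ} {i : Fin n} {k : Fin d}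
    (hg : ∀ t, |grad i ((run p W grad Q s r t).x i) (s t i) k| ≤ b) (t : ℕ) :
    |(run p W grad Q s r t).m i k| ≤ b := by
  induction t with
  | zero => simpa [run, State.init] using (abs_nonneg _).trans (hg 0)
  | succ t ih =>
    have h1 := hp.β₁_pos
    have h2 : 0 ≤ 1 - p.β₁ := by linarith [hp.β₁_lt_one]
    calc |p.β₁ * (run p W grad Q s r t).m i k
          + (1 - p.β₁) * grad i ((run p W grad Q s r t).x i) (s t i) k|
        ≤ p.β₁ * |(run p W grad Q s r t).m i k|
          + (1 - p.β₁) * |grad i ((run p W grad Q s r t).x i) (s t i) k| := by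
          refine (abs_add_le _ _).trans (le_of_eq ?_)
          rw [abs_mul, abs_mul, abs_of_pos h1, abs_of_nonneg h2]
      _ ≤ p.β₁ * b + (1 - p.β₁) * b := by
          have := hg t
          gcongr
      _ = b := by ring

/-- A geometric average started from 0. The state after t iterations stores \widehat{u}^{t-1}, hence
the exponent t here and t + 1 in the final bound. -/
theorem run_uh_le (hp : p.Admissible) {b : ℝ} {i : Fin n} {k : Fin d}
    (hg : ∀ t, |grad i ((run p W grad Q s r t).x i) (s t i) k| ≤ b) (t : ℕ) :
    (run p W grad Q s r t).uh i k ≤ (1 - p.β₂ ^ t) * b ^ 2 := by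
  induction t with
  | zero => simp [run, State.init]
  | succ t ih =>
    have h1 := hp.β₂_pos
    have h2 : 0 ≤ 1 - p.β₂ := by linarith [hp.β₂_lt_one]
    set g := grad i ((run p W grad Q s r t).x i) (s t i) k
    have hg2 : g * g ≤ b ^ 2 := by
      rw [← sq]
      exact sq_le_sq' (by linarith [neg_le_of_abs_le (hg t)]) (le_of_abs_le (hg t))
    calc (run p W grad Q s r (t + 1)).uh i k
        = p.β₂ * (run p W grad Q s r t).uh i k + (1 - p.β₂) * (g * g) := rfl
      _ ≤ p.β₂ * ((1 - p.β₂ ^ t) * b ^ 2) + (1 - p.β₂) * b ^ 2 := by gcongr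
      _ = _ := by ring

theorem run_u_le_succ (i : Fin n) (k : Fin d) (t : ℕ) :
    (run p W grad Q s r t).u i k ≤ (run p W grad Q s r (t + 1)).u i k :=
  le_max_left _ _

theorem run_u_nonneg (i : Fin n) (k : Fin d) (t : ℕ) : 0 ≤ (run p W grad Q s r t).u i k := by
  induction t with
  | zero => simp [run, State.init]
  | succ t ih => exact ih.trans (run_u_le_succ i k t)

/-- The bound on `uh` increases with t, so taking running maxima does not spoil it. -/
theorem run_u_le (hp : p.Admissible) {b : ℝ} {i : Fin n} {k : Fin d}
    (hg : ∀ t, |grad i ((run p W grad Q s r t).x i) (s t i) k| ≤ b) (t : ℕ) :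
    (run p W grad Q s r t).u i k ≤ (1 - p.β₂ ^ t) * b ^ 2 := by
  induction t with
  | zero => simp [run, State.init]
  | succ t ih =>
    refine max_le (ih.trans ?_) (run_uh_le hp hg (t + 1))
    have := pow_le_pow_of_le_one hp.β₂_pos.le hp.β₂_lt_one.le (Nat.le_succ t)
    gcongr

theorem norm_run_dir_sq_le (hp : p.Admissible) {B : ℝ} {i : Fin n}
    (hg : ∀ t, ‖grad i ((run p W grad Q s r t).x i) (s t i)‖ ≤ B) (t : ℕ) :
    ‖(run p W grad Q s r t).dir p.δ i‖ ^ 2 ≤ B ^ 2 / p.δ := by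
  have hδ := hp.δ_pos
  calc ‖(run p W grad Q s r t).dir p.δ i‖ ^ 2
      = ∑ k, ((run p W grad Q s r t).m i k / √((run p W grad Q s r t).u i k + p.δ)) ^ 2 := by
        rw [norm_sq_eq_sum_coord]
        rfl
    _ ≤ ∑ k, (run p W grad Q s r t).m i k ^ 2 / p.δ := by
        refine Finset.sum_le_sum fun k _ => ?_
        have h := run_u_nonneg (p := p) (W := W) (grad := grad) (Q := Q) (s := s) (r := r) i k t
        rw [div_pow, Real.sq_sqrt (by linarith)]
        gcongr
        linarith
    _ = ‖(run p W grad Q s r t).m i‖ ^ 2 / p.δ := by rw [norm_sq_eq_sum_coord, Finset.sum_div]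
    _ ≤ _ := by
        have := norm_run_m_le hp hg t
        gcongr

theorem sum_norm_smul_run_dir_sq_le (hp : p.Admissible) {B : ℝ}
    (hg : ∀ t i, ‖grad i ((run p W grad Q s r t).x i) (s t i)‖ ≤ B) (t : ℕ) :
    ∑ i, ‖p.α • (run p W grad Q s r t).dir p.δ i‖ ^ 2 ≤ n * p.α ^ 2 * B ^ 2 / p.δ := by
  calc ∑ i, ‖p.α • (run p W grad Q s r t).dir p.δ i‖ ^ 2
      ≤ ∑ _i : Fin n, p.α ^ 2 * (B ^ 2 / p.δ) := by
        refine Finset.sum_le_sum fun i _ => ?_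
        rw [norm_smul, mul_pow, Real.norm_eq_abs, sq_abs]
        exact mul_le_mul_of_nonneg_left (norm_run_dir_sq_le hp (fun t => hg t i) t) (sq_nonneg _)
    _ = _ := by
        simp
        ring

end Bounds

/-! ### Measurability of the iterates with respect to an arbitrary σ-algebra -/

section Measurability

variable {n d : ℕ} {Ξ Z Ω : Type*} [MeasurableSpace Ξ] {p : Params}
  {W : Matrix (Fin n) (Fin n) ℝ} {grad : Fin n → Vec d → Ξ → Vec d} {Q : Z → Vec d → Vec d}
  {ξ : Fin n → ℕ → Ω → Ξ} {ζ : Fin n → ℕ → Ω → Z}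

/-- All components of a random state are measurable. -/
structure State.Meas [MeasurableSpace Ω] (S : Ω → State n d) : Prop where
  x : ∀ i, Measurable fun ω => (S ω).x i
  xu : ∀ i, Measurable fun ω => (S ω).xu i
  m : ∀ i, Measurable fun ω => (S ω).m i
  uh : ∀ i, Measurable fun ω => (S ω).uh i
  u : ∀ i, Measurable fun ω => (S ω).u i

section

variable [MeasurableSpace Ω]

theorem measurable_step_uh (hgrad : ∀ i, Measurable fun v : Vec d × Ξ => grad i v.1 v.2)
    {S : Ω → State n d} (hS : State.Meas S) {s : Ω → Fin n → Ξ}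
    (hs : ∀ i, Measurable fun ω => s ω i) (r : Ω → Fin n → Z) (i : Fin n) :
    Measurable fun ω => (step p W grad Q (S ω) (s ω) (r ω)).uh i := by
  have hg : Measurable fun ω => grad i ((S ω).x i) (s ω i) :=
    (hgrad i).comp ((hS.x i).prodMk (hs i))
  have h1 : ∀ U G : Ω → Vec d, Measurable U → Measurable G → Measurable fun ω =>
      (WithLp.toLp 2 fun k => p.β₂ * U ω k + (1 - p.β₂) * (G ω k * G ω k) : Vec d) := by
    fun_prop
  exact h1 _ _ (hS.uh i) hg

theorem measurable_step_u (hgrad : ∀ i, Measurable fun v : Vec d × Ξ => grad i v.1 v.2)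
    {S : Ω → State n d} (hS : State.Meas S) {s : Ω → Fin n → Ξ}
    (hs : ∀ i, Measurable fun ω => s ω i) (r : Ω → Fin n → Z) (i : Fin n) :
    Measurable fun ω => (step p W grad Q (S ω) (s ω) (r ω)).u i := by
  have h1 := hS.u i
  have h2 := measurable_step_uh (p := p) (W := W) (Q := Q) hgrad hS hs r i
  have h3 : Measurable fun ω => (WithLp.toLp 2 fun k => max ((S ω).u i k)
    ((step p W grad Q (S ω) (s ω) (r ω)).uh i k) : Vec d) := by fun_prop
  exact h3

theorem measurable_step_m (hgrad : ∀ i, Measurable fun v : Vec d × Ξ => grad i v.1 v.2)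
    {S : Ω → State n d} (hS : State.Meas S) {s : Ω → Fin n → Ξ}
    (hs : ∀ i, Measurable fun ω => s ω i) (r : Ω → Fin n → Z) (i : Fin n) :
    Measurable fun ω => (step p W grad Q (S ω) (s ω) (r ω)).m i := by
  have hg : Measurable fun ω => grad i ((S ω).x i) (s ω i) :=
    (hgrad i).comp ((hS.x i).prodMk (hs i))
  exact ((hS.m i).const_smul p.β₁).add (hg.const_smul (1 - p.β₁))

theorem measurable_dir {S : Ω → State n d} {i : Fin n} (δ : ℝ)
    (hm : Measurable fun ω => (S ω).m i) (hu : Measurable fun ω => (S ω).u i) :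
    Measurable fun ω => (S ω).dir δ i := by
  have h : Measurable fun ω => (WithLp.toLp 2 fun k => (S ω).m i k / √((S ω).u i k + δ) : Vec d) :=
    by fun_prop
  exact h

/-- The seeds `r` may be arbitrary functions here: compression acts only after the direction is
formed. This makes the compressed vector of an iteration independent of that iteration's seeds. -/
theorem measurable_step_dir (hgrad : ∀ i, Measurable fun v : Vec d × Ξ => grad i v.1 v.2)
    {S : Ω → State n d} (hS : State.Meas S) {s : Ω → Fin n → Ξ}
    (hs : ∀ i, Measurable fun ω => s ω i) (r : Ω → Fin n → Z) (i : Fin n) :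
    Measurable fun ω => (step p W grad Q (S ω) (s ω) (r ω)).dir p.δ i :=
  measurable_dir _ (measurable_step_m hgrad hS hs r i) (measurable_step_u hgrad hS hs r i)

variable [MeasurableSpace Z]

theorem State.Meas.step (hgrad : ∀ i, Measurable fun v : Vec d × Ξ => grad i v.1 v.2)
    (hQ : Measurable fun v : Z × Vec d => Q v.1 v.2)
    {S : Ω → State n d} (hS : State.Meas S) {s : Ω → Fin n → Ξ}
    (hs : ∀ i, Measurable fun ω => s ω i) {r : Ω → Fin n → Z}
    (hr : ∀ i, Measurable fun ω => r ω i) :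
    State.Meas fun ω => step p W grad Q (S ω) (s ω) (r ω) := by
  have hh : ∀ i, Measurable fun ω =>
      halfModel p (S ω) (DAMSCo.step p W grad Q (S ω) (s ω) (r ω)) i := fun i =>
    (hS.x i).sub ((measurable_step_dir hgrad hS hs r i).const_smul p.α)
  have hxu : ∀ i, Measurable fun ω => (DAMSCo.step p W grad Q (S ω) (s ω) (r ω)).xu i := by
    intro i
    have h1 : Measurable fun ω =>
        residual p (S ω) (DAMSCo.step p W grad Q (S ω) (s ω) (r ω)) i := (hh i).sub (hS.xu i)
    exact (hS.xu i).add (hQ.comp ((hr i).prodMk h1))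
  refine ⟨fun i => ?_, hxu, measurable_step_m hgrad hS hs r, measurable_step_uh hgrad hS hs r,
    measurable_step_u hgrad hS hs r⟩
  exact (hh i).add (((Finset.measurable_sum _ fun j _ => (hxu j).const_smul (W j i)).sub
    (hxu i)).const_smul p.γ)

/-- Only samples and seeds of iterations before t enter. As the σ-algebra on Ω is free, the same
statement gives adaptedness when it is taken to be generated by part of the randomness. -/
theorem measurable_run (hgrad : ∀ i, Measurable fun v : Vec d × Ξ => grad i v.1 v.2)
    (hQ : Measurable fun v : Z × Vec d => Q v.1 v.2) (t : ℕ)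
    (hξ : ∀ s < t, ∀ i, Measurable (ξ i s)) (hζ : ∀ s < t, ∀ i, Measurable (ζ i s)) :
    State.Meas fun ω => run p W grad Q (fun t i => ξ i t ω) (fun t i => ζ i t ω) t := by
  induction t with
  | zero =>
    constructor <;> exact fun i => measurable_const
  | succ t ih =>
    exact (ih (fun s hs => hξ s (hs.trans t.lt_succ_self))
      (fun s hs => hζ s (hs.trans t.lt_succ_self))).step hgrad hQ (hξ t t.lt_succ_self)
      (hζ t t.lt_succ_self)

/-- The compressed vectors of iteration `t` do not depend on the seeds of that iteration. -/
theorem measurable_run_residual (hgrad : ∀ i, Measurable fun v : Vec d × Ξ => grad i v.1 v.2)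
    (hQ : Measurable fun v : Z × Vec d => Q v.1 v.2) (t : ℕ)
    (hξ : ∀ s < t + 1, ∀ i, Measurable (ξ i s)) (hζ : ∀ s < t, ∀ i, Measurable (ζ i s))
    (i : Fin n) :
    Measurable fun ω =>
      residual p (run p W grad Q (fun t i => ξ i t ω) (fun t i => ζ i t ω) t)
        (run p W grad Q (fun t i => ξ i t ω) (fun t i => ζ i t ω) (t + 1)) i := by
  have h := measurable_run (p := p) (W := W) hgrad hQ t
    (fun s hs => hξ s (hs.trans t.lt_succ_self)) hζ
  have h2 := measurable_step_dir (p := p) (W := W) (Q := Q) hgrad h (s := fun ω i => ξ i t ω)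
    (hξ t t.lt_succ_self) (fun ω i => ζ i t ω) i
  exact ((h.x i).sub (h2.const_smul p.α)).sub (h.xu i)

end

end Measurability

/-! ### Independence of fresh seeds and samples from the past -/

section Independence

theorem indepFun_of_measurable_comap {Ω E α β : Type*} [MeasurableSpace Ω] [MeasurableSpace E]
    [MeasurableSpace α] [MeasurableSpace β] {P : Measure Ω}
    {A : Ω → α} {B : Ω → β} {U : Ω → E} (h : IndepFun A B P)
    (hU : Measurable[MeasurableSpace.comap B inferInstance] U) : IndepFun U A P := by
  rw [IndepFun_iff_Indep] at h ⊢
  exact indep_of_indep_of_le_left h.symm hU.comap_le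

/-- The two hypotheses make the joint law of A, B, C the product of the three marginals, and Fubini
allows regrouping the factors. -/
theorem indepFun_prodMk_of_indepFun {Ω α β γ : Type*} [MeasurableSpace Ω] [MeasurableSpace α]
    [MeasurableSpace β] [MeasurableSpace γ] {P : Measure Ω} [IsProbabilityMeasure P] {A : Ω → α}
    {B : Ω → β} {C : Ω → γ} (hA : Measurable A) (hB : Measurable B) (hC : Measurable C)
    (h1 : IndepFun A (fun ω => (B ω, C ω)) P) (h2 : IndepFun B C P) :
    IndepFun B (fun ω => (A ω, C ω)) P := by
  have hAC : IndepFun A C P := h1.comp measurable_id measurable_snd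
  have e1 := (indepFun_iff_map_prod_eq_prod_map_map hA.aemeasurable
    (hB.prodMk hC).aemeasurable).1 h1
  have e2 := (indepFun_iff_map_prod_eq_prod_map_map hB.aemeasurable hC.aemeasurable).1 h2
  have e3 := (indepFun_iff_map_prod_eq_prod_map_map hA.aemeasurable hC.aemeasurable).1 hAC
  have := Measure.isProbabilityMeasure_map (μ := P) hA.aemeasurable
  have := Measure.isProbabilityMeasure_map (μ := P) hB.aemeasurable
  have := Measure.isProbabilityMeasure_map (μ := P) hC.aemeasurable
  rw [indepFun_iff_measure_inter_preimage_eq_mul]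
  intro s t hs ht
  have hST : MeasurableSet {v : α × β × γ | v.2.1 ∈ s ∧ (v.1, v.2.2) ∈ t} :=
    (measurable_fst.comp measurable_snd hs).inter
      ((measurable_fst.prodMk (measurable_snd.comp measurable_snd)) ht)
  have h3 : B ⁻¹' s ∩ (fun ω => (A ω, C ω)) ⁻¹' t
      = (fun ω => (A ω, B ω, C ω)) ⁻¹' {v : α × β × γ | v.2.1 ∈ s ∧ (v.1, v.2.2) ∈ t} := rfl
  have h4 : ∀ a : α, Prod.mk a ⁻¹' {v : α × β × γ | v.2.1 ∈ s ∧ (v.1, v.2.2) ∈ t}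
      = s ×ˢ (Prod.mk a ⁻¹' t) := fun a => rfl
  rw [h3, ← Measure.map_apply (hA.prodMk (hB.prodMk hC)) hST, e1, Measure.prod_apply hST, e2,
    ← Measure.map_apply hB hs, ← Measure.map_apply (hA.prodMk hC) ht, e3, Measure.prod_apply ht,
    ← lintegral_const_mul _ (measurable_measure_prodMk_left ht)]
  simp only [h4, Measure.prod_prod]

variable {n d : ℕ} {Ξ Z Ω : Type*} [MeasurableSpace Ξ] [MeasurableSpace Z] [MeasurableSpace Ω]
  {P : Measure Ω} [IsProbabilityMeasure P] {D : Fin n → Measure Ξ} {ν : Measure Z}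
  {ξ : Fin n → ℕ → Ω → Ξ} {ζ : Fin n → ℕ → Ω → Z} {E : Type*} [MeasurableSpace E]

/-- The seeds of iteration `t` are independent of all samples and of the earlier seeds. -/
theorem IsSampling.indepFun_seed (h : IsSampling P D ν ξ ζ) (t : ℕ) {U : Ω → E}
    (hU : ∀ m : MeasurableSpace Ω, (∀ i s, Measurable[m] (ξ i s)) →
      (∀ s < t, ∀ i, Measurable[m] (ζ i s)) → Measurable[m] U) (i : Fin n) :
    IndepFun U (ζ i t) P := by
  have hm : ∀ t, Measurable fun ω (i : Fin n) => ζ i t ω := fun t =>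
    measurable_pi_lambda _ fun i => h.measurable_seed i t
  have h2 := h.indep_seed.indepFun_finset {t} (Finset.range t) (by simp) hm
  have h3 : IndepFun (fun ω (v : Fin n × ℕ) => ξ v.1 v.2 ω)
      (fun ω => ((fun (s : ({t} : Finset ℕ)) i => ζ i s ω),
        (fun (s : Finset.range t) i => ζ i s ω))) P := by
    refine h.indep.comp (φ := id) (ψ := fun z : Fin n × ℕ → Z =>
      ((fun (s : ({t} : Finset ℕ)) i => z (i, s)), (fun (s : Finset.range t) i => z (i, s))))
      measurable_id ?_
    fun_prop
  have h4 := indepFun_prodMk_of_indepFun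
    (measurable_pi_lambda _ fun v : Fin n × ℕ => h.measurable_sample v.1 v.2)
    (measurable_pi_lambda _ fun s : ({t} : Finset ℕ) => hm s)
    (measurable_pi_lambda _ fun s : Finset.range t => hm s) h3 h2
  -- `hU` is used for the σ-algebra generated by all samples and the earlier seeds. Quantifying over
  -- σ-algebras is how "U is a function of these variables" is expressed.
  have h5 : IndepFun U (fun ω (s : ({t} : Finset ℕ)) i => ζ i s ω) P := by
    refine indepFun_of_measurable_comap h4 (hU _ (fun j s => ?_) (fun s hs j => ?_))
    · have : Measurable fun v : (Fin n × ℕ → Ξ) × (Finset.range t → Fin n → Z) => v.1 (j, s) := by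
        fun_prop
      exact this.comp (comap_measurable _)
    · have : Measurable fun v : (Fin n × ℕ → Ξ) × (Finset.range t → Fin n → Z) =>
          v.2 ⟨s, Finset.mem_range.2 hs⟩ j := by
        fun_prop
      exact this.comp (comap_measurable _)
  have h6 : Measurable fun v : ({t} : Finset ℕ) → Fin n → Z => v ⟨t, by simp⟩ i := by fun_prop
  exact h5.comp measurable_id h6

/-- The sample of agent `i` in iteration `t` is independent of the other samples up to iteration `t`
and of all seeds. -/
theorem IsSampling.indepFun_sample (h : IsSampling P D ν ξ ζ) (i : Fin n) (t : ℕ) {U : Ω → E}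
    (hU : ∀ m : MeasurableSpace Ω,
      (∀ j s, s ≤ t → (j, s) ≠ (i, t) → Measurable[m] (ξ j s)) →
      (∀ j s, Measurable[m] (ζ j s)) → Measurable[m] U) :
    IndepFun U (ξ i t) P := by
  have hm : ∀ v : Fin n × ℕ, Measurable (ξ v.1 v.2) := fun v => h.measurable_sample _ _
  -- The set keeps the other agents' samples of iteration t itself, which is what makes cross terms
  -- of the noise vanish later.
  set S : Finset (Fin n × ℕ) := (Finset.univ ×ˢ Finset.range (t + 1)).erase (i, t) with hS
  have h2 := h.indep_sample.indepFun_finset {(i, t)} S (by simp [hS]) hm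
  have h3 : IndepFun (fun ω (v : Fin n × ℕ) => ζ v.1 v.2 ω)
      (fun ω => ((fun (v : ({(i, t)} : Finset (Fin n × ℕ))) => ξ v.1.1 v.1.2 ω),
        (fun (v : S) => ξ v.1.1 v.1.2 ω))) P := by
    refine h.indep.symm.comp (φ := id) (ψ := fun z : Fin n × ℕ → Ξ =>
      ((fun (v : ({(i, t)} : Finset (Fin n × ℕ))) => z v), (fun (v : S) => z v)))
      measurable_id ?_
    fun_prop
  have h4 := indepFun_prodMk_of_indepFun
    (measurable_pi_lambda _ fun v : Fin n × ℕ => h.measurable_seed v.1 v.2)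
    (measurable_pi_lambda _ fun v : ({(i, t)} : Finset (Fin n × ℕ)) => hm v)
    (measurable_pi_lambda _ fun v : S => hm v) h3 h2
  have h5 : IndepFun U (fun ω (v : ({(i, t)} : Finset (Fin n × ℕ))) => ξ v.1.1 v.1.2 ω) P := by
    refine indepFun_of_measurable_comap h4 (hU _ (fun j s hs hne => ?_) (fun j s => ?_))
    · have : Measurable fun v : (Fin n × ℕ → Z) × (S → Ξ) =>
          v.2 ⟨(j, s), by simp [hS, hne]; omega⟩ := by
        fun_prop
      exact this.comp (comap_measurable _)
    · have : Measurable fun v : (Fin n × ℕ → Z) × (S → Ξ) => v.1 (j, s) := by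
        fun_prop
      exact this.comp (comap_measurable _)
  have h6 : Measurable fun v : ({(i, t)} : Finset (Fin n × ℕ)) → Ξ => v ⟨(i, t), by simp⟩ := by
    fun_prop
  exact h5.comp measurable_id h6

end Independence

/-! ### Expectations over a fresh seed or a fresh sample -/

section Expectation

variable {n d : ℕ} {Ξ Z Ω : Type*} [MeasurableSpace Ξ] [MeasurableSpace Z] [MeasurableSpace Ω]
  {P : Measure Ω} [IsProbabilityMeasure P]

/-- The expected error of compressing a random vector that is independent of the seed. -/
theorem IsCompressor.integral_comp_le {ν : Measure Z} [IsProbabilityMeasure ν]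
    {Q : Z → Vec d → Vec d} {η : ℝ} (hQ : IsCompressor ν Q η) {U : Ω → Vec d} {V : Ω → Z}
    (hU : Measurable U) (hV : Measurable V) (hUV : IndepFun U V P) (hVν : P.map V = ν)
    (hU2 : Integrable (fun ω => ‖U ω‖ ^ 2) P) :
    Integrable (fun ω => ‖Q (V ω) (U ω) - U ω‖ ^ 2) P ∧
      ∫ ω, ‖Q (V ω) (U ω) - U ω‖ ^ 2 ∂P ≤ η ^ 2 * ∫ ω, ‖U ω‖ ^ 2 ∂P := by
  have e := (indepFun_iff_map_prod_eq_prod_map_map hU.aemeasurable hV.aemeasurable).1 hUV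
  rw [hVν] at e
  have := Measure.isProbabilityMeasure_map (μ := P) hU.aemeasurable
  set h : Vec d × Z → ℝ := fun v => ‖v.1 - Q v.2 v.1‖ ^ 2 with hh
  have hm : Measurable h :=
    ((measurable_fst.sub (hQ.measurable.comp measurable_swap)).norm).pow_const 2
  have hUl : Integrable (fun x : Vec d => ‖x‖ ^ 2) (P.map U) :=
    (integrable_map_measure (by fun_prop) hU.aemeasurable).2 hU2
  -- The seed is integrated first: the inner integral is at most η²‖x‖², which is integrable under
  -- the law of U.
  have hi : Integrable h ((P.map U).prod ν) := by
    refine (integrable_prod_iff hm.aestronglyMeasurable).2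
      ⟨Filter.Eventually.of_forall fun x => hQ.integrable x, ?_⟩
    refine (hUl.const_mul (η ^ 2)).mono' (hm.norm.stronglyMeasurable.integral_prod_right
      |>.aestronglyMeasurable) (Filter.Eventually.of_forall fun x => ?_)
    have h2 : ∀ r, ‖h (x, r)‖ = ‖x - Q r x‖ ^ 2 := fun r => by simp [hh]
    simp only [h2]
    rw [Real.norm_of_nonneg (integral_nonneg fun r => by positivity)]
    exact hQ.le x
  have hc : ∀ ω, ‖Q (V ω) (U ω) - U ω‖ ^ 2 = h (U ω, V ω) := fun ω => by
    simp only [hh, norm_sub_rev]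
  simp only [hc]
  rw [← e] at hi
  refine ⟨(integrable_map_measure hm.aestronglyMeasurable (hU.prodMk hV).aemeasurable).1 hi, ?_⟩
  rw [← integral_map (hU.prodMk hV).aemeasurable hm.aestronglyMeasurable, e]
  rw [e] at hi
  rw [integral_prod _ hi, ← integral_map hU.aemeasurable hUl.aestronglyMeasurable,
    ← integral_const_mul]
  exact integral_mono hi.integral_prod_left (hUl.const_mul _) fun x => hQ.le x

/-- A fresh sample turns a stochastic gradient into its mean, even when tested against a random
vector `V` of the past. -/
theorem integral_inner_sub_eq_zero {D : Measure Ξ} [IsProbabilityMeasure D]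
    {φ : Vec d → Ξ → Vec d} (hφ : Measurable fun v : Vec d × Ξ => φ v.1 v.2) {ψ : Vec d → Vec d}
    (hψ : Measurable ψ) {V X : Ω → Vec d} {S : Ω → Ξ} (hV : Measurable V) (hX : Measurable X)
    (hS : Measurable S) (hind : IndepFun (fun ω => (V ω, X ω)) S P) (hSD : P.map S = D) {B c : ℝ}
    (hφB : ∀ᵐ ω ∂P, ‖φ (X ω) (S ω)‖ ≤ B) (hψB : ∀ x, ‖ψ x‖ ≤ B) (hVc : ∀ᵐ ω ∂P, ‖V ω‖ ≤ c)
    (hmean : ∀ᵐ ω ∂P, ∫ s, φ (X ω) s ∂D = ψ (X ω)) :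
    ∫ ω, inner ℝ (V ω) (φ (X ω) (S ω) - ψ (X ω)) ∂P = 0 := by
  have hVX := hV.prodMk hX
  have hVXS := hVX.prodMk hS
  have e := (indepFun_iff_map_prod_eq_prod_map_map hVX.aemeasurable hS.aemeasurable).1 hind
  rw [hSD] at e
  have := Measure.isProbabilityMeasure_map (μ := P) hVX.aemeasurable
  have hφ' : Measurable fun v : (Vec d × Vec d) × Ξ => φ v.1.2 v.2 :=
    hφ.comp ((measurable_snd.comp measurable_fst).prodMk measurable_snd)
  set h : (Vec d × Vec d) × Ξ → ℝ := fun v => inner ℝ v.1.1 (φ v.1.2 v.2 - ψ v.1.2) with hh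
  have hm : Measurable h :=
    (measurable_fst.comp measurable_fst).inner
      (hφ'.sub (hψ.comp (measurable_snd.comp measurable_fst)))
  -- The gradient bound holds only along the iterates. It is transported to the product law, so that
  -- almost every section φ(x, ·) is bounded and hence integrable.
  have hbdd : ∀ᵐ v ∂((P.map fun ω => (V ω, X ω)).prod D), ‖φ v.1.2 v.2‖ ≤ B := by
    rw [← e, ae_map_iff hVXS.aemeasurable (measurableSet_le hφ'.norm measurable_const)]
    exact hφB
  have hi : Integrable (fun ω => h ((V ω, X ω), S ω)) P := by
    refine Integrable.of_bound (hm.comp hVXS).aestronglyMeasurable (c * (B + B)) ?_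
    filter_upwards [hφB, hVc] with ω h1 h2
    refine (norm_inner_le_norm _ _).trans ?_
    have h3 : ‖φ (X ω) (S ω) - ψ (X ω)‖ ≤ B + B :=
      (norm_sub_le _ _).trans (add_le_add h1 (hψB _))
    exact mul_le_mul h2 h3 (norm_nonneg _) ((norm_nonneg _).trans h2)
  have hi' : Integrable h ((P.map fun ω => (V ω, X ω)).prod D) := by
    rw [← e]
    exact (integrable_map_measure hm.aestronglyMeasurable hVXS.aemeasurable).2 hi
  have hmean' : ∀ᵐ v ∂(P.map fun ω => (V ω, X ω)), ∫ s, φ v.2 s ∂D = ψ v.2 := by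
    have hmi : Measurable fun x : Vec d => ∫ s, φ x s ∂D :=
      hφ.stronglyMeasurable.integral_prod_right.measurable
    have hset : MeasurableSet {v : Vec d × Vec d | ∫ s, φ v.2 s ∂D = ψ v.2} :=
      measurableSet_eq_fun (hmi.comp measurable_snd) (hψ.comp measurable_snd)
    exact (ae_map_iff hVX.aemeasurable hset).2 hmean
  calc ∫ ω, inner ℝ (V ω) (φ (X ω) (S ω) - ψ (X ω)) ∂P
      = ∫ v, h v ∂(P.map fun ω => ((V ω, X ω), S ω)) :=
        (integral_map hVXS.aemeasurable hm.aestronglyMeasurable).symm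
    _ = ∫ v, ∫ s, h (v, s) ∂D ∂(P.map fun ω => (V ω, X ω)) := by rw [e, integral_prod _ hi']
    _ = ∫ _, 0 ∂(P.map fun ω => (V ω, X ω)) := by
        refine integral_congr_ae ?_
        filter_upwards [hmean', Measure.ae_ae_of_ae_prod hbdd] with v h1 h2
        have h3 : Integrable (fun s => φ v.2 s) D :=
          Integrable.of_bound (hφ.comp measurable_prodMk_left).aestronglyMeasurable B h2
        refine (integral_inner (h3.sub (integrable_const (ψ v.2))) v.1).trans ?_
        rw [integral_sub' h3 (integrable_const (ψ v.2)), h1]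
        simp
    _ = 0 := integral_zero _ _

end Expectation

/-! ### Real recursions and their constants -/

section Sequences

/-- Summing a contraction with perturbations. -/
theorem mul_sum_le_of_recursion {a b : ℕ → ℝ} {κ : ℝ} (ha : ∀ t, 0 ≤ a t)
    (h : ∀ t, a (t + 1) ≤ (1 - κ) * a t + b t) (T : ℕ) :
    κ * ∑ t ∈ Finset.range T, a t ≤ a 0 + ∑ t ∈ Finset.range T, b t := by
  have key : κ * ∑ t ∈ Finset.range T, a t + a T ≤ a 0 + ∑ t ∈ Finset.range T, b t := by
    induction T with
    | zero => simp
    | succ T ih =>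
      rw [Finset.sum_range_succ, Finset.sum_range_succ]
      linarith [h T]
  linarith [ha T]

/-- Since γ ≤ κ/25, the expansion (1 + 2γ)² costs less than the compression gains: (1 + 2γ)²(1 - κ)
≤ (1 - κ/2)(1 - κ/3). In the perturbation, 1266/625 = 16/625 + 2 comes from γ² ≤ 1/625. -/
theorem residual_recursion_simplify {a b b' κ γ η Y : ℝ} (hκ : 0 < κ) (hκ1 : κ ≤ 1) (hγ : 0 ≤ γ)
    (hY : 0 ≤ Y) (hηκ : η ^ 2 = 1 - κ) (h3 : γ ≤ κ / 25) (ha : 0 ≤ a) (hb : 0 ≤ b)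
    (hbr : b' ≤ (1 + 2 * γ) ^ 2 * (η ^ 2 * b) / (1 - κ / 3)
      + (16 * γ ^ 2 * (a + Y) + 2 * Y) / (κ / 3)) :
    b' ≤ (1 - κ / 2) * b + 3 / κ * (16 / 625 * κ ^ 2 * a + 1266 / 625 * Y) := by
  refine hbr.trans (add_le_add ?_ ?_)
  · rw [div_le_iff₀ (by linarith)]
    have h5 : (1 + 2 * γ) ^ 2 ≤ 1 + 4 / 25 * κ + 4 / 625 * κ ^ 2 := by nlinarith
    have h6 : (1 + 2 * γ) ^ 2 * η ^ 2 ≤ (1 - κ / 2) * (1 - κ / 3) := by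
      rw [hηκ]
      have : (1 + 2 * γ) ^ 2 * (1 - κ) ≤ (1 + 4 / 25 * κ + 4 / 625 * κ ^ 2) * (1 - κ) :=
        mul_le_mul_of_nonneg_right h5 (by linarith)
      nlinarith [mul_nonneg hκ.le hκ.le, mul_nonneg hκ.le (mul_nonneg hκ.le hκ.le)]
    linarith [mul_le_mul_of_nonneg_right h6 hb]
  · rw [div_div_eq_mul_div, mul_comm _ (3 : ℝ), mul_div_right_comm]
    refine mul_le_mul_of_nonneg_left ?_ (by positivity)
    have h5 : γ ^ 2 ≤ κ ^ 2 / 625 := by nlinarith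
    have h6 : γ ^ 2 ≤ 1 / 625 := by nlinarith
    linarith [mul_le_mul_of_nonneg_right h5 ha, mul_le_mul_of_nonneg_right h6 hY]

/-- Multiplication by 2κ clears the denominators; 71/5 and 4/25 round up 2 + 7596/625 and 96/625.
Here τ is the number of iterations, and the initial residual Y is absorbed into τY. -/
theorem sum_residual_bound {A S κ τ Y : ℝ} (hκ : 0 < κ) (hκ1 : κ ≤ 1) (hA : 0 ≤ A) (hY : 0 ≤ Y)
    (hτ : 1 ≤ τ) (h : κ / 2 * S ≤ Y + 3 / κ * (16 / 625 * κ ^ 2 * A + 1266 / 625 * (τ * Y))) :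
    S ≤ 71 / 5 * (τ * Y) / κ ^ 2 + 4 / 25 * A := by
  have h6 := mul_le_mul_of_nonneg_left h (by positivity : 0 ≤ 2 * κ)
  have h7 : 2 * κ * (Y + 3 / κ * (16 / 625 * κ ^ 2 * A + 1266 / 625 * (τ * Y)))
      = 2 * κ * Y + 6 * (1266 / 625) * (τ * Y) + 96 / 625 * (κ ^ 2 * A) := by
    field_simp
    ring
  have h8 : κ * Y ≤ τ * Y := mul_le_mul_of_nonneg_right (by linarith) hY
  have h9 : 0 ≤ κ ^ 2 * A := by positivity
  have h10 : 0 ≤ τ * Y := mul_nonneg (by linarith) hY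
  rw [← sub_le_iff_le_add, le_div_iff₀ (by positivity)]
  linarith

/-- The factor u² is estimated in two ways: by (s/60)(κ²/32) against the X-term, which carries
1/(sκ²), and by (s/60)² against the A-term, which carries 1/s. What remains of A is at most sA/1000
and is absorbed on the left. -/
theorem consensus_bound_of_residual_bound {A S s κ u X : ℝ} (hs : 0 < s) (hs1 : s ≤ 1) (hκ : 0 < κ)
    (hA : 0 ≤ A) (hX : 0 ≤ X) (hu : 0 ≤ u) (hu1 : u ≤ s / 60) (hu2 : u ≤ κ ^ 2 / 32)
    (hS : S ≤ 71 / 5 * X / κ ^ 2 + 4 / 25 * A)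
    (h : s / 2 * A ≤ 4 * (1 - s) * X / s + 16 * u ^ 2 / s * S) :
    A ≤ 12 / s * (4 * (1 - s) * X / s + X / 45) := by
  have e4 : u ^ 2 ≤ s * κ ^ 2 / 1920 := by
    have := mul_le_mul hu1 hu2 hu (by positivity)
    linarith
  have e5 : u ^ 2 ≤ s ^ 2 / 3600 := by
    have := mul_le_mul hu1 hu1 hu (by positivity)
    linarith
  have e6 : 16 * u ^ 2 / s * S ≤ 148 / 1250 * X + 1 / 1000 * (s * A) := by
    calc 16 * u ^ 2 / s * S
        ≤ 16 * u ^ 2 / s * (71 / 5 * X / κ ^ 2 + 4 / 25 * A) :=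
          mul_le_mul_of_nonneg_left hS (by positivity)
      _ = u ^ 2 * (1136 / 5 * X / (s * κ ^ 2)) + u ^ 2 * (64 / 25 * A / s) := by
        field_simp
        ring
      _ ≤ s * κ ^ 2 / 1920 * (1136 / 5 * X / (s * κ ^ 2)) + s ^ 2 / 3600 * (64 / 25 * A / s) :=
        add_le_add (mul_le_mul_of_nonneg_right e4 (by positivity))
          (mul_le_mul_of_nonneg_right e5 (by positivity))
      _ = 1136 / 9600 * X + 64 / 90000 * (s * A) := by
        field_simp
        ring
      _ ≤ _ := by
        have : 0 ≤ s * A := by positivity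
        linarith
  have h1 : 0 ≤ 4 * (1 - s) * X / s :=
    div_nonneg (mul_nonneg (by linarith) hX) hs.le
  have h6 : 12 / s * (4 * (1 - s) * X / s + X / 45)
      = (12 * (4 * (1 - s) * X / s) + 12 / 45 * X) / s := by
    ring
  rw [h6, le_div_iff₀ hs]
  linarith

/-- Solving the coupled recursions of the consensus error `a` and the compressed vectors `b`;
`s` and `κ` are the spectral gap and the compression gap. -/
theorem sum_le_of_coupled_recursion {a b : ℕ → ℝ} {s κ γ η α Y : ℝ} (hs : 0 < s) (hκ : 0 < κ)
    (hκ1 : κ ≤ 1) (hs1 : s ≤ 1) (hγ : 0 ≤ γ) (hη : 0 ≤ η) (hα : 0 ≤ α) (hY : 0 ≤ Y)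
    (hηκ : η ^ 2 = 1 - κ) (h1 : α ≤ κ ^ 2 / 32) (h2 : 60 * η * γ ≤ s) (h3 : γ ≤ κ / 25)
    (h4 : η * γ ≤ α) (ha : ∀ t, 0 ≤ a t) (hb : ∀ t, 0 ≤ b t) (ha0 : a 0 = 0) (hb0 : b 0 ≤ Y)
    (har : ∀ t, a (t + 1) ≤ (1 - s / 2) * a t
      + 2 / s * (2 * (1 - s) * Y + 8 * γ ^ 2 * (η ^ 2 * b t)))
    (hbr : ∀ t, b (t + 1) ≤ (1 + 2 * γ) ^ 2 * (η ^ 2 * b t) / (1 - κ / 3)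
      + (16 * γ ^ 2 * (a t + Y) + 2 * Y) / (κ / 3)) {T : ℕ} (hT : 0 < T) :
    ∑ t ∈ Finset.range T, a t
      ≤ T * (12 / s * (4 * (1 - s) * Y / s + Y / 45) + 320 * α * Y / κ ^ 2) := by
  have hT' : (1 : ℝ) ≤ T := by exact_mod_cast hT
  have hA0 : 0 ≤ ∑ t ∈ Finset.range T, a t := Finset.sum_nonneg fun t _ => ha t
  have e1 := mul_sum_le_of_recursion ha har T
  have e2 := mul_sum_le_of_recursion hb (fun t => residual_recursion_simplify hκ hκ1 hγ hY hηκ h3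
    (ha t) (hb t) (hbr t)) T
  simp only [ha0, Finset.sum_add_distrib, ← Finset.mul_sum, Finset.sum_const, Finset.card_range,
    nsmul_eq_mul] at e1 e2
  generalize ∑ t ∈ Finset.range T, a t = A at *
  generalize ∑ t ∈ Finset.range T, b t = S at *
  have e3 := sum_residual_bound hκ hκ1 hA0 hY hT' (e2.trans (add_le_add_left hb0 _))
  -- Both smallness conditions are conditions on ηγ: 60ηγ ≤ s, and ηγ ≤ α ≤ κ²/32.
  have e4 := consensus_bound_of_residual_bound (u := η * γ) hs hs1 hκ hA0
    (by positivity : 0 ≤ T * Y) (by positivity) (by linarith) (by linarith) e3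
    (e1.trans (le_of_eq (by field_simp; ring)))
  -- The last term of the consensus constant is pure slack: the bound already holds without it.
  have e5 : 0 ≤ T * (320 * α * Y / κ ^ 2) := by positivity
  rw [mul_add]
  refine e4.trans (le_of_eq_of_le ?_ (le_add_of_nonneg_right e5))
  ring

end Sequences

/-! ### The random iterates and their compression errors -/

section Consensus

variable {n d : ℕ} {Ξ Z Ω : Type*}

/-- The random state after `t` iterations. -/
noncomputable def iter (p : Params) (W : Matrix (Fin n) (Fin n) ℝ)
    (grad : Fin n → Vec d → Ξ → Vec d)
    (Q : Z → Vec d → Vec d) (ξ : Fin n → ℕ → Ω → Ξ) (ζ : Fin n → ℕ → Ω → Z) (t : ℕ) (ω : Ω) :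
    State n d :=
  run p W grad Q (fun t i => ξ i t ω) (fun t i => ζ i t ω) t

variable {p : Params} {W : Matrix (Fin n) (Fin n) ℝ} {grad : Fin n → Vec d → Ξ → Vec d}
  {Q : Z → Vec d → Vec d} {ξ : Fin n → ℕ → Ω → Ξ} {ζ : Fin n → ℕ → Ω → Z}

theorem consensusError_iter_zero (ω : Ω) :
    consensusError (iter p W grad Q ξ ζ 0 ω).x = 0 := by
  simp [iter, run, State.init, consensusError, avg]

/-- Models and estimates both start at 0, so the first compressed vector is just the negative first
step. This starts the residual recursion. -/
theorem sum_residual_iter_zero (ω : Ω) :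
    ∑ i, ‖residual p (iter p W grad Q ξ ζ 0 ω) (iter p W grad Q ξ ζ 1 ω) i‖ ^ 2
      = ∑ i, ‖p.α • (iter p W grad Q ξ ζ 1 ω).dir p.δ i‖ ^ 2 := by
  refine Finset.sum_congr rfl fun i _ => ?_
  simp [residual, halfModel, iter, run, State.init]

/-- Written as an affine combination of two random quantities with deterministic coefficients, ready
to be integrated. -/
theorem consensusError_iter_succ_le (hn : 0 < n) (hW : W ∈ doublyStochastic ℝ (Fin n))
    (hρ : rhoHat p.γ W < 1) {Y : ℝ} {ω : Ω} {t : ℕ}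
    (hY : ∑ i, ‖p.α • (iter p W grad Q ξ ζ (t + 1) ω).dir p.δ i‖ ^ 2 ≤ Y) :
    consensusError (iter p W grad Q ξ ζ (t + 1) ω).x
      ≤ (1 - (1 - rhoHat p.γ W ^ 2) / 2) * consensusError (iter p W grad Q ξ ζ t ω).x
        + 2 / (1 - rhoHat p.γ W ^ 2) * (8 * p.γ ^ 2) * (∑ i, ‖comprErr p Q
            (iter p W grad Q ξ ζ t ω) (iter p W grad Q ξ ζ (t + 1) ω) (fun i => ζ i t ω) i‖ ^ 2)
        + 2 / (1 - rhoHat p.γ W ^ 2) * (2 * rhoHat p.γ W ^ 2 * Y) := by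
  have h0 := rhoHat_nonneg p.γ W
  have hs : 0 ≤ 2 / (1 - rhoHat p.γ W ^ 2) := div_nonneg (by norm_num) (by nlinarith)
  have h1 := consensusError_step_le grad Q (iter p W grad Q ξ ζ t ω) (fun i => ξ i t ω)
    (fun i => ζ i t ω) hn hW hρ
  have h2 : iter p W grad Q ξ ζ (t + 1) ω = step p W grad Q (iter p W grad Q ξ ζ t ω)
    (fun i => ξ i t ω) (fun i => ζ i t ω) := rfl
  rw [← h2] at h1
  refine h1.trans ?_
  have h3 := mul_le_mul_of_nonneg_left
    (mul_le_mul_of_nonneg_left hY (by positivity : 0 ≤ 2 * rhoHat p.γ W ^ 2)) hs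
  rw [mul_add]
  linarith

theorem sum_residual_iter_succ_le (hn : 0 < n) (hW : W ∈ doublyStochastic ℝ (Fin n))
    (hp : p.Admissible) {Y θ : ℝ} (hθ0 : 0 < θ) (hθ1 : θ < 1) {ω : Ω} {t : ℕ}
    (hY : ∀ t, ∑ i, ‖p.α • (iter p W grad Q ξ ζ t ω).dir p.δ i‖ ^ 2 ≤ Y) :
    ∑ i, ‖residual p (iter p W grad Q ξ ζ (t + 1) ω) (iter p W grad Q ξ ζ (t + 1 + 1) ω) i‖ ^ 2
      ≤ 16 * p.γ ^ 2 / (1 - θ) * consensusError (iter p W grad Q ξ ζ t ω).x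
        + (1 + 2 * p.γ) ^ 2 / θ * (∑ i, ‖comprErr p Q
            (iter p W grad Q ξ ζ t ω) (iter p W grad Q ξ ζ (t + 1) ω) (fun i => ζ i t ω) i‖ ^ 2)
        + (16 * p.γ ^ 2 * Y + 2 * Y) / (1 - θ) := by
  have h1 := residual_step_le grad Q (iter p W grad Q ξ ζ t ω) (fun i => ξ i t ω)
    (fun i => ζ i t ω) hn hW hp.γ_pos.le (iter p W grad Q ξ ζ (t + 1 + 1) ω) hθ0 hθ1
  have h2 : iter p W grad Q ξ ζ (t + 1) ω = step p W grad Q (iter p W grad Q ξ ζ t ω)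
    (fun i => ξ i t ω) (fun i => ζ i t ω) := rfl
  rw [← h2] at h1
  have hθ : 0 < 1 - θ := by linarith
  have h3 := hY (t + 1 + 1)
  refine h1.trans ?_
  calc _ ≤ (1 + 2 * p.γ) ^ 2 * (∑ i, ‖comprErr p Q (iter p W grad Q ξ ζ t ω)
            (iter p W grad Q ξ ζ (t + 1) ω) (fun i => ζ i t ω) i‖ ^ 2) / θ
          + (16 * p.γ ^ 2 * (consensusError (iter p W grad Q ξ ζ t ω).x + Y) + 2 * Y)
            / (1 - θ) := by
        gcongr
        exact hY (t + 1)
    _ = _ := by ring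

variable [MeasurableSpace Ω]

theorem ae_sum_norm_smul_dir_sq_le {P : Measure Ω} {B : ℝ} (hp : p.Admissible)
    (hB : ∀ᵐ ω ∂P, ∀ t i, ‖grad i ((iter p W grad Q ξ ζ t ω).x i) (ξ i t ω)‖ ≤ B) :
    ∀ᵐ ω ∂P, ∀ t, ∑ i, ‖p.α • (iter p W grad Q ξ ζ t ω).dir p.δ i‖ ^ 2
      ≤ n * p.α ^ 2 * B ^ 2 / p.δ := by
  filter_upwards [hB] with ω h t
  exact sum_norm_smul_run_dir_sq_le (s := fun t i => ξ i t ω) hp h t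

variable [MeasurableSpace Ξ] [MeasurableSpace Z]
  {P : Measure Ω} {D : Fin n → Measure Ξ} {ν : Measure Z} {η : ℝ}

theorem meas_iter (hgrad : ∀ i, Measurable fun v : Vec d × Ξ => grad i v.1 v.2)
    (hQ : Measurable fun v : Z × Vec d => Q v.1 v.2) (hξζ : IsSampling P D ν ξ ζ) (t : ℕ) :
    State.Meas (iter p W grad Q ξ ζ t) :=
  measurable_run hgrad hQ t (fun s _ i => hξζ.measurable_sample i s)
    (fun s _ i => hξζ.measurable_seed i s)

theorem measurable_residual_iter (hgrad : ∀ i, Measurable fun v : Vec d × Ξ => grad i v.1 v.2)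
    (hQ : Measurable fun v : Z × Vec d => Q v.1 v.2) (hξζ : IsSampling P D ν ξ ζ) (t : ℕ)
    (i : Fin n) :
    Measurable fun ω => residual p (iter p W grad Q ξ ζ t ω) (iter p W grad Q ξ ζ (t + 1) ω) i :=
  measurable_run_residual hgrad hQ t (fun s _ i => hξζ.measurable_sample i s)
    (fun s _ i => hξζ.measurable_seed i s) i

theorem measurable_consensusError {X : Ω → Fin n → Vec d} (hX : ∀ i, Measurable fun ω => X ω i) :
    Measurable fun ω => consensusError (X ω) := by
  unfold consensusError avg
  fun_prop

variable [IsProbabilityMeasure P] [IsProbabilityMeasure ν]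

/-- The compressed vectors of iteration t depend on samples up to t and on earlier seeds only, so
each is independent of its own seed. Summing over agents is linear, so dependence between seeds
within an iteration is harmless. -/
theorem integral_sum_comprErr_le (hgrad : ∀ i, Measurable fun v : Vec d × Ξ => grad i v.1 v.2)
    (hQ : IsCompressor ν Q η) (hξζ : IsSampling P D ν ξ ζ) (t : ℕ)
    (hi : Integrable (fun ω => ∑ i,
      ‖residual p (iter p W grad Q ξ ζ t ω) (iter p W grad Q ξ ζ (t + 1) ω) i‖ ^ 2) P) :
    Integrable (fun ω => ∑ i, ‖comprErr p Q (iter p W grad Q ξ ζ t ω)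
        (iter p W grad Q ξ ζ (t + 1) ω) (fun i => ζ i t ω) i‖ ^ 2) P ∧
      ∫ ω, ∑ i, ‖comprErr p Q (iter p W grad Q ξ ζ t ω)
          (iter p W grad Q ξ ζ (t + 1) ω) (fun i => ζ i t ω) i‖ ^ 2 ∂P
        ≤ η ^ 2 * ∫ ω, ∑ i,
          ‖residual p (iter p W grad Q ξ ζ t ω) (iter p W grad Q ξ ζ (t + 1) ω) i‖ ^ 2 ∂P := by
  have hm := measurable_residual_iter (p := p) (W := W) hgrad hQ.measurable hξζ t
  have hi' : ∀ i, Integrable (fun ω =>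
      ‖residual p (iter p W grad Q ξ ζ t ω) (iter p W grad Q ξ ζ (t + 1) ω) i‖ ^ 2) P := by
    intro i
    refine hi.mono' ((hm i).norm.pow_const 2).aestronglyMeasurable
      (Filter.Eventually.of_forall fun ω => ?_)
    rw [Real.norm_of_nonneg (by positivity)]
    exact Finset.single_le_sum (f := fun i => ‖residual p (iter p W grad Q ξ ζ t ω)
      (iter p W grad Q ξ ζ (t + 1) ω) i‖ ^ 2) (fun j _ => by positivity) (Finset.mem_univ i)
  have key : ∀ i, _ := fun i =>
    hQ.integral_comp_le (P := P) (hm i) (hξζ.measurable_seed i t) (hξζ.indepFun_seed t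
      (fun m h1 h2 => by
        let := m
        exact measurable_run_residual hgrad hQ.measurable t (fun s _ i => h1 i s) h2 i) i) (hξζ.map_seed i t) (hi' i)
  refine ⟨integrable_finsetSum _ fun i _ => (key i).1, ?_⟩
  rw [integral_finsetSum _ fun i _ => hi' i, Finset.mul_sum]
  refine (integral_finsetSum _ fun i _ => (key i).1).trans_le ?_
  exact Finset.sum_le_sum fun i _ => (key i).2

end Consensus

/-! ### Integrating affine inequalities -/

section Affine

variable {Ω : Type*} [MeasurableSpace Ω] {P : Measure Ω} [IsProbabilityMeasure P]

theorem integrable_of_le_affine {f g h : Ω → ℝ} (hf : Measurable f) (hf0 : ∀ ω, 0 ≤ f ω)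
    (hg : Integrable g P) (hh : Integrable h P) (a b c : ℝ)
    (hle : ∀ᵐ ω ∂P, f ω ≤ a * g ω + b * h ω + c) : Integrable f P := by
  have hi : Integrable (fun ω => a * g ω + b * h ω + c) P :=
    ((hg.const_mul a).add (hh.const_mul b)).add (integrable_const c)
  refine hi.mono' hf.aestronglyMeasurable ?_
  filter_upwards [hle] with ω hω
  rwa [Real.norm_of_nonneg (hf0 ω)]

theorem integral_le_affine {f g h : Ω → ℝ} (hf : Integrable f P) (hg : Integrable g P)
    (hh : Integrable h P) (a b c : ℝ) (hle : ∀ᵐ ω ∂P, f ω ≤ a * g ω + b * h ω + c) :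
    ∫ ω, f ω ∂P ≤ a * ∫ ω, g ω ∂P + b * ∫ ω, h ω ∂P + c := by
  have h1 : Integrable (fun ω => a * g ω + b * h ω) P := (hg.const_mul a).add (hh.const_mul b)
  refine (integral_mono_ae hf (h1.add (integrable_const c)) hle).trans (le_of_eq ?_)
  rw [integral_add' h1 (integrable_const c), integral_add (hg.const_mul a) (hh.const_mul b),
    integral_const_mul, integral_const_mul]
  simp

end Affine

/-! ### The consensus bound in expectation -/

section Consensus

variable {n d : ℕ} {Ξ Z Ω : Type*} [MeasurableSpace Ξ] [MeasurableSpace Z] [MeasurableSpace Ω]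
  {P : Measure Ω} [IsProbabilityMeasure P] {D : Fin n → Measure Ξ} {ν : Measure Z}
  [IsProbabilityMeasure ν] {p : Params} {W : Matrix (Fin n) (Fin n) ℝ}
  {grad : Fin n → Vec d → Ξ → Vec d} {Q : Z → Vec d → Vec d} {η : ℝ}
  {ξ : Fin n → ℕ → Ω → Ξ} {ζ : Fin n → ℕ → Ω → Z} {B : ℝ}

/-- The two integrabilities must be carried by one induction: the next consensus error and residual
are dominated by the current consensus error and compression error, and the latter is integrable
because the current residual is. -/
theorem integrable_consensusError_and_residual (hn : 0 < n) (hW : W ∈ doublyStochastic ℝ (Fin n))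
    (hp : p.Admissible) (hgrad : ∀ i, Measurable fun v : Vec d × Ξ => grad i v.1 v.2)
    (hQ : IsCompressor ν Q η) (hξζ : IsSampling P D ν ξ ζ)
    (hB : ∀ᵐ ω ∂P, ∀ t i, ‖grad i ((iter p W grad Q ξ ζ t ω).x i) (ξ i t ω)‖ ≤ B)
    (hρ : rhoHat p.γ W < 1) (t : ℕ) :
    Integrable (fun ω => consensusError (iter p W grad Q ξ ζ t ω).x) P ∧
    Integrable (fun ω => ∑ i,
      ‖residual p (iter p W grad Q ξ ζ t ω) (iter p W grad Q ξ ζ (t + 1) ω) i‖ ^ 2) P := by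
  have hY := ae_sum_norm_smul_dir_sq_le hp hB
  have hmx : ∀ t, Measurable fun ω => consensusError (iter p W grad Q ξ ζ t ω).x := fun t =>
    measurable_consensusError (meas_iter hgrad hQ.measurable hξζ t).x
  have hmr : ∀ t, Measurable fun ω => ∑ i,
      ‖residual p (iter p W grad Q ξ ζ t ω) (iter p W grad Q ξ ζ (t + 1) ω) i‖ ^ 2 := fun t =>
    Finset.measurable_sum _ fun i _ =>
      (measurable_residual_iter hgrad hQ.measurable hξζ t i).norm.pow_const 2
  have hr0 : ∀ t ω, 0 ≤ ∑ i,
      ‖residual p (iter p W grad Q ξ ζ t ω) (iter p W grad Q ξ ζ (t + 1) ω) i‖ ^ 2 := fun t ω =>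
    Finset.sum_nonneg fun _ _ => sq_nonneg _
  induction t with
  | zero =>
    constructor
    · simp [consensusError_iter_zero]
    · refine Integrable.of_bound (hmr 0).aestronglyMeasurable (n * p.α ^ 2 * B ^ 2 / p.δ) ?_
      filter_upwards [hY] with ω h
      rw [Real.norm_of_nonneg (hr0 0 ω)]
      exact (sum_residual_iter_zero ω).trans_le (h 1)
  | succ t ih =>
    have he := (integral_sum_comprErr_le hgrad hQ hξζ t ih.2).1
    constructor
    · refine integrable_of_le_affine (hmx _) (fun ω => consensusError_nonneg _) ih.1 he _ _ _
        (hY.mono fun ω h => consensusError_iter_succ_le hn hW hρ (h (t + 1)))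
    · refine integrable_of_le_affine (hmr _) (hr0 _) ih.1 he _ _ _
        -- Only finiteness matters here, so any Young weight would do.
        (hY.mono fun ω h => sum_residual_iter_succ_le hn hW hp (θ := 1 / 2) (by norm_num)
          (by norm_num) h)

/-- The bound on the accumulated consensus error. -/
theorem sum_integral_consensusError_le (hn : 0 < n) (hW : W ∈ doublyStochastic ℝ (Fin n))
    (hp : p.Admissible) (hgrad : ∀ i, Measurable fun v : Vec d × Ξ => grad i v.1 v.2)
    (hQ : IsCompressor ν Q η) (hξζ : IsSampling P D ν ξ ζ)
    (hB : ∀ᵐ ω ∂P, ∀ t i, ‖grad i ((iter p W grad Q ξ ζ t ω).x i) (ξ i t ω)‖ ≤ B)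
    (hρ : rhoHat p.γ W < 1) (hη0 : 0 ≤ η) (hη1 : η < 1)
    (hα₂ : p.α ≤ (1 - η ^ 2) ^ 2 / 32) (hγ₁ : 60 * η * p.γ ≤ 1 - rhoHat p.γ W ^ 2)
    (hγ₂ : p.γ ≤ (1 - η ^ 2) / 25) (hγ₃ : η * p.γ ≤ p.α) {T : ℕ} (hT : 0 < T) :
    ∑ t ∈ Finset.range T, ∫ ω, consensusError (iter p W grad Q ξ ζ t ω).x ∂P
      ≤ T * (p.α ^ 2 * consensusConst n p.α p.δ η B (rhoHat p.γ W)) := by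
  have hY := ae_sum_norm_smul_dir_sq_le hp hB
  have hint := integrable_consensusError_and_residual hn hW hp hgrad hQ hξζ hB hρ
  have hρ0 := rhoHat_nonneg p.γ W
  have hr : rhoHat p.γ W ^ 2 < 1 := by nlinarith
  have hη2 : η ^ 2 < 1 := by nlinarith
  have hδ := hp.δ_pos
  have hs : 0 < 1 - rhoHat p.γ W ^ 2 := by linarith
  have hκ : 0 < 1 - η ^ 2 := by linarith
  set Y : ℝ := n * p.α ^ 2 * B ^ 2 / p.δ with hYdef
  have hY0 : 0 ≤ Y := by positivity
  have e : T * (p.α ^ 2 * consensusConst n p.α p.δ η B (rhoHat p.γ W))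
      = T * (12 / (1 - rhoHat p.γ W ^ 2) * (4 * (1 - (1 - rhoHat p.γ W ^ 2)) * Y
        / (1 - rhoHat p.γ W ^ 2) + Y / 45) + 320 * p.α * Y / (1 - η ^ 2) ^ 2) := by
    rw [consensusConst, hYdef]
    generalize rhoHat p.γ W = ρ at *
    field_simp
    ring
  rw [e]
  refine sum_le_of_coupled_recursion (a := fun t => ∫ ω, consensusError
    (iter p W grad Q ξ ζ t ω).x ∂P) (b := fun t => ∫ ω, ∑ i, ‖residual p (iter p W grad Q ξ ζ t ω)
    (iter p W grad Q ξ ζ (t + 1) ω) i‖ ^ 2 ∂P) hs hκ (by nlinarith) (by nlinarith)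
    hp.γ_pos.le hη0 hp.α_pos.le hY0 (by ring) hα₂ hγ₁ hγ₂ hγ₃
    (fun t => integral_nonneg fun ω => consensusError_nonneg _)
    (fun t => integral_nonneg fun ω => Finset.sum_nonneg fun _ _ => by positivity)
    ?_ ?_ (fun t => ?_) (fun t => ?_) hT
  · simp [consensusError_iter_zero]
  · refine (integral_mono_ae (hint 0).2 (integrable_const Y) ?_).trans (by simp)
    filter_upwards [hY] with ω h
    exact (sum_residual_iter_zero ω).trans_le (h 1)
  · obtain ⟨he, he'⟩ := integral_sum_comprErr_le hgrad hQ hξζ t (hint t).2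
    have h1 := integral_le_affine (hint (t + 1)).1 (hint t).1 he _ _ _
      (hY.mono fun ω h => consensusError_iter_succ_le hn hW hρ (h (t + 1)))
    refine h1.trans ?_
    have h2 := mul_le_mul_of_nonneg_left he'
      (by positivity : 0 ≤ 2 / (1 - rhoHat p.γ W ^ 2) * (8 * p.γ ^ 2))
    rw [sub_sub_cancel, mul_add]
    linarith
  · obtain ⟨he, he'⟩ := integral_sum_comprErr_le hgrad hQ hξζ t (hint t).2
    have h1 := integral_le_affine (hint (t + 1)).2 (hint t).1 he _ _ _
      -- The weight θ = 1 - κ/3 spends a third of the compression gap κ, leaving room for the rate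
      -- κ/2.
      (hY.mono fun ω h => sum_residual_iter_succ_le hn hW hp (θ := 1 - (1 - η ^ 2) / 3)
        (by linarith [sq_nonneg η]) (by linarith) h)
    refine h1.trans ?_
    have h2 := mul_le_mul_of_nonneg_left he' (div_nonneg (sq_nonneg (1 + 2 * p.γ))
      (by linarith [sq_nonneg η] : 0 ≤ 1 - (1 - η ^ 2) / 3))
    refine (add_le_add_left (add_le_add_right h2 _) _).trans (le_of_eq ?_)
    rw [sub_sub_cancel]
    ring

end Consensus

/-! ### Smoothness of the global objective -/

section Smooth

variable {d : ℕ}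

/-- The descent lemma for functions with Lipschitz gradient. -/
theorem le_add_inner_add_sq_of_lipschitz_gradient {E : Type*} [NormedAddCommGroup E]
    [InnerProductSpace ℝ E] [CompleteSpace E] {f : E → ℝ} {L : ℝ} (hf : Differentiable ℝ f)
    (hL : ∀ x y, ‖gradient f x - gradient f y‖ ≤ L * ‖x - y‖) (x v : E) :
    f (x + v) ≤ f x + inner ℝ (gradient f x) v + L / 2 * ‖v‖ ^ 2 := by
  -- Along the segment, f minus its claimed growth; the Lipschitz bound makes φ nonincreasing, and
  -- the claim is φ 1 ≤ φ 0.
  set φ : ℝ → ℝ := fun s => f (x + s • v) - s * inner ℝ (gradient f x) v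
    - s ^ 2 * (L / 2 * ‖v‖ ^ 2) with hφ
  have hd : ∀ s, HasDerivAt φ (inner ℝ (gradient f (x + s • v)) v - inner ℝ (gradient f x) v
      - 2 * s * (L / 2 * ‖v‖ ^ 2)) s := by
    intro s
    have h1 : HasDerivAt (fun s : ℝ => x + s • v) v s := by
      simpa using ((hasDerivAt_id s).smul_const v).const_add x
    have h2 := (hf (x + s • v)).hasGradientAt.hasFDerivAt.comp_hasDerivAt s h1
    have h3 := (hasDerivAt_id s).mul_const (inner ℝ (gradient f x) v)
    have h4 := (hasDerivAt_pow 2 s).mul_const (L / 2 * ‖v‖ ^ 2)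
    have h5 : HasDerivAt φ _ s := (h2.sub h3).sub h4
    simpa using h5
  have hanti : AntitoneOn φ (Set.Icc 0 1) := by
    refine antitoneOn_of_deriv_nonpos (convex_Icc 0 1)
      (fun s _ => (hd s).continuousAt.continuousWithinAt)
      (fun s _ => (hd s).differentiableAt.differentiableWithinAt) fun s hs => ?_
    rw [interior_Icc] at hs
    rw [(hd s).deriv, ← inner_sub_left]
    have h1 := real_inner_le_norm (gradient f (x + s • v) - gradient f x) v
    have h2 := hL (x + s • v) x
    rw [add_sub_cancel_left, norm_smul, Real.norm_of_nonneg hs.1.le] at h2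
    nlinarith [mul_le_mul_of_nonneg_right h2 (norm_nonneg v)]
  have h := hanti (Set.left_mem_Icc.2 zero_le_one) (Set.right_mem_Icc.2 zero_le_one) zero_le_one
  simp only [hφ] at h
  simp only [one_smul, zero_smul, add_zero] at h
  linarith

variable {n : ℕ} {f : Fin n → Vec d → ℝ}

theorem hasGradientAt_globalObj (hf : ∀ i, Differentiable ℝ (f i)) (x : Vec d) :
    HasGradientAt (globalObj f) (avg fun i => gradient (f i) x) x := by
  rw [hasGradientAt_iff_hasFDerivAt]
  have h : HasFDerivAt (fun x => ∑ i, f i x)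
      (∑ i, InnerProductSpace.toDual ℝ (Vec d) (gradient (f i) x)) x :=
    HasFDerivAt.fun_sum fun i _ => ((hf i) x).hasGradientAt.hasFDerivAt
  have h2 := h.const_mul (1 / (n : ℝ))
  rw [avg, map_smulₛₗ, map_sum]
  exact h2

theorem gradient_globalObj (hf : ∀ i, Differentiable ℝ (f i)) (x : Vec d) :
    gradient (globalObj f) x = avg fun i => gradient (f i) x :=
  (hasGradientAt_globalObj hf x).gradient

theorem norm_gradient_globalObj_sub_le (hn : 0 < n) {L : ℝ} (hf : ∀ i, Differentiable ℝ (f i))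
    (hL : ∀ i x y, ‖gradient (f i) x - gradient (f i) y‖ ≤ L * ‖x - y‖) (x y : Vec d) :
    ‖gradient (globalObj f) x - gradient (globalObj f) y‖ ≤ L * ‖x - y‖ := by
  rw [gradient_globalObj hf, gradient_globalObj hf, ← avg_sub]
  exact norm_avg_le hn _ fun i => hL i x y

/-- The global gradient at the average is itself an average of local gradients, so Jensen and the
Lipschitz bound apply agent by agent. -/
theorem norm_avg_gradient_sub_sq_le (hn : 0 < n) {L : ℝ} (hf : ∀ i, Differentiable ℝ (f i))
    (hL : ∀ i x y, ‖gradient (f i) x - gradient (f i) y‖ ≤ L * ‖x - y‖) (X : Fin n → Vec d) :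
    ‖avg (fun i => gradient (f i) (X i)) - gradient (globalObj f) (avg X)‖ ^ 2
      ≤ L ^ 2 / n * consensusError X := by
  rw [gradient_globalObj hf, ← avg_sub]
  refine (norm_avg_sq_le hn _).trans ?_
  have h : ∑ i, ‖gradient (f i) (X i) - gradient (f i) (avg X)‖ ^ 2
      ≤ ∑ i, L ^ 2 * ‖X i - avg X‖ ^ 2 := by
    refine Finset.sum_le_sum fun i _ => ?_
    rw [← mul_pow]
    exact pow_le_pow_left₀ (norm_nonneg _) (hL i _ _) 2
  rw [← Finset.mul_sum] at h
  calc _ ≤ 1 / (n : ℝ) * (L ^ 2 * ∑ i, ‖X i - avg X‖ ^ 2) := by gcongr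
    _ = _ := by
      rw [consensusError]
      ring

theorem abs_avg_coord_le (hn : 0 < n) {X : Fin n → Vec d} {c : ℝ} {k : Fin d}
    (h : ∀ i, |X i k| ≤ c) : |avg X k| ≤ c := by
  have hn' : (0 : ℝ) < n := by positivity
  have h1 : avg X k = 1 / (n : ℝ) * ∑ i, X i k := by simp [avg]
  rw [h1, abs_mul, abs_of_nonneg (by positivity), one_div, inv_mul_le_iff₀ hn']
  refine (Finset.abs_sum_le_sum_abs _ _).trans ((Finset.sum_le_sum fun i _ => h i).trans ?_)
  simp

theorem inner_vec (v w : Vec d) : inner ℝ v w = ∑ k, v k * w k := by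
  simp [PiLp.inner_apply, mul_comm]

end Smooth

/-! ### Pathwise analysis of the auxiliary sequence -/

section Path

variable {n d : ℕ} {Ξ Z : Type*} {p : Params} {W : Matrix (Fin n) (Fin n) ℝ}
  {grad : Fin n → Vec d → Ξ → Vec d} {Q : Z → Vec d → Vec d}
  {s : ℕ → Fin n → Ξ} {r : ℕ → Fin n → Z}

/-- The diagonal `1 / √(u + δ)` of the preconditioner. -/
noncomputable def State.precond (δ : ℝ) (st : State n d) (i : Fin n) (k : Fin d) : ℝ :=
  1 / √(st.u i k + δ)

/-- With a = √δ and b = √(u + δ), the gap is (b - a)/(ab) and u = (b - a)(b + a). The square is also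
bounded linearly in u, so both estimates inherit the factor 1 - β₂^{t+1}. -/
theorem inv_sqrt_sub_le {δ u : ℝ} (hδ : 0 < δ) (hu : 0 ≤ u) :
    1 / √δ - 1 / √(u + δ) ≤ u * (1 / √δ) ^ 3 ∧
      (1 / √δ - 1 / √(u + δ)) ^ 2 ≤ u * (1 / √δ) ^ 4 := by
  have ha : 0 < √δ := Real.sqrt_pos.2 hδ
  have hb : √δ ≤ √(u + δ) := Real.sqrt_le_sqrt (by linarith)
  have ha2 : √δ ^ 2 = δ := Real.sq_sqrt hδ.le
  have hb2 : √(u + δ) ^ 2 = u + δ := Real.sq_sqrt (by linarith)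
  set a := √δ
  set b := √(u + δ)
  have hb0 : 0 < b := ha.trans_le hb
  have hu' : u = (b - a) * (b + a) := by nlinarith
  have e : 1 / a - 1 / b = (b - a) / (a * b) := by field_simp
  rw [e, hu']
  constructor
  · rw [one_div, inv_pow, ← div_eq_mul_inv, div_le_div_iff₀ (by positivity) (by positivity)]
    have h1 : a ^ 3 ≤ (b + a) * (a * b) := by nlinarith [mul_pos ha hb0, mul_pos ha ha]
    nlinarith [mul_le_mul_of_nonneg_left h1 (sub_nonneg.2 hb)]
  · rw [one_div, inv_pow, ← div_eq_mul_inv, div_pow, div_le_div_iff₀ (by positivity) (by positivity)]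
    have h1 : (b - a) * a ^ 4 ≤ (b + a) * (a * b) ^ 2 := by
      have h2 : b - a ≤ b + a := by linarith
      have h3 : a ^ 4 ≤ (a * b) ^ 2 := by
        have : a ^ 2 ≤ b ^ 2 := by gcongr
        nlinarith [sq_nonneg a]
      exact mul_le_mul h2 h3 (by positivity) (by positivity)
    nlinarith [mul_le_mul_of_nonneg_left h1 (sub_nonneg.2 hb)]

theorem run_precond_nonneg (i : Fin n) (k : Fin d) (t : ℕ) (δ : ℝ) :
    0 ≤ (run p W grad Q s r t).precond δ i k := by
  unfold State.precond
  positivity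

/-- This monotonicity, due to the maximum in u, makes the drift errors telescope. -/
theorem run_precond_succ_le (hp : p.Admissible) (i : Fin n) (k : Fin d) (t : ℕ) :
    (run p W grad Q s r (t + 1)).precond p.δ i k ≤ (run p W grad Q s r t).precond p.δ i k := by
  have h1 := run_u_nonneg (p := p) (W := W) (grad := grad) (Q := Q) (s := s) (r := r) i k t
  have h2 := run_u_le_succ (p := p) (W := W) (grad := grad) (Q := Q) (s := s) (r := r) i k t
  have h3 := hp.δ_pos
  unfold State.precond
  gcongr

theorem run_precond_le (hp : p.Admissible) (i : Fin n) (k : Fin d) (t : ℕ) :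
    (run p W grad Q s r t).precond p.δ i k ≤ 1 / √p.δ := by
  have h1 := run_u_nonneg (p := p) (W := W) (grad := grad) (Q := Q) (s := s) (r := r) i k t
  have h3 := hp.δ_pos
  unfold State.precond
  gcongr
  linarith

/-- The part of the preconditioned gradient that is due to `u ≠ 0`. -/
noncomputable def precondGap (δ : ℝ) (g : Fin n → Vec d) (st : State n d) (i : Fin n) : Vec d :=
  WithLp.toLp 2 fun k => g i k * (1 / √δ - st.precond δ i k)

/-- The part of the momentum that is due to the change of the preconditioner. -/
noncomputable def precondDrift (δ : ℝ) (st st' : State n d) (i : Fin n) : Vec d :=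
  WithLp.toLp 2 fun k => st.m i k * (st.precond δ i k - st'.precond δ i k)

/-- The new preconditioner is replaced by the old one on the momentum, at the cost of the drift, and
by the constant 1/√δ on the fresh gradient, at the cost of the gap. -/
theorem run_dir_succ (t : ℕ) (i : Fin n) :
    (run p W grad Q s r (t + 1)).dir p.δ i
      = p.β₁ • (run p W grad Q s r t).dir p.δ i
        + (1 - p.β₁) • ((1 / √p.δ) • grad i ((run p W grad Q s r t).x i) (s t i)
          - precondGap p.δ (fun i => grad i ((run p W grad Q s r t).x i) (s t i))
            (run p W grad Q s r (t + 1)) i)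
        - p.β₁ • precondDrift p.δ (run p W grad Q s r t) (run p W grad Q s r (t + 1)) i := by
  ext k
  have hm : (run p W grad Q s r (t + 1)).m i k = p.β₁ * (run p W grad Q s r t).m i k
      + (1 - p.β₁) * grad i ((run p W grad Q s r t).x i) (s t i) k := rfl
  simp only [State.dir, precondGap, precondDrift, State.precond, PiLp.add_apply, PiLp.sub_apply,
    PiLp.smul_apply, smul_eq_mul, hm]
  ring

theorem auxSeq_run (hW : W ∈ doublyStochastic ℝ (Fin n)) (t : ℕ) :
    auxSeq p.β₁ (fun t => avg (run p W grad Q s r t).x) t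
      = avg (run p W grad Q s r t).x
        - (p.α * p.β₁ / (1 - p.β₁)) • avg ((run p W grad Q s r t).dir p.δ) := by
  cases t with
  | zero =>
    have h : (run p W grad Q s r 0).dir p.δ = 0 := by
      funext i
      ext k
      simp [State.dir, run, State.init]
    rw [auxSeq, h]
    simp [avg]
  | succ t =>
    have h : avg (run p W grad Q s r (t + 1)).x = avg (run p W grad Q s r t).x
        - p.α • avg ((run p W grad Q s r (t + 1)).dir p.δ) :=
      avg_step_x grad Q (run p W grad Q s r t) (s t) (r t) hW
    rw [auxSeq, Nat.add_sub_cancel]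
    simp only [h]
    module

/-- If D and D' are consecutive averaged directions, the increment is -(α/(1 - β₁))(D' - β₁D). The
old direction cancels against the momentum part of D'. -/
theorem auxSeq_run_succ (hp : p.Admissible) (hW : W ∈ doublyStochastic ℝ (Fin n)) (t : ℕ) :
    auxSeq p.β₁ (fun t => avg (run p W grad Q s r t).x) (t + 1)
      = auxSeq p.β₁ (fun t => avg (run p W grad Q s r t).x) t
        + (-(p.α * (1 / √p.δ)) • avg (fun i => grad i ((run p W grad Q s r t).x i) (s t i))
          + p.α • avg (precondGap p.δ (fun i => grad i ((run p W grad Q s r t).x i) (s t i))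
            (run p W grad Q s r (t + 1)))
          + (p.α * p.β₁ / (1 - p.β₁)) • avg
            (precondDrift p.δ (run p W grad Q s r t) (run p W grad Q s r (t + 1)))) := by
  have hβ : 1 - p.β₁ ≠ 0 := by linarith [hp.β₁_lt_one]
  have h : avg (run p W grad Q s r (t + 1)).x = avg (run p W grad Q s r t).x
      - p.α • avg ((run p W grad Q s r (t + 1)).dir p.δ) :=
    avg_step_x grad Q (run p W grad Q s r t) (s t) (r t) hW
  have h2 := congrArg avg (funext (run_dir_succ (p := p) (W := W) (grad := grad) (Q := Q) (s := s)
    (r := r) t))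
  rw [avg_sub, avg_add, avg_smul, avg_smul, avg_smul, avg_sub, avg_smul] at h2
  rw [auxSeq_run hW, auxSeq_run hW, h]
  change avg ((run p W grad Q s r (t + 1)).dir p.δ) = _ at h2
  rw [h2]
  match_scalars <;> field_simp <;> ring

/-- The average over the agents of the trace of the preconditioner. -/
noncomputable def State.meanPrecond (δ : ℝ) (st : State n d) : ℝ :=
  1 / (n : ℝ) * ∑ i, ∑ k, st.precond δ i k

variable {b : ℝ} (hn : 0 < n) (hp : p.Admissible)
  (hg : ∀ t i k, |grad i ((run p W grad Q s r t).x i) (s t i) k| ≤ b)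

include hn hp hg

theorem inner_avg_precondGap_le {v : Vec d} (hv : ∀ k, |v k| ≤ b) (t : ℕ) :
    inner ℝ v (avg (precondGap p.δ (fun i => grad i ((run p W grad Q s r t).x i) (s t i))
        (run p W grad Q s r (t + 1))))
      ≤ d * b ^ 4 * (1 - p.β₂ ^ (t + 1)) * (1 / √p.δ) ^ 3 := by
  have hn' : (n : ℝ) ≠ 0 := by positivity
  rw [inner_avg_right, one_div (n : ℝ), inv_mul_le_iff₀ (by positivity)]
  refine (Finset.sum_le_sum (g := fun _ => d * b ^ 4 * (1 - p.β₂ ^ (t + 1)) * (1 / √p.δ) ^ 3)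
    fun i _ => ?_).trans (by simp)
  rw [inner_vec]
  refine (Finset.sum_le_sum (g := fun _ => b ^ 4 * (1 - p.β₂ ^ (t + 1)) * (1 / √p.δ) ^ 3)
    fun k _ => ?_).trans (le_of_eq (by simp; ring))
  have hb : 0 ≤ b := (abs_nonneg _).trans (hv k)
  have h1 := run_u_le hp (fun t => hg t i k) (t + 1)
  have h2 := (inv_sqrt_sub_le hp.δ_pos (run_u_nonneg (p := p) (W := W) (grad := grad) (Q := Q)
    (s := s) (r := r) i k (t + 1))).1
  have h3 := run_precond_le (W := W) (grad := grad) (Q := Q) (s := s) (r := r) hp i k (t + 1)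
  change 1 / √p.δ - (run p W grad Q s r (t + 1)).precond p.δ i k ≤ _ at h2
  have h4 : 0 ≤ 1 / √p.δ - (run p W grad Q s r (t + 1)).precond p.δ i k := by linarith
  have h5 : 1 / √p.δ - (run p W grad Q s r (t + 1)).precond p.δ i k
      ≤ (1 - p.β₂ ^ (t + 1)) * b ^ 2 * (1 / √p.δ) ^ 3 := h2.trans (by gcongr)
  refine (le_abs_self _).trans ?_
  rw [precondGap, abs_mul, abs_mul, abs_of_nonneg h4]
  calc _ ≤ b * (b * ((1 - p.β₂ ^ (t + 1)) * b ^ 2 * (1 / √p.δ) ^ 3)) := by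
        have := hg t i k
        have := hv k
        gcongr
    _ = _ := by ring

theorem norm_avg_precondGap_sq_le (t : ℕ) :
    ‖avg (precondGap p.δ (fun i => grad i ((run p W grad Q s r t).x i) (s t i))
        (run p W grad Q s r (t + 1)))‖ ^ 2
      ≤ d * b ^ 4 * (1 - p.β₂ ^ (t + 1)) * (1 / √p.δ) ^ 4 := by
  have hn' : (n : ℝ) ≠ 0 := by positivity
  refine (norm_avg_sq_le hn _).trans ?_
  rw [one_div (n : ℝ), inv_mul_le_iff₀ (by positivity)]
  refine (Finset.sum_le_sum (g := fun _ => d * b ^ 4 * (1 - p.β₂ ^ (t + 1)) * (1 / √p.δ) ^ 4)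
    fun i _ => ?_).trans (by simp)
  rw [norm_sq_eq_sum_coord]
  refine (Finset.sum_le_sum (g := fun _ => b ^ 4 * (1 - p.β₂ ^ (t + 1)) * (1 / √p.δ) ^ 4)
    fun k _ => ?_).trans (le_of_eq (by simp; ring))
  have h1 := run_u_le hp (fun t => hg t i k) (t + 1)
  have h2 := (inv_sqrt_sub_le hp.δ_pos (run_u_nonneg (p := p) (W := W) (grad := grad) (Q := Q)
    (s := s) (r := r) i k (t + 1))).2
  change (1 / √p.δ - (run p W grad Q s r (t + 1)).precond p.δ i k) ^ 2 ≤ _ at h2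
  have h5 : (1 / √p.δ - (run p W grad Q s r (t + 1)).precond p.δ i k) ^ 2
      ≤ (1 - p.β₂ ^ (t + 1)) * b ^ 2 * (1 / √p.δ) ^ 4 := h2.trans (by gcongr)
  rw [precondGap, mul_pow]
  calc _ ≤ b ^ 2 * ((1 - p.β₂ ^ (t + 1)) * b ^ 2 * (1 / √p.δ) ^ 4) := by
        have := sq_le_sq.2 ((hg t i k).trans (le_abs_self b))
        gcongr
    _ = _ := by ring

theorem inner_avg_precondDrift_le {v : Vec d} (hv : ∀ k, |v k| ≤ b) (t : ℕ) :
    inner ℝ v (avg (precondDrift p.δ (run p W grad Q s r t) (run p W grad Q s r (t + 1))))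
      ≤ b ^ 2 * ((run p W grad Q s r t).meanPrecond p.δ
        - (run p W grad Q s r (t + 1)).meanPrecond p.δ) := by
  rw [inner_avg_right, State.meanPrecond, State.meanPrecond, ← mul_sub, mul_left_comm]
  refine mul_le_mul_of_nonneg_left ?_ (by positivity)
  rw [← Finset.sum_sub_distrib, Finset.mul_sum]
  refine Finset.sum_le_sum fun i _ => ?_
  rw [inner_vec, ← Finset.sum_sub_distrib, Finset.mul_sum]
  refine Finset.sum_le_sum fun k _ => ?_
  have hb : 0 ≤ b := (abs_nonneg _).trans (hv k)
  have h1 := abs_run_m_le hp (fun t => hg t i k) t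
  have h2 := run_precond_succ_le (W := W) (grad := grad) (Q := Q) (s := s) (r := r) hp i k t
  refine (le_abs_self _).trans ?_
  rw [precondDrift, abs_mul, abs_mul, abs_of_nonneg (sub_nonneg.2 h2)]
  calc _ ≤ b * (b * ((run p W grad Q s r t).precond p.δ i k
        - (run p W grad Q s r (t + 1)).precond p.δ i k)) := by
        have := hv k
        have := sub_nonneg.2 h2
        gcongr
    _ = _ := by ring

/-- Preconditioner entries lie in [0, 1/√δ], so a squared decrease is at most 1/√δ times the
decrease; the quadratic error telescopes too. -/
theorem norm_avg_precondDrift_sq_le (t : ℕ) :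
    ‖avg (precondDrift p.δ (run p W grad Q s r t) (run p W grad Q s r (t + 1)))‖ ^ 2
      ≤ b ^ 2 * (1 / √p.δ) * ((run p W grad Q s r t).meanPrecond p.δ
        - (run p W grad Q s r (t + 1)).meanPrecond p.δ) := by
  refine (norm_avg_sq_le hn _).trans ?_
  rw [State.meanPrecond, State.meanPrecond, ← mul_sub, mul_left_comm]
  refine mul_le_mul_of_nonneg_left ?_ (by positivity)
  rw [← Finset.sum_sub_distrib, Finset.mul_sum]
  refine Finset.sum_le_sum fun i _ => ?_
  rw [norm_sq_eq_sum_coord, ← Finset.sum_sub_distrib, Finset.mul_sum]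
  refine Finset.sum_le_sum fun k _ => ?_
  have h1 := sq_le_sq.2 ((abs_run_m_le hp (fun t => hg t i k) t).trans (le_abs_self b))
  have h2 := run_precond_succ_le (W := W) (grad := grad) (Q := Q) (s := s) (r := r) hp i k t
  have h3 := run_precond_le (W := W) (grad := grad) (Q := Q) (s := s) (r := r) hp i k t
  have h4 := run_precond_nonneg (p := p) (W := W) (grad := grad) (Q := Q) (s := s) (r := r) i k
    (t + 1) p.δ
  rw [precondDrift, mul_pow]
  calc _ ≤ b ^ 2 * ((1 / √p.δ) * ((run p W grad Q s r t).precond p.δ i k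
        - (run p W grad Q s r (t + 1)).precond p.δ i k)) := by
        rw [sq ((run p W grad Q s r t).precond p.δ i k
          - (run p W grad Q s r (t + 1)).precond p.δ i k)]
        have := sub_nonneg.2 h2
        gcongr
        linarith
    _ = _ := by ring

/-- The descent of the objective along one iteration. -/
theorem globalObj_auxSeq_succ_le (hW : W ∈ doublyStochastic ℝ (Fin n)) {f : Fin n → Vec d → ℝ}
    {L : ℝ} (hL0 : 0 ≤ L) (hf : ∀ i, Differentiable ℝ (f i))
    (hL : ∀ i x y, ‖gradient (f i) x - gradient (f i) y‖ ≤ L * ‖x - y‖)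
    (hfb : ∀ i x k, |gradient (f i) x k| ≤ b) (t : ℕ) {z : ℕ → Vec d}
    (hz : z = auxSeq p.β₁ fun t => avg (run p W grad Q s r t).x) :
    globalObj f (z (t + 1)) ≤ globalObj f (z t)
      - p.α * (1 / √p.δ) * inner ℝ (gradient (globalObj f) (z t))
        (avg fun i => grad i ((run p W grad Q s r t).x i) (s t i))
      + 2 * L * p.α ^ 2 * (1 / √p.δ) ^ 2
        * ‖avg fun i => grad i ((run p W grad Q s r t).x i) (s t i)‖ ^ 2
      + p.α * (d * b ^ 4 * (1 - p.β₂ ^ (t + 1)) * (1 / √p.δ) ^ 3)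
      + 2 * L * p.α ^ 2 * (d * b ^ 4 * (1 - p.β₂ ^ (t + 1)) * (1 / √p.δ) ^ 4)
      + (p.α * p.β₁ / (1 - p.β₁) + L * (p.α * p.β₁ / (1 - p.β₁)) ^ 2 * (1 / √p.δ)) * b ^ 2
        * ((run p W grad Q s r t).meanPrecond p.δ
          - (run p W grad Q s r (t + 1)).meanPrecond p.δ) := by
  have hα := hp.α_pos.le
  have hdiff : Differentiable ℝ (globalObj f) := fun x =>
    (hasGradientAt_globalObj hf x).differentiableAt
  have hc : 0 ≤ p.α * p.β₁ / (1 - p.β₁) :=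
    div_nonneg (mul_nonneg hα hp.β₁_pos.le) (by linarith [hp.β₁_lt_one])
  have hv : ∀ k, |gradient (globalObj f) (z t) k| ≤ b := fun k => by
    rw [gradient_globalObj hf]
    exact abs_avg_coord_le hn fun i => hfb i _ k
  have hstep := auxSeq_run_succ (W := W) (grad := grad) (Q := Q) (s := s) (r := r) hp hW t
  rw [← hz] at hstep
  have h1 := inner_avg_precondGap_le (r := r) (W := W) (Q := Q) hn hp hg hv t
  have h2 := norm_avg_precondGap_sq_le (r := r) (W := W) (Q := Q) hn hp hg t
  have h3 := inner_avg_precondDrift_le (r := r) (W := W) (Q := Q) hn hp hg hv t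
  have h4 := norm_avg_precondDrift_sq_le (r := r) (W := W) (Q := Q) hn hp hg t
  rw [hstep]
  generalize p.α * p.β₁ / (1 - p.β₁) = c at *
  generalize (avg fun i => grad i ((run p W grad Q s r t).x i) (s t i)) = g at *
  generalize avg (precondGap p.δ _ _) = A at *
  generalize avg (precondDrift p.δ _ _) = D at *
  refine (le_add_inner_add_sq_of_lipschitz_gradient hdiff
    (norm_gradient_globalObj_sub_le hn hf hL) (z t) _).trans ?_
  -- The drift is split off first, then the gap. This yields the weights L for the drift and 2L for
  -- the gradient and gap.
  have h5 := norm_add_sq_le_two (-(p.α * (1 / √p.δ)) • g + p.α • A) (c • D)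
  have h6 := norm_add_sq_le_two (-(p.α * (1 / √p.δ)) • g) (p.α • A)
  rw [norm_smul, norm_smul, mul_pow, mul_pow, Real.norm_eq_abs, Real.norm_eq_abs, sq_abs, sq_abs]
    at h6
  rw [norm_smul c, mul_pow, Real.norm_eq_abs, sq_abs] at h5
  rw [inner_add_right, inner_add_right, real_inner_smul_right, real_inner_smul_right,
    real_inner_smul_right]
  have h7 := mul_le_mul_of_nonneg_left h1 hα
  have h8 := mul_le_mul_of_nonneg_left h3 hc
  have h9 := mul_le_mul_of_nonneg_left h2 (by positivity : 0 ≤ 2 * L * p.α ^ 2)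
  have h10 := mul_le_mul_of_nonneg_left h4 (by positivity : 0 ≤ L * c ^ 2)
  have h11 := mul_le_mul_of_nonneg_left h5 (by positivity : 0 ≤ L / 2)
  have h12 := mul_le_mul_of_nonneg_left h6 hL0
  linarith

end Path

/-! ### Stochastic gradient noise -/

section Noise

variable {n d : ℕ} {Ξ Z Ω : Type*} [MeasurableSpace Ω] {P : Measure Ω}

theorem integrable_inner_of_ae_bound [IsFiniteMeasure P] {V U : Ω → Vec d} (hV : Measurable V) (hU : Measurable U)
    {a b : ℝ} (ha : ∀ᵐ ω ∂P, ‖V ω‖ ≤ a) (hb : ∀ᵐ ω ∂P, ‖U ω‖ ≤ b) :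
    Integrable (fun ω => inner ℝ (V ω) (U ω)) P := by
  refine Integrable.of_bound (hV.inner hU).aestronglyMeasurable (a * b) ?_
  filter_upwards [ha, hb] with ω h1 h2
  exact (norm_inner_le_norm _ _).trans
    (mul_le_mul h1 h2 (norm_nonneg _) ((norm_nonneg _).trans h1))

/-- The stochastic error of the gradient of agent `i` in iteration `t`. -/
noncomputable def noise (grad : Fin n → Vec d → Ξ → Vec d) (ψ : Fin n → Vec d → Vec d)
    (S : ℕ → Ω → State n d) (ξ : Fin n → ℕ → Ω → Ξ) (t : ℕ) (ω : Ω) (i : Fin n) : Vec d :=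
  grad i ((S t ω).x i) (ξ i t ω) - ψ i ((S t ω).x i)

theorem measurable_avg {X : Ω → Fin n → Vec d} (hX : ∀ i, Measurable fun ω => X ω i) :
    Measurable fun ω => avg (X ω) := by
  unfold avg
  fun_prop

variable {p : Params} {W : Matrix (Fin n) (Fin n) ℝ} {grad : Fin n → Vec d → Ξ → Vec d}
  {Q : Z → Vec d → Vec d} {ξ : Fin n → ℕ → Ω → Ξ} {ζ : Fin n → ℕ → Ω → Z}
  {ψ : Fin n → Vec d → Vec d} {B : ℝ}

theorem ae_norm_noise_le
    (hB : ∀ᵐ ω ∂P, ∀ t i, ‖grad i ((iter p W grad Q ξ ζ t ω).x i) (ξ i t ω)‖ ≤ B)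
    (hψB : ∀ i x, ‖ψ i x‖ ≤ B) :
    ∀ᵐ ω ∂P, ∀ t i, ‖noise grad ψ (iter p W grad Q ξ ζ) ξ t ω i‖ ≤ 2 * B := by
  filter_upwards [hB] with ω h t i
  refine (norm_sub_le _ _).trans ?_
  linarith [h t i, hψB i ((iter p W grad Q ξ ζ t ω).x i)]

variable [MeasurableSpace Ξ] [MeasurableSpace Z] {D : Fin n → Measure Ξ} {ν : Measure Z}
  (hn : 0 < n) (hgrad : ∀ i, Measurable fun v : Vec d × Ξ => grad i v.1 v.2)
  (hψ : ∀ i, Measurable (ψ i))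
  (hQ : Measurable fun v : Z × Vec d => Q v.1 v.2) (hξζ : IsSampling P D ν ξ ζ)
  (hB : ∀ᵐ ω ∂P, ∀ t i, ‖grad i ((iter p W grad Q ξ ζ t ω).x i) (ξ i t ω)‖ ≤ B)
  (hψB : ∀ i x, ‖ψ i x‖ ≤ B)
  (hmean : ∀ i t, ∀ᵐ ω ∂P, ∫ s, grad i ((iter p W grad Q ξ ζ t ω).x i) s ∂(D i)
    = ψ i ((iter p W grad Q ξ ζ t ω).x i))

section

include hgrad hψ hQ hξζ

theorem measurable_noise (t : ℕ) (i : Fin n) :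
    Measurable fun ω => noise grad ψ (iter p W grad Q ξ ζ) ξ t ω i := by
  have hx := (meas_iter (p := p) (W := W) hgrad hQ hξζ t).x i
  exact ((hgrad i).comp (hx.prodMk (hξζ.measurable_sample i t))).sub ((hψ i).comp hx)

end

variable [IsProbabilityMeasure P] [∀ i, IsProbabilityMeasure (D i)]

include hgrad hψ hQ hξζ hB hψB hmean

/-- The test vector may involve everything up to iteration t except agent i's own sample, and all
seeds; this covers both the past and the noise of another agent. -/
theorem integral_inner_noise_eq_zero (t : ℕ) (i : Fin n) {V : Ω → Vec d} {c : ℝ}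
    (hVc : ∀ᵐ ω ∂P, ‖V ω‖ ≤ c)
    (hV : ∀ m : MeasurableSpace Ω,
      (∀ j s, s ≤ t → (j, s) ≠ (i, t) → Measurable[m] (ξ j s)) →
      (∀ j s, Measurable[m] (ζ j s)) → Measurable[m] V) :
    ∫ ω, inner ℝ (V ω) (noise grad ψ (iter p W grad Q ξ ζ) ξ t ω i) ∂P = 0 := by
  have hx : ∀ m : MeasurableSpace Ω,
      (∀ j s, s ≤ t → (j, s) ≠ (i, t) → Measurable[m] (ξ j s)) →
      (∀ j s, Measurable[m] (ζ j s)) →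
      Measurable[m] fun ω => (iter p W grad Q ξ ζ t ω).x i := by
    intro m h1 h2
    let := m
    refine (measurable_run hgrad hQ t (fun s hs j => h1 j s hs.le ?_) fun s _ j => h2 j s).x i
    simp [hs.ne]
  exact integral_inner_sub_eq_zero (hgrad i) (hψ i)
    (hV _ (fun j s _ _ => hξζ.measurable_sample j s) hξζ.measurable_seed)
    (hx _ (fun j s _ _ => hξζ.measurable_sample j s) hξζ.measurable_seed)
    (hξζ.measurable_sample i t)
    (hξζ.indepFun_sample i t fun m h1 h2 => (hV m h1 h2).prodMk (hx m h1 h2))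
    (hξζ.map_sample i t) (hB.mono fun ω h => h t i) (hψB i) hVc (hmean i t)

/-- The average noise is orthogonal to the past. -/
theorem integral_inner_avg_noise_eq_zero (t : ℕ) {V : Ω → Vec d} {c : ℝ}
    (hVc : ∀ᵐ ω ∂P, ‖V ω‖ ≤ c)
    (hV : ∀ m : MeasurableSpace Ω, (∀ s < t, ∀ j, Measurable[m] (ξ j s)) →
      (∀ j s, Measurable[m] (ζ j s)) → Measurable[m] V) :
    ∫ ω, inner ℝ (V ω) (avg (noise grad ψ (iter p W grad Q ξ ζ) ξ t ω)) ∂P = 0 := by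
  have hVm := hV _ (fun s _ j => hξζ.measurable_sample j s) hξζ.measurable_seed
  simp only [inner_avg_right]
  rw [integral_const_mul, integral_finsetSum _ fun i _ => integrable_inner_of_ae_bound hVm
    (measurable_noise hgrad hψ hQ hξζ t i) hVc ((ae_norm_noise_le hB hψB).mono fun ω h => h t i)]
  refine mul_eq_zero_of_right _ (Finset.sum_eq_zero fun i _ => ?_)
  refine integral_inner_noise_eq_zero hgrad hψ hQ hξζ hB hψB hmean t i hVc fun m h1 h2 =>
    hV m (fun s hs j => h1 j s hs.le ?_) h2
  simp [hs.ne]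

include hn

/-- Averaging over the agents reduces the variance of the noise. -/
theorem integral_norm_avg_noise_sq_le (t : ℕ) :
    ∫ ω, ‖avg (noise grad ψ (iter p W grad Q ξ ζ) ξ t ω)‖ ^ 2 ∂P ≤ 4 * B ^ 2 / n := by
  have hm := measurable_noise (p := p) (W := W) hgrad hψ hQ hξζ t
  have hb : ∀ i, ∀ᵐ ω ∂P, ‖noise grad ψ (iter p W grad Q ξ ζ) ξ t ω i‖ ≤ 2 * B := fun i =>
    (ae_norm_noise_le hB hψB).mono fun ω h => h t i
  have hi := fun i j => integrable_inner_of_ae_bound (hm i) (hm j) (hb i) (hb j)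
  -- The noise of agent i is an admissible test vector for agent j: it depends on the iterate and on
  -- `ξ i t`, never on `ξ j t`.
  have hij : ∀ i j, j ≠ i → ∫ ω, inner ℝ (noise grad ψ (iter p W grad Q ξ ζ) ξ t ω i)
      (noise grad ψ (iter p W grad Q ξ ζ) ξ t ω j) ∂P = 0 := by
    intro i j hne
    refine integral_inner_noise_eq_zero hgrad hψ hQ hξζ hB hψB hmean t j (hb i) fun m h1 h2 => ?_
    let := m
    have hx := (measurable_run (p := p) (W := W) hgrad hQ t (fun s hs k => h1 k s hs.le
      (by simp [hs.ne])) fun s _ k => h2 k s).x i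
    exact ((hgrad i).comp (hx.prodMk (h1 i t le_rfl (by simp [hne.symm])))).sub ((hψ i).comp hx)
  have hii : ∀ i, ∫ ω, inner ℝ (noise grad ψ (iter p W grad Q ξ ζ) ξ t ω i)
      (noise grad ψ (iter p W grad Q ξ ζ) ξ t ω i) ∂P ≤ 4 * B ^ 2 := by
    intro i
    refine (integral_mono_ae (hi i i) (integrable_const (4 * B ^ 2)) ?_).trans (by simp)
    filter_upwards [hb i] with ω h
    rw [real_inner_self_eq_norm_sq]
    have := pow_le_pow_left₀ (norm_nonneg _) h 2
    linarith
  simp only [← real_inner_self_eq_norm_sq, inner_avg_left, inner_avg_right]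
  rw [integral_const_mul, integral_finsetSum _ fun i _ =>
    (integrable_finsetSum _ fun j _ => hi j i).const_mul _]
  have hsum : ∀ i ∈ Finset.univ, ∫ ω, 1 / (n : ℝ) * ∑ j,
      inner ℝ (noise grad ψ (iter p W grad Q ξ ζ) ξ t ω j)
        (noise grad ψ (iter p W grad Q ξ ζ) ξ t ω i) ∂P ≤ 1 / (n : ℝ) * (4 * B ^ 2) := by
    intro i _
    rw [integral_const_mul, integral_finsetSum _ fun j _ => hi j i,
      Finset.sum_eq_single i (fun j _ hj => hij j i hj.symm) (by simp)]
    exact mul_le_mul_of_nonneg_left (hii i) (by positivity)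
  refine (mul_le_mul_of_nonneg_left (Finset.sum_le_sum hsum) (by positivity)).trans ?_
  simp
  apply le_of_eq
  field_simp

end Noise

/-! ### Descent from an inexact gradient -/

section Descent

/-- With V = G + a and N = G + b, right side minus left side equals ‖7G + 6(a + b)‖²/84 + ‖a +
b‖²/14 + ‖a‖² + ‖b‖². The weight is 5/12 = 1/6 + 1/4: a sixth pays for the second-order term, a
quarter is kept. -/
theorem neg_inner_add_le {E : Type*} [NormedAddCommGroup E] [InnerProductSpace ℝ E] (G V N : E) :
    -inner ℝ V N + 5 / 12 * ‖G‖ ^ 2 ≤ 3 / 2 * (‖V - G‖ ^ 2 + ‖N - G‖ ^ 2) := by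
  obtain ⟨a, rfl⟩ : ∃ a, V = G + a := ⟨V - G, by abel⟩
  obtain ⟨b, rfl⟩ : ∃ b, N = G + b := ⟨N - G, by abel⟩
  have h1 : 0 ≤ ‖(7 : ℝ) • G + (6 : ℝ) • (a + b)‖ ^ 2 := sq_nonneg _
  have h2 : 0 ≤ ‖a + b‖ ^ 2 := sq_nonneg _
  simp only [add_sub_cancel_left]
  rw [norm_add_sq_real, norm_smul, norm_smul, mul_pow, mul_pow, inner_smul_left, inner_smul_right,
    inner_add_right, norm_add_sq_real a b] at h1
  rw [norm_add_sq_real] at h2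
  rw [inner_add_left, inner_add_right, inner_add_right, real_inner_self_eq_norm_sq,
    real_inner_comm G a]
  norm_num at h1
  have h3 : 0 ≤ ‖a‖ ^ 2 := sq_nonneg _
  have h4 : 0 ≤ ‖b‖ ^ 2 := sq_nonneg _
  linarith

/-- Descent obtained from a noisy gradient `N + e`, where `N` and the gradient `V` at the auxiliary
point are close to the gradient `G` at the average. -/
theorem neg_inner_add_norm_sq_le {E : Type*} [NormedAddCommGroup E] [InnerProductSpace ℝ E]
    (G V N e : E) {α h L R : ℝ} (hα : 0 ≤ α) (hL : 0 ≤ L) (hR : 0 < R) (hRh : 1 / R ≤ h)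
    (hα₁ : 24 * L * R * α * h ^ 2 ≤ 1) :
    -(α * h * inner ℝ V (N + e)) + 2 * L * α ^ 2 * h ^ 2 * ‖N + e‖ ^ 2
      ≤ -(α / (4 * R) * ‖G‖ ^ 2) + 3 / 2 * α * h * (‖V - G‖ ^ 2 + ‖N - G‖ ^ 2)
        + 4 * L * α ^ 2 * h ^ 2 * ‖N - G‖ ^ 2
        + (-(α * h) * inner ℝ V e + 4 * L * α ^ 2 * h ^ 2 * inner ℝ N e
          + 2 * L * α ^ 2 * h ^ 2 * ‖e‖ ^ 2) := by
  have hh : 0 < h := lt_of_lt_of_le (by positivity) hRh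
  have h1 := mul_le_mul_of_nonneg_left (neg_inner_add_le G V N) (mul_nonneg hα hh.le)
  have h2 : ‖N‖ ^ 2 ≤ 2 * ‖G‖ ^ 2 + 2 * ‖N - G‖ ^ 2 := by
    simpa using norm_add_sq_le_two G (N - G)
  have h3 := mul_le_mul_of_nonneg_left h2 (by positivity : 0 ≤ 2 * L * α ^ 2 * h ^ 2)
  -- This is where the constant 24 in the step-size condition is needed.
  have h4 : 4 * L * α ^ 2 * h ^ 2 ≤ α / (6 * R) := by
    rw [le_div_iff₀ (by positivity)]
    nlinarith [mul_le_mul_of_nonneg_left hα₁ hα]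
  have h5 := mul_le_mul_of_nonneg_right h4 (sq_nonneg ‖G‖)
  have h6 : α / (6 * R) + α / (4 * R) ≤ α * h * (5 / 12) := by
    have : α / (6 * R) + α / (4 * R) = α * (1 / R) * (5 / 12) := by
      ring
    rw [this]
    gcongr
  have h7 := mul_le_mul_of_nonneg_right h6 (sq_nonneg ‖G‖)
  rw [norm_add_sq_real, inner_add_right]
  linarith

end Descent

/-! ### The descent inequality along a path -/

section PathBounds

variable {n d : ℕ} {Ξ Z : Type*} {p : Params} {W : Matrix (Fin n) (Fin n) ℝ}
  {grad : Fin n → Vec d → Ξ → Vec d} {Q : Z → Vec d → Vec d}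
  {s : ℕ → Fin n → Ξ} {r : ℕ → Fin n → Z} {B : ℝ}

theorem norm_avg_run_dir_le (hn : 0 < n) (hp : p.Admissible)
    (hg : ∀ t i, ‖grad i ((run p W grad Q s r t).x i) (s t i)‖ ≤ B) (t : ℕ) :
    ‖avg ((run p W grad Q s r t).dir p.δ)‖ ≤ √(B ^ 2 / p.δ) :=
  norm_avg_le hn _ fun i => Real.le_sqrt_of_sq_le (norm_run_dir_sq_le hp (fun t => hg t i) t)

theorem norm_avg_run_x_le (hn : 0 < n) (hp : p.Admissible) (hW : W ∈ doublyStochastic ℝ (Fin n))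
    (hg : ∀ t i, ‖grad i ((run p W grad Q s r t).x i) (s t i)‖ ≤ B) (t : ℕ) :
    ‖avg (run p W grad Q s r t).x‖ ≤ t * (p.α * √(B ^ 2 / p.δ)) := by
  induction t with
  | zero => simp [run, State.init, avg]
  | succ t ih =>
    have h : avg (run p W grad Q s r (t + 1)).x = avg (run p W grad Q s r t).x
        - p.α • avg ((run p W grad Q s r (t + 1)).dir p.δ) :=
      avg_step_x grad Q (run p W grad Q s r t) (s t) (r t) hW
    have h2 := mul_le_mul_of_nonneg_left
      (norm_avg_run_dir_le (Q := Q) (r := r) (W := W) hn hp hg (t + 1)) hp.α_pos.le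
    rw [h]
    refine (norm_sub_le _ _).trans ?_
    rw [norm_smul, Real.norm_of_nonneg hp.α_pos.le]
    push_cast
    linarith

/-- Crude and growing with t, but it keeps z^t in a fixed ball for each t, which makes f(z^t)
integrable. -/
theorem norm_auxSeq_run_le (hn : 0 < n) (hp : p.Admissible) (hW : W ∈ doublyStochastic ℝ (Fin n))
    (hg : ∀ t i, ‖grad i ((run p W grad Q s r t).x i) (s t i)‖ ≤ B) (t : ℕ) :
    ‖auxSeq p.β₁ (fun t => avg (run p W grad Q s r t).x) t‖
      ≤ t * (p.α * √(B ^ 2 / p.δ)) + p.α * p.β₁ / (1 - p.β₁) * √(B ^ 2 / p.δ) := by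
  have hc : 0 ≤ p.α * p.β₁ / (1 - p.β₁) :=
    div_nonneg (mul_nonneg hp.α_pos.le hp.β₁_pos.le) (by linarith [hp.β₁_lt_one])
  rw [auxSeq_run hW]
  refine (norm_sub_le _ _).trans (add_le_add (norm_avg_run_x_le hn hp hW hg t) ?_)
  rw [norm_smul, Real.norm_of_nonneg hc]
  exact mul_le_mul_of_nonneg_left (norm_avg_run_dir_le hn hp hg t) hc

theorem norm_auxSeq_run_sub_sq_le (hn : 0 < n) (hp : p.Admissible)
    (hW : W ∈ doublyStochastic ℝ (Fin n))
    (hg : ∀ t i, ‖grad i ((run p W grad Q s r t).x i) (s t i)‖ ≤ B) (t : ℕ) :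
    ‖auxSeq p.β₁ (fun t => avg (run p W grad Q s r t).x) t - avg (run p W grad Q s r t).x‖ ^ 2
      ≤ (p.α * p.β₁ / (1 - p.β₁)) ^ 2 * (B ^ 2 / p.δ) := by
  have hδ := hp.δ_pos
  rw [auxSeq_run hW, sub_sub_cancel_left, norm_neg, norm_smul, mul_pow, Real.norm_eq_abs, sq_abs]
  refine mul_le_mul_of_nonneg_left ?_ (sq_nonneg _)
  have h := pow_le_pow_left₀ (norm_nonneg _)
    (norm_avg_run_dir_le (Q := Q) (r := r) (W := W) hn hp hg t) 2
  rwa [Real.sq_sqrt (by positivity)] at h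

/-- The part of the descent inequality of iteration `t` that is linear or quadratic in the average
noise `e`; `N` is the average of the local gradients and `V` the gradient at the auxiliary point. -/
noncomputable def noiseTerm (p : Params) (L : ℝ) (V N e : Vec d) : ℝ :=
  -(p.α * (1 / √p.δ)) * inner ℝ V e + 4 * L * p.α ^ 2 * (1 / √p.δ) ^ 2 * inner ℝ N e
    + 2 * L * p.α ^ 2 * (1 / √p.δ) ^ 2 * ‖e‖ ^ 2

/-- The deterministic error terms of the descent inequality of iteration `t`. -/
noncomputable def driftTerm (d : ℕ) (p : Params) (L B b : ℝ) (t : ℕ) : ℝ :=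
  3 / 2 * p.α * (1 / √p.δ) * (L ^ 2 * ((p.α * p.β₁ / (1 - p.β₁)) ^ 2 * (B ^ 2 / p.δ)))
    + p.α * (d * b ^ 4 * (1 - p.β₂ ^ (t + 1)) * (1 / √p.δ) ^ 3)
    + 2 * L * p.α ^ 2 * (d * b ^ 4 * (1 - p.β₂ ^ (t + 1)) * (1 / √p.δ) ^ 4)

/-- The factor of the consensus error in the descent inequality. -/
noncomputable def consensusFactor (n : ℕ) (p : Params) (L : ℝ) : ℝ :=
  (3 / 2 * p.α * (1 / √p.δ) + 4 * L * p.α ^ 2 * (1 / √p.δ) ^ 2) * (L ^ 2 / n)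

/-- The factor of the decrease of the preconditioner in the descent inequality. -/
noncomputable def precondFactor (p : Params) (L b : ℝ) : ℝ :=
  (p.α * p.β₁ / (1 - p.β₁) + L * (p.α * p.β₁ / (1 - p.β₁)) ^ 2 * (1 / √p.δ)) * b ^ 2

theorem precondFactor_nonneg (hp : p.Admissible) {L b : ℝ} (hL : 0 ≤ L) :
    0 ≤ precondFactor p L b := by
  have hc : 0 ≤ p.α * p.β₁ / (1 - p.β₁) :=
    div_nonneg (mul_nonneg hp.α_pos.le hp.β₁_pos.le) (by linarith [hp.β₁_lt_one])
  unfold precondFactor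
  positivity

variable {f : Fin n → Vec d → ℝ} {L b : ℝ} (hn : 0 < n) (hp : p.Admissible)
  (hW : W ∈ doublyStochastic ℝ (Fin n)) (hL0 : 0 ≤ L) (hf : ∀ i, Differentiable ℝ (f i))
  (hL : ∀ i x y, ‖gradient (f i) x - gradient (f i) y‖ ≤ L * ‖x - y‖)
  (hfb : ∀ i x k, |gradient (f i) x k| ≤ b)
  (hα₁ : 24 * L * √(b ^ 2 + p.δ) * p.α ≤ p.δ)
  (hg : ∀ t i, ‖grad i ((run p W grad Q s r t).x i) (s t i)‖ ≤ B)
  (hgb : ∀ t i k, |grad i ((run p W grad Q s r t).x i) (s t i) k| ≤ b)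
  {z : ℕ → Vec d} (hz : z = auxSeq p.β₁ fun t => avg (run p W grad Q s r t).x)

include hn hp hW hL0 hf hL hfb hα₁ hg hgb hz

theorem descent_step (t : ℕ) :
    globalObj f (z (t + 1))
        + p.α / (4 * √(b ^ 2 + p.δ)) * ‖gradient (globalObj f) (avg (run p W grad Q s r t).x)‖ ^ 2
      ≤ globalObj f (z t)
        + consensusFactor n p L * consensusError (run p W grad Q s r t).x
        + noiseTerm p L (gradient (globalObj f) (z t))
          (avg fun i => gradient (f i) ((run p W grad Q s r t).x i))
          (avg fun i => grad i ((run p W grad Q s r t).x i) (s t i)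
            - gradient (f i) ((run p W grad Q s r t).x i))
        + driftTerm d p L B b t
        + precondFactor p L b * ((run p W grad Q s r t).meanPrecond p.δ
          - (run p W grad Q s r (t + 1)).meanPrecond p.δ) := by
  have hδ := hp.δ_pos
  have hα := hp.α_pos.le
  have hR : 0 < √(b ^ 2 + p.δ) := Real.sqrt_pos.2 (by positivity)
  have hRh : 1 / √(b ^ 2 + p.δ) ≤ 1 / √p.δ := by
    have := sq_nonneg b
    gcongr
    linarith
  have hh2 : (1 / √p.δ) ^ 2 = 1 / p.δ := by rw [div_pow, Real.sq_sqrt hδ.le, one_pow]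
  have hα₁' : 24 * L * √(b ^ 2 + p.δ) * p.α * (1 / √p.δ) ^ 2 ≤ 1 := by
    rw [hh2, mul_one_div, div_le_one hδ]
    exact hα₁
  set x := (run p W grad Q s r t).x with hx
  set N := avg fun i => gradient (f i) (x i) with hN
  set e := avg fun i => grad i (x i) (s t i) - gradient (f i) (x i) with he
  have hNe : (avg fun i => grad i (x i) (s t i)) = N + e := by
    rw [he, avg_sub, hN]
    abel
  have h1 := globalObj_auxSeq_succ_le (W := W) (Q := Q) (r := r) hn hp hgb hW hL0 hf hL hfb t hz
  rw [← hx, hNe] at h1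
  have h2 := neg_inner_add_norm_sq_le (gradient (globalObj f) (avg x)) (gradient (globalObj f) (z t))
    N e hα hL0 hR hRh hα₁'
  have h3 : ‖gradient (globalObj f) (z t) - gradient (globalObj f) (avg x)‖ ^ 2
      ≤ L ^ 2 * ((p.α * p.β₁ / (1 - p.β₁)) ^ 2 * (B ^ 2 / p.δ)) := by
    have h4 := pow_le_pow_left₀ (norm_nonneg _)
      (norm_gradient_globalObj_sub_le hn hf hL (z t) (avg x)) 2
    rw [mul_pow] at h4
    refine h4.trans (mul_le_mul_of_nonneg_left ?_ (sq_nonneg L))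
    rw [hz]
    exact norm_auxSeq_run_sub_sq_le hn hp hW hg t
  have h4 := norm_avg_gradient_sub_sq_le hn hf hL x
  rw [← hN] at h4
  have h5 := mul_le_mul_of_nonneg_left h3 (by positivity : 0 ≤ 3 / 2 * p.α * (1 / √p.δ))
  have h6 := mul_le_mul_of_nonneg_left h4
    (by positivity : 0 ≤ 3 / 2 * p.α * (1 / √p.δ) + 4 * L * p.α ^ 2 * (1 / √p.δ) ^ 2)
  unfold consensusFactor noiseTerm driftTerm precondFactor
  linarith

theorem sum_descent_le (T : ℕ) :
    p.α / (4 * √(b ^ 2 + p.δ)) * ∑ t ∈ Finset.range T,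
        ‖gradient (globalObj f) (avg (run p W grad Q s r t).x)‖ ^ 2
      ≤ globalObj f (z 0) - globalObj f (z T)
        + consensusFactor n p L * ∑ t ∈ Finset.range T, consensusError (run p W grad Q s r t).x
        + ∑ t ∈ Finset.range T, noiseTerm p L (gradient (globalObj f) (z t))
          (avg fun i => gradient (f i) ((run p W grad Q s r t).x i))
          (avg fun i => grad i ((run p W grad Q s r t).x i) (s t i)
            - gradient (f i) ((run p W grad Q s r t).x i))
        + (∑ t ∈ Finset.range T, driftTerm d p L B b t
          + precondFactor p L b * (d * (1 / √p.δ))) := by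
  -- The induction keeps the preconditioner difference exact; afterwards the final trace is dropped
  -- as nonnegative and the initial one is d/√δ because u starts at 0.
  have key : ∀ T : ℕ, p.α / (4 * √(b ^ 2 + p.δ)) * ∑ t ∈ Finset.range T,
        ‖gradient (globalObj f) (avg (run p W grad Q s r t).x)‖ ^ 2
      ≤ globalObj f (z 0) - globalObj f (z T)
        + consensusFactor n p L * ∑ t ∈ Finset.range T, consensusError (run p W grad Q s r t).x
        + ∑ t ∈ Finset.range T, noiseTerm p L (gradient (globalObj f) (z t))
          (avg fun i => gradient (f i) ((run p W grad Q s r t).x i))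
          (avg fun i => grad i ((run p W grad Q s r t).x i) (s t i)
            - gradient (f i) ((run p W grad Q s r t).x i))
        + (∑ t ∈ Finset.range T, driftTerm d p L B b t
          + precondFactor p L b * ((run p W grad Q s r 0).meanPrecond p.δ
            - (run p W grad Q s r T).meanPrecond p.δ)) := by
    intro T
    induction T with
    | zero => simp
    | succ T ih =>
      simp only [Finset.sum_range_succ]
      linarith [descent_step hn hp hW hL0 hf hL hfb hα₁ hg hgb hz T]
  refine (key T).trans (add_le_add_right (add_le_add_right
    (mul_le_mul_of_nonneg_left ?_ (precondFactor_nonneg hp hL0)) _) _)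
  have h1 : 0 ≤ (run p W grad Q s r T).meanPrecond p.δ :=
    mul_nonneg (by positivity) (Finset.sum_nonneg fun i _ => Finset.sum_nonneg fun k _ =>
      run_precond_nonneg i k T p.δ)
  have hn' : (n : ℝ) ≠ 0 := by positivity
  have h2 : (run p W grad Q s r 0).meanPrecond p.δ = d * (1 / √p.δ) := by
    simp [State.meanPrecond, State.precond, run, State.init, hn']
  linarith

end PathBounds

/-! ### Comparison with the stated constants -/

section Bound

/-- Since 1/√δ ≤ √(B_∞² + δ)/δ, the coefficient 3/(2√δ) is below the stated bracket. The remaining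
slack is 4 against 6 in the L³ term and 8 against 24 in the variance term. -/
theorem sum_le_gradientBound {n d T : ℕ} {p : Params} (hp : p.Admissible) {L B b C gap S : ℝ}
    (hn : 0 < n) (hL : 0 ≤ L) (hS0 : 0 ≤ S) (hS : S ≤ T * (p.α ^ 2 * C)) :
    gap + consensusFactor n p L * S
        + T * (2 * L * p.α ^ 2 * (1 / √p.δ) ^ 2 * (4 * B ^ 2 / n))
        + (∑ t ∈ Finset.range T, driftTerm d p L B b t
          + precondFactor p L b * (d * (1 / √p.δ)))
      ≤ gradientBound n d T p L B b C gap := by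
  have hα := hp.α_pos
  have hβ : 0 < 1 - p.β₁ := by linarith [hp.β₁_lt_one]
  have hδ := hp.δ_pos
  have hq : 0 < √p.δ := Real.sqrt_pos.2 hδ
  have hδq : p.δ = √p.δ ^ 2 := (Real.sq_sqrt hδ.le).symm
  have hδ3 : p.δ ^ (3 / 2 : ℝ) = √p.δ ^ 3 := by
    rw [Real.sqrt_eq_rpow, ← Real.rpow_natCast, ← Real.rpow_mul hδ.le]
    norm_num
  have hR : √p.δ ≤ √(b ^ 2 + p.δ) := Real.sqrt_le_sqrt (by linarith [sq_nonneg b])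
  have hn' : (0 : ℝ) < n := by positivity
  have hβ₂ : ∀ t : ℕ, 0 ≤ 1 - p.β₂ ^ (t + 1) := fun t =>
    sub_nonneg.2 (pow_le_one₀ hp.β₂_pos.le hp.β₂_lt_one.le)
  have hh : 1 / √p.δ ≤ √(b ^ 2 + p.δ) / p.δ := by
    have h : 1 / √p.δ = √p.δ / p.δ := by
      rw [div_eq_div_iff hq.ne' hδ.ne', one_mul, Real.mul_self_sqrt hδ.le]
    rw [h]
    gcongr
  have hU : 3 / 2 * (1 / √p.δ) ≤ √(b ^ 2 + p.δ) / p.δ + 1 / (2 * √p.δ) := by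
    have : 1 / (2 * √p.δ) = 1 / 2 * (1 / √p.δ) := by ring
    linarith
  have e1 : consensusFactor n p L * S ≤ (6 * L ^ 3 * p.α ^ 2 / (n * p.δ)
      + L ^ 2 * p.α / n * (√(b ^ 2 + p.δ) / p.δ + 1 / (2 * √p.δ))) * p.α ^ 2 * C * T := by
    have h1 : consensusFactor n p L ≤ 6 * L ^ 3 * p.α ^ 2 / (n * p.δ)
        + L ^ 2 * p.α / n * (√(b ^ 2 + p.δ) / p.δ + 1 / (2 * √p.δ)) := by
      have h2 : consensusFactor n p L
          = 4 * L ^ 3 * p.α ^ 2 / (n * p.δ) + L ^ 2 * p.α / n * (3 / 2 * (1 / √p.δ)) := by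
        unfold consensusFactor
        rw [hδq, Real.sqrt_sq hq.le]
        field_simp
        ring
      rw [h2]
      gcongr
      norm_num
    have h3 : 0 ≤ consensusFactor n p L := by
      unfold consensusFactor
      positivity
    calc consensusFactor n p L * S ≤ _ := mul_le_mul h1 hS hS0 (h3.trans h1)
      _ = _ := by ring
  have e2 : T * (2 * L * p.α ^ 2 * (1 / √p.δ) ^ 2 * (4 * B ^ 2 / n))
      ≤ 24 * L * p.α ^ 2 / (n * p.δ) * T * B ^ 2 := by
    have h1 : T * (2 * L * p.α ^ 2 * (1 / √p.δ) ^ 2 * (4 * B ^ 2 / n))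
        = 8 * L * p.α ^ 2 / (n * p.δ) * T * B ^ 2 := by
      rw [div_pow, Real.sq_sqrt hδ.le]
      field_simp
      ring
    rw [h1]
    gcongr
    norm_num
  have e3 : precondFactor p L b * (d * (1 / √p.δ))
      = p.α * p.β₁ / (1 - p.β₁) * (d * b ^ 2 / √p.δ)
        + L * p.β₁ ^ 2 * p.α ^ 2 * d * b ^ 2 / (p.δ * (1 - p.β₁) ^ 2) := by
    unfold precondFactor
    rw [hδq, Real.sqrt_sq hq.le]
    field_simp
  have e4 : ∑ t ∈ Finset.range T, driftTerm d p L B b t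
      ≤ L * p.α ^ 2 * b ^ 4 * (2 * d / p.δ ^ 2) * ∑ t ∈ Finset.range T, (1 - p.β₂ ^ (t + 1))
        + p.α * ∑ t ∈ Finset.range T, (d * b ^ 4 / p.δ ^ (3 / 2 : ℝ) * (1 - p.β₂ ^ (t + 1))
          + p.α ^ 2 * p.β₁ ^ 2 * L ^ 2 * B ^ 2 / (p.δ * (1 - p.β₁) ^ 2)
            * (√(b ^ 2 + p.δ) / p.δ + 1 / (2 * √p.δ))) := by
    rw [Finset.mul_sum, Finset.mul_sum, ← Finset.sum_add_distrib]
    refine Finset.sum_le_sum fun t _ => ?_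
    have h1 : driftTerm d p L B b t
        = L * p.α ^ 2 * b ^ 4 * (2 * d / p.δ ^ 2) * (1 - p.β₂ ^ (t + 1))
          + p.α * (d * b ^ 4 / p.δ ^ (3 / 2 : ℝ) * (1 - p.β₂ ^ (t + 1))
            + p.α ^ 2 * p.β₁ ^ 2 * L ^ 2 * B ^ 2 / (p.δ * (1 - p.β₁) ^ 2)
              * (3 / 2 * (1 / √p.δ))) := by
      unfold driftTerm
      rw [hδ3]
      generalize 1 - p.β₂ ^ (t + 1) = ε
      rw [hδq, Real.sqrt_sq hq.le]
      field_simp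
      ring
    rw [h1]
    gcongr
  unfold gradientBound
  linarith

end Bound

/-! ### Adaptedness and integrability of the auxiliary sequence -/

section Integrability

variable {n d : ℕ} {Ξ Z Ω : Type*} [MeasurableSpace Ξ] {p : Params} {W : Matrix (Fin n) (Fin n) ℝ}
  {grad : Fin n → Vec d → Ξ → Vec d} {Q : Z → Vec d → Vec d}
  {ξ : Fin n → ℕ → Ω → Ξ} {ζ : Fin n → ℕ → Ω → Z} [MeasurableSpace Z]

/-- By `auxSeq_run`, z^t is a function of the state after t iterations alone, so it depends only on
samples and seeds before t. -/
theorem measurable_auxSeq_iter [MeasurableSpace Ω] (hW : W ∈ doublyStochastic ℝ (Fin n))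
    (hgrad : ∀ i, Measurable fun v : Vec d × Ξ => grad i v.1 v.2)
    (hQ : Measurable fun v : Z × Vec d => Q v.1 v.2) (t : ℕ)
    (hξ : ∀ s < t, ∀ i, Measurable (ξ i s)) (hζ : ∀ s < t, ∀ i, Measurable (ζ i s)) :
    Measurable fun ω => auxSeq p.β₁ (fun s => avg (iter p W grad Q ξ ζ s ω).x) t := by
  have hS := measurable_run (p := p) (W := W) hgrad hQ t hξ hζ
  have h : (fun ω => auxSeq p.β₁ (fun s => avg (iter p W grad Q ξ ζ s ω).x) t) = fun ω =>
      avg (iter p W grad Q ξ ζ t ω).x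
        - (p.α * p.β₁ / (1 - p.β₁)) • avg ((iter p W grad Q ξ ζ t ω).dir p.δ) :=
    funext fun ω => auxSeq_run hW t
  rw [h]
  have hdir : Measurable fun ω => avg ((iter p W grad Q ξ ζ t ω).dir p.δ) :=
    measurable_avg fun i => measurable_dir p.δ (hS.m i) (hS.u i)
  exact (measurable_avg hS.x).sub (hdir.const_smul (p.α * p.β₁ / (1 - p.β₁)))

theorem integrable_comp_of_ae_bound [MeasurableSpace Ω] {P : Measure Ω} [IsFiniteMeasure P]
    {φ : Vec d → ℝ} (hφ : Continuous φ) {U : Ω → Vec d} (hU : Measurable U) {c : ℝ}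
    (hc : ∀ᵐ ω ∂P, ‖U ω‖ ≤ c) : Integrable (fun ω => φ (U ω)) P := by
  obtain ⟨M, hM⟩ := (isCompact_closedBall (0 : Vec d) c).exists_bound_of_continuousOn
    hφ.continuousOn
  refine Integrable.of_bound (hφ.measurable.comp hU).aestronglyMeasurable M ?_
  filter_upwards [hc] with ω h
  exact hM _ (by simpa using h)

end Integrability

/-! ### Expectation of the noise contribution -/

section NoiseTerm

variable {d : ℕ} {Ω : Type*} [MeasurableSpace Ω] {P : Measure Ω} [IsFiniteMeasure P]

theorem integrable_noiseTerm (p : Params) (L : ℝ) {V N e : Ω → Vec d} (hV : Measurable V)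
    (hN : Measurable N) (he : Measurable e) {a c : ℝ} (hVa : ∀ᵐ ω ∂P, ‖V ω‖ ≤ a)
    (hNa : ∀ᵐ ω ∂P, ‖N ω‖ ≤ a) (hec : ∀ᵐ ω ∂P, ‖e ω‖ ≤ c) :
    Integrable (fun ω => noiseTerm p L (V ω) (N ω) (e ω)) P := by
  have h := integrable_inner_of_ae_bound he he hec hec
  simp only [real_inner_self_eq_norm_sq] at h
  exact (((integrable_inner_of_ae_bound hV he hVa hec).const_mul _).add
    ((integrable_inner_of_ae_bound hN he hNa hec).const_mul _)).add (h.const_mul _)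

theorem integral_noiseTerm (p : Params) (L : ℝ) {V N e : Ω → Vec d} (hV : Measurable V)
    (hN : Measurable N) (he : Measurable e) {a c : ℝ} (hVa : ∀ᵐ ω ∂P, ‖V ω‖ ≤ a)
    (hNa : ∀ᵐ ω ∂P, ‖N ω‖ ≤ a) (hec : ∀ᵐ ω ∂P, ‖e ω‖ ≤ c)
    (hVe : ∫ ω, inner ℝ (V ω) (e ω) ∂P = 0) (hNe : ∫ ω, inner ℝ (N ω) (e ω) ∂P = 0) :
    ∫ ω, noiseTerm p L (V ω) (N ω) (e ω) ∂P
      = 2 * L * p.α ^ 2 * (1 / √p.δ) ^ 2 * ∫ ω, ‖e ω‖ ^ 2 ∂P := by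
  have h := integrable_inner_of_ae_bound he he hec hec
  simp only [real_inner_self_eq_norm_sq] at h
  have h1 := (integrable_inner_of_ae_bound hV he hVa hec).const_mul (-(p.α * (1 / √p.δ)))
  have h2 := (integrable_inner_of_ae_bound hN he hNa hec).const_mul
    (4 * L * p.α ^ 2 * (1 / √p.δ) ^ 2)
  have h3 := h.const_mul (2 * L * p.α ^ 2 * (1 / √p.δ) ^ 2)
  refine (integral_add' (h1.add h2) h3).trans ?_
  rw [integral_add' h1 h2, integral_const_mul, integral_const_mul, integral_const_mul, hVe, hNe]
  simp

end NoiseTerm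

end DAMSCo

/-- The step-size conditions are multiplied out, so that L = 0 or η = 0 makes the corresponding
quotient condition vacuous. -/
theorem mainTheorem1 {n d : ℕ} (hn : 0 < n)
    {Ξ Z Ω : Type*} [MeasurableSpace Ξ] [MeasurableSpace Z] [MeasurableSpace Ω]
    (P : Measure Ω) [IsProbabilityMeasure P]
    (D : Fin n → Measure Ξ) [∀ i, IsProbabilityMeasure (D i)]
    (ν : Measure Z) [IsProbabilityMeasure ν]
    (F : Fin n → DAMSCo.Vec d → Ξ → ℝ) (f : Fin n → DAMSCo.Vec d → ℝ) (L : ℝ)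
    (hf : DAMSCo.IsSmoothProblem D F f L)
    (G : SimpleGraph (Fin n)) (hG : G.Connected)
    (W : Matrix (Fin n) (Fin n) ℝ) (hW : DAMSCo.IsMixingMatrix G W)
    (Q : Z → DAMSCo.Vec d → DAMSCo.Vec d) (η : ℝ) (hη0 : 0 ≤ η) (hη1 : η < 1)
    (hQ : DAMSCo.IsCompressor ν Q η)
    (ξ : Fin n → ℕ → Ω → Ξ) (ζ : Fin n → ℕ → Ω → Z)
    (hξζ : DAMSCo.IsSampling P D ν ξ ζ)
    (p : DAMSCo.Params) (hp : p.Admissible) (T : ℕ) (hT : 0 < T)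
    (X : ℕ → Ω → Fin n → DAMSCo.Vec d)
    (hX : ∀ t ω, X t ω = (DAMSCo.run p W (DAMSCo.stochGrad F) Q
      (fun t i => ξ i t ω) (fun t i => ζ i t ω) t).x)
    (B Binf : ℝ) (hB : DAMSCo.HasBoundedGradients P D F f ξ X B Binf)
    (hα₁ : 24 * L * √(Binf ^ 2 + p.δ) * p.α ≤ p.δ)
    (hα₂ : p.α ≤ (1 - η ^ 2) ^ 2 / 32)
    (hγ₁ : 60 * η * p.γ ≤ 1 - DAMSCo.rhoHat p.γ W ^ 2)
    (hγ₂ : p.γ ≤ (1 - η ^ 2) / 25)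
    (hγ₃ : η * p.γ ≤ p.α)
    (C : ℝ) (hC : C = DAMSCo.consensusConst n p.α p.δ η B (DAMSCo.rhoHat p.γ W))
    (z : ℕ → Ω → DAMSCo.Vec d)
    (hz : ∀ t ω, z t ω = DAMSCo.auxSeq p.β₁ (fun s => DAMSCo.avg (X s ω)) t) :
    DAMSCo.rhoHat p.γ W < 1 ∧
    (∀ t, Integrable (fun ω => DAMSCo.consensusError (X t ω)) P) ∧
    (∀ t, Integrable (fun ω => ‖gradient (DAMSCo.globalObj f) (DAMSCo.avg (X t ω))‖ ^ 2) P) ∧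
    (∀ t, Integrable (fun ω => DAMSCo.globalObj f (z t ω)) P) ∧
    (1 / (T : ℝ)) * ∑ t ∈ Finset.range T, ∫ ω, DAMSCo.consensusError (X t ω) ∂P
      ≤ p.α ^ 2 * C ∧
    p.α / (4 * √(Binf ^ 2 + p.δ)) * ∑ t ∈ Finset.range T,
        ∫ ω, ‖gradient (DAMSCo.globalObj f) (DAMSCo.avg (X t ω))‖ ^ 2 ∂P
      ≤ DAMSCo.gradientBound n d T p L B Binf C
          (∫ ω, (DAMSCo.globalObj f (z 0 ω) - DAMSCo.globalObj f (z T ω)) ∂P) ∧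
    p.α / (4 * √(Binf ^ 2 + p.δ)) * ∑ t ∈ Finset.range T,
        ∫ ω, ‖gradient (DAMSCo.globalObj f) (DAMSCo.avg (X t ω))‖ ^ 2 ∂P
      ≤ DAMSCo.gradientBound n d T p L B Binf C
          (DAMSCo.globalObj f 0 - ⨅ x, DAMSCo.globalObj f x) := by
  obtain rfl : X = fun t ω => (DAMSCo.iter p W (DAMSCo.stochGrad F) Q ξ ζ t ω).x :=
    funext fun t => funext fun ω => hX t ω
  obtain rfl : z = fun t ω => DAMSCo.auxSeq p.β₁ (fun s =>
      DAMSCo.avg (DAMSCo.iter p W (DAMSCo.stochGrad F) Q ξ ζ s ω).x) t :=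
    funext fun t => funext fun ω => hz t ω
  have hρ := DAMSCo.rhoHat_lt_one hn hp.γ_pos hp.γ_le_one hW.rho_lt_one
  have hWd := hW.doublyStochastic
  have hgB : ∀ᵐ ω ∂P, ∀ t i, ‖DAMSCo.stochGrad F i
      ((DAMSCo.iter p W (DAMSCo.stochGrad F) Q ξ ζ t ω).x i) (ξ i t ω)‖ ≤ B :=
    ae_all_iff.2 fun t => ae_all_iff.2 fun i => hB.stoch_le i t
  have hgb : ∀ᵐ ω ∂P, ∀ t i k, |DAMSCo.stochGrad F i
      ((DAMSCo.iter p W (DAMSCo.stochGrad F) Q ξ ζ t ω).x i) (ξ i t ω) k| ≤ Binf :=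
    ae_all_iff.2 fun t => ae_all_iff.2 fun i => hB.stoch_inf_le i t
  have hgrad := hf.measurable_stochGrad
  have hcont : ∀ i, Continuous (gradient (f i)) := fun i =>
    (LipschitzWith.of_dist_le_mul (K := ⟨L, hf.L_nonneg⟩) fun x y => by
      rw [dist_eq_norm, dist_eq_norm]
      exact hf.smooth i x y).continuous
  have hgcont : Continuous (gradient (DAMSCo.globalObj f)) :=
    (LipschitzWith.of_dist_le_mul (K := ⟨L, hf.L_nonneg⟩) fun x y => by
      rw [dist_eq_norm, dist_eq_norm]
      exact DAMSCo.norm_gradient_globalObj_sub_le hn hf.differentiable hf.smooth x y).continuous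
  have hfcont : Continuous (DAMSCo.globalObj f) := continuous_iff_continuousAt.2 fun x =>
    (DAMSCo.hasGradientAt_globalObj hf.differentiable x).continuousAt
  have hGB : ∀ x, ‖gradient (DAMSCo.globalObj f) x‖ ≤ B := fun x => by
    rw [DAMSCo.gradient_globalObj hf.differentiable]
    exact DAMSCo.norm_avg_le hn _ fun i => hB.grad_le i x
  have hS := DAMSCo.meas_iter (p := p) (W := W) hgrad hQ.measurable hξζ
  have hzm : ∀ t, Measurable fun ω => DAMSCo.auxSeq p.β₁ (fun s =>
      DAMSCo.avg (DAMSCo.iter p W (DAMSCo.stochGrad F) Q ξ ζ s ω).x) t := fun t =>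
    DAMSCo.measurable_auxSeq_iter hWd hgrad hQ.measurable t
      (fun s _ i => hξζ.measurable_sample i s) fun s _ i => hξζ.measurable_seed i s
  have hp_int := fun t => (DAMSCo.integrable_consensusError_and_residual hn hWd hp hgrad hQ hξζ
    hgB hρ t).1
  have hG_int : ∀ t, Integrable (fun ω => ‖gradient (DAMSCo.globalObj f) (DAMSCo.avg
      (DAMSCo.iter p W (DAMSCo.stochGrad F) Q ξ ζ t ω).x)‖ ^ 2) P := fun t =>
    Integrable.of_bound ((hgcont.measurable.comp
      (DAMSCo.measurable_avg (hS t).x)).norm.pow_const 2).aestronglyMeasurable (B ^ 2)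
      (Filter.Eventually.of_forall fun ω => by
        rw [Real.norm_of_nonneg (sq_nonneg _)]
        exact pow_le_pow_left₀ (norm_nonneg _) (hGB _) 2)
  have hz_int : ∀ t, Integrable (fun ω => DAMSCo.globalObj f (DAMSCo.auxSeq p.β₁ (fun s =>
      DAMSCo.avg (DAMSCo.iter p W (DAMSCo.stochGrad F) Q ξ ζ s ω).x) t)) P := fun t =>
    DAMSCo.integrable_comp_of_ae_bound hfcont (hzm t)
      (hgB.mono fun ω h => DAMSCo.norm_auxSeq_run_le (s := fun t i => ξ i t ω) hn hp hWd h t)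
  have hcons := DAMSCo.sum_integral_consensusError_le hn hWd hp hgrad hQ hξζ hgB hρ hη0 hη1 hα₂
    hγ₁ hγ₂ hγ₃ hT
  rw [← hC] at hcons
  have hT' : (0 : ℝ) < T := by exact_mod_cast hT
  have hψ : ∀ i, Measurable (gradient (f i)) := fun i => (hcont i).measurable
  have hNm : ∀ t, Measurable fun ω => DAMSCo.avg fun i => gradient (f i)
      ((DAMSCo.iter p W (DAMSCo.stochGrad F) Q ξ ζ t ω).x i) := fun t =>
    DAMSCo.measurable_avg fun i => (hψ i).comp ((hS t).x i)
  have hem : ∀ t, Measurable fun ω => DAMSCo.avg (DAMSCo.noise (DAMSCo.stochGrad F)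
      (fun i => gradient (f i)) (DAMSCo.iter p W (DAMSCo.stochGrad F) Q ξ ζ) ξ t ω) := fun t =>
    DAMSCo.measurable_avg fun i => DAMSCo.measurable_noise hgrad hψ hQ.measurable hξζ t i
  have hVB : ∀ t, ∀ᵐ ω ∂P, ‖gradient (DAMSCo.globalObj f) (DAMSCo.auxSeq p.β₁ (fun s =>
      DAMSCo.avg (DAMSCo.iter p W (DAMSCo.stochGrad F) Q ξ ζ s ω).x) t)‖ ≤ B := fun t =>
    Filter.Eventually.of_forall fun ω => hGB _
  have hNB : ∀ t, ∀ᵐ ω ∂P, ‖DAMSCo.avg fun i => gradient (f i)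
      ((DAMSCo.iter p W (DAMSCo.stochGrad F) Q ξ ζ t ω).x i)‖ ≤ B := fun t =>
    Filter.Eventually.of_forall fun ω => DAMSCo.norm_avg_le hn _ fun i => hB.grad_le i _
  have heB : ∀ t, ∀ᵐ ω ∂P, ‖DAMSCo.avg (DAMSCo.noise (DAMSCo.stochGrad F)
      (fun i => gradient (f i)) (DAMSCo.iter p W (DAMSCo.stochGrad F) Q ξ ζ) ξ t ω)‖ ≤ 2 * B :=
    fun t => (DAMSCo.ae_norm_noise_le hgB hB.grad_le).mono fun ω h =>
      DAMSCo.norm_avg_le hn _ (h t)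
  have hVe := fun t => DAMSCo.integral_inner_avg_noise_eq_zero hgrad hψ hQ.measurable hξζ hgB
    hB.grad_le hB.unbiased t (hVB t) fun m h1 h2 => by
      let := m
      exact hgcont.measurable.comp (DAMSCo.measurable_auxSeq_iter hWd hgrad hQ.measurable t h1
        fun s _ j => h2 j s)
  have hNe := fun t => DAMSCo.integral_inner_avg_noise_eq_zero hgrad hψ hQ.measurable hξζ hgB
    hB.grad_le hB.unbiased t (hNB t) fun m h1 h2 => by
      let := m
      exact DAMSCo.measurable_avg fun i => (hψ i).comp
        ((DAMSCo.measurable_run hgrad hQ.measurable t h1 fun s _ j => h2 j s).x i)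
  have hn_int := fun t => DAMSCo.integrable_noiseTerm p L (hgcont.measurable.comp (hzm t)) (hNm t)
    (hem t) (hVB t) (hNB t) (heB t)
  have hn_le : ∀ t ∈ Finset.range T, _ := fun t _ => (DAMSCo.integral_noiseTerm p L
    (hgcont.measurable.comp (hzm t)) (hNm t) (hem t) (hVB t) (hNB t) (heB t) (hVe t)
    (hNe t)).trans_le (mul_le_mul_of_nonneg_left (DAMSCo.integral_norm_avg_noise_sq_le hn hgrad hψ
      hQ.measurable hξζ hgB hB.grad_le hB.unbiased t)
      (mul_nonneg (mul_nonneg (mul_nonneg zero_le_two hf.L_nonneg) (sq_nonneg _)) (sq_nonneg _)))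
  -- The descent is summed path by path, and expectations are taken only once, at the end.
  have hpath : ∀ᵐ ω ∂P, _ := (hgB.and hgb).mono fun ω h =>
    DAMSCo.sum_descent_le (s := fun t i => ξ i t ω) (r := fun t i => ζ i t ω) (W := W) (Q := Q)
      hn hp hWd hf.L_nonneg hf.differentiable hf.smooth hB.grad_inf_le hα₁ h.1 h.2 rfl T
  have hi1 := (hz_int 0).sub (hz_int T)
  have hi2 := (integrable_finsetSum (Finset.range T) fun t _ => hp_int t).const_mul
    (DAMSCo.consensusFactor n p L)
  have hi3 := integrable_finsetSum (Finset.range T) fun t _ => hn_int t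
  have hmain := integral_mono_ae ((integrable_finsetSum (Finset.range T)
    fun t _ => hG_int t).const_mul _) (((hi1.add hi2).add hi3).add (integrable_const _)) hpath
  rw [integral_const_mul, integral_finsetSum _ fun t _ => hG_int t,
    integral_add' ((hi1.add hi2).add hi3) (integrable_const _), integral_add' (hi1.add hi2) hi3,
    integral_add' hi1 hi2, integral_const_mul, integral_finsetSum _ fun t _ => hp_int t,
    integral_finsetSum _ fun t _ => hn_int t, integral_const, probReal_univ, one_smul] at hmain
  -- The gap enters additively, so any upper bound for the expected decrease will do; this serves
  -- both gradient inequalities.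
  have hfin : ∀ gap, ∫ ω, (DAMSCo.globalObj f (DAMSCo.auxSeq p.β₁ (fun s =>
      DAMSCo.avg (DAMSCo.iter p W (DAMSCo.stochGrad F) Q ξ ζ s ω).x) 0)
      - DAMSCo.globalObj f (DAMSCo.auxSeq p.β₁ (fun s =>
      DAMSCo.avg (DAMSCo.iter p W (DAMSCo.stochGrad F) Q ξ ζ s ω).x) T)) ∂P ≤ gap →
      p.α / (4 * √(Binf ^ 2 + p.δ)) * ∑ t ∈ Finset.range T,
        ∫ ω, ‖gradient (DAMSCo.globalObj f) (DAMSCo.avg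
          (DAMSCo.iter p W (DAMSCo.stochGrad F) Q ξ ζ t ω).x)‖ ^ 2 ∂P
      ≤ DAMSCo.gradientBound n d T p L B Binf C gap := by
    intro gap hgap
    refine (hmain.trans (add_le_add_left (add_le_add (add_le_add_left hgap _) ?_) _)).trans
      (DAMSCo.sum_le_gradientBound hp hn hf.L_nonneg (Finset.sum_nonneg fun t _ =>
        integral_nonneg fun ω => DAMSCo.consensusError_nonneg _) hcons)
    refine (Finset.sum_le_sum hn_le).trans (le_of_eq ?_)
    simp
  refine ⟨hρ, hp_int, hG_int, hz_int, ?_, hfin _ le_rfl, hfin _ ?_⟩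
  · rw [one_div, inv_mul_le_iff₀ hT']
    exact hcons
  · have h0 : ∀ ω, DAMSCo.auxSeq p.β₁ (fun s =>
        DAMSCo.avg (DAMSCo.iter p W (DAMSCo.stochGrad F) Q ξ ζ s ω).x) 0 = 0 := fun ω => by
      simp [DAMSCo.auxSeq, DAMSCo.iter, DAMSCo.run, DAMSCo.State.init, DAMSCo.avg]
    refine (integral_mono hi1 (integrable_const (DAMSCo.globalObj f 0
      - ⨅ x, DAMSCo.globalObj f x)) fun ω => ?_).trans (by simp)
    simp only [Pi.sub_apply, h0]
    exact sub_le_sub_left (ciInf_le hf.bddBelow _) _
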